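/- **Definitions.** An *ordinal* is a finite nonempty totally ordered set; $[n]=\{0<1<\dots<n\}$. For an ordinal $I$ let $\vec I$ be the totally ordered set of pairs of consecutive elements of $I$. A *2-ordinal* $\mathcal U$ consists of an ordinal $\mathcal C$ and, for each $c\in\vec{\mathcal C}$, an ordinal $\mathcal F_c$. Put $\vec{\mathcal F}=\bigsqcup_{c\in\vec{\mathcal C}}\vec{\mathcal F_c}$ (the set of 2-cells, ordered lexicographically), with projection $\pi:\vec{\mathcal F}\to\vec{\mathcal C}$. Given ordinals $I_f$ $(f\in\vec{\mathcal F})$ and $J$, let $\mathrm{seq}(\mathcal U)^J_{\{I_f\}}$ be the set of pairs consisting of a total order on $\mathcal I=\bigsqcup_f I_f$ and a monotone map $W:\mathcal I\to J$, such that 1. the order on $\mathcal I$ agrees with the order of each $I_f$; 2. if $i_1<i<i_2$ with $i_1,i_2\in I_f$, $i\in I_g$ and $g\ne f$, then $\pi(g)<\pi(f)$; 3. if $\pi(f)=\pi(g)=c$ and $f<g$ in $\vec{\mathcal F_c}$, then $I_f<I_g$ in $\mathcal I$. This is covariant in $J$ (composition with $W$) and contravariant in each $I_f$: for monotone $\theta_f:I'_f\to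 I_f$ with induced map $\theta:\mathcal I'\to\mathcal I$, the element of $\mathrm{seq}(\mathcal U)^J_{\{I_f\}}$ with map $W$ is sent to the pair formed by $W\circ\theta$ and the order in which $x<y$ if $\theta(x)<\theta(y)$, while elements with the same image are compared in the $I'_f$ containing both. Hence it is a functor $(\Delta^{op})^{\vec{\mathcal F}}\times\Delta\to\mathrm{Sets}$. Let $S(\mathcal U,J)$ be the poly-simplicial realization of $\mathrm{seq}(\mathcal U)^J_{\bullet,\dots,\bullet}$ with respect to all lower indices, i.e. the quotient of $\bigsqcup_{n:\vec{\mathcal F}\to\mathbb N}\mathrm{seq}(\mathcal U)^J_{\{[n_f]\}}\times\prod_f\Delta^{n_f}$ by the relation generated by $(\theta^*x,t)\sim(x,\theta_*t)$. Let $S(\mathcal U)$ be the space of decompositions of a segment of length $|\vec{\mathcal F}|$ into subsegments labelled by $\vec{\mathcal F}$, of total length $1$ for each label, whose order satisfies 1--3, up to adding or deleting subsegments of length $0$ and joining neighbouring subsegments with the same label; that is, the realization of the poly-simplicial set of the total orders above, without $W$. Let $k$ be a commutative ring and $\mathcal S(I)=C_*(\Delta^I)$ the normalized chain complex over $k$ of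 the simplex with vertex set $I$, placed in non-positive cohomological degrees; it is a cosimplicial complex. Put $$\mathcal O(\mathcal U)=\hom_\Delta\bigl(\mathcal S,\;k[\mathrm{seq}(\mathcal U)]\otimes_{(\Delta^{op})^{\vec{\mathcal F}}}\mathcal S^{\boxtimes\vec{\mathcal F}}\bigr),$$ the complex of natural families of graded maps. Its augmentation $\mathcal O(\mathcal U)\to\mathrm{triv}(\mathcal U)=k$ is induced by $\mathrm{seq}(\mathcal U)\to\{1\}$ and by the augmentations $\mathcal S(I)\to k$: it sends a family $z$ of degree $0$ to the augmentation of $z_{[0]}(v)$, where $v$ is the vertex of $\Delta^{[0]}$. **Proposition.** Let $\mathcal U$ be a 2-ordinal. (a) For each ordinal $J$, the space $S(\mathcal U,J)$ is contractible. If moreover $\vec{\mathcal F}\neq\emptyset$, then $S(\mathcal U,J)$ is homeomorphic to $S(\mathcal U)\times\Delta^J$. (b) The space $S(\mathcal U)$ is homeomorphic to a finite product of simplices. (c) For each commutative ring $k$, the augmentation $\mathcal O(\mathcal U)\to\mathrm{triv}(\mathcal U)=k$ is a quasi-isomorphism. -/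

import Mathlib

open CategoryTheory Opposite

universe u v w

/-! ### Ordinals and 2-ordinals -/

/-- The set of pairs of consecutive elements of a totally ordered set `I`
(an element is an "arrow" from `i` to its immediate successor `j`). -/
def Arr (I : Type u) [LinearOrder I] : Type u := {e : I × I // e.1 ⋖ e.2}

namespace Arr

variable {I : Type u} [LinearOrder I]

/-- The source of a pair of consecutive elements. -/
def src (e : Arr I) : I := e.1.1

theorem src_injective : Function.Injective (src : Arr I → I) := by
  rintro ⟨⟨a, b⟩, h⟩ ⟨⟨a', b'⟩, h'⟩ (rfl : a = a')
  have hb : b = b' := h.unique_right h'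
  subst hb
  rfl

/-- The order on `Arr I` induced by that of `I`. -/
noncomputable instance : LinearOrder (Arr I) := LinearOrder.lift' src src_injective

instance [Finite I] : Finite (Arr I) := inferInstanceAs (Finite {e : I × I // e.1 ⋖ e.2})

noncomputable instance [Finite I] : Fintype (Arr I) := Fintype.ofFinite _

end Arr

/-- A 2-ordinal: a finite nonempty totally ordered set `C`, and, for each pair `c` of consecutive
elements of `C`, a finite nonempty totally ordered set `F c`. -/
structure TwoOrdinal where
  C : Type u
  [linC : LinearOrder C]
  [finC : Finite C]
  [neC : Nonempty C]
  F : Arr C → Type u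
  [linF : ∀ c, LinearOrder (F c)]
  [finF : ∀ c, Finite (F c)]
  [neF : ∀ c, Nonempty (F c)]

namespace TwoOrdinal

attribute [instance] linC finC neC linF finF neF

/-- The set of 2-cells of a 2-ordinal, i.e. the disjoint union over the
pairs `c` of consecutive elements of `C` of the sets of pairs of consecutive elements of `F c`.
The first projection is the 2-tree `π` of the 2-ordinal. -/
abbrev Cells (U : TwoOrdinal.{u}) : Type u := Σ c : Arr U.C, Arr (U.F c)

/-- The 2-cells, listed in increasing (lexicographic) order. -/
noncomputable def cellList (U : TwoOrdinal.{u}) : List U.Cells :=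
  ((Finset.univ : Finset (Σₗ c : Arr U.C, Arr (U.F c))).sort (· ≤ ·)).map ofLex

/-- The total orders on the disjoint union `Σ f, I f` which are allowed in `seq(U)`. In `agrees`,
`x ≤ y` is the order of the disjoint union, in which only elements of the same `I f` are
comparable. -/
@[ext]
structure CellOrder (U : TwoOrdinal.{u}) (I : U.Cells → Type w) [∀ f, LinearOrder (I f)] where
  le : (Σ f, I f) → (Σ f, I f) → Prop
  trans : ∀ x y z, le x y → le y z → le x z
  antisymm : ∀ x y, le x y → le y x → x = y
  total : ∀ x y, le x y ∨ le y x
  /-- 1) The order agrees with the order of each `I f`. -/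
  agrees : ∀ x y, x ≤ y → le x y
  /-- 2) If an element of `I g` lies between two elements of `I f`, and `g ≠ f`,
  then `π g < π f`. -/
  nested : ∀ (f g : U.Cells) (i₁ i₂ : I f) (i : I g), g ≠ f →
    le ⟨f, i₁⟩ ⟨g, i⟩ → le ⟨g, i⟩ ⟨f, i₂⟩ → g.1 < f.1
  /-- 3) If `π f = π g = c` and `f < g`, then all of `I f` precedes all of `I g`. -/
  separated : ∀ (c : Arr U.C) (f g : Arr (U.F c)), f < g →
    ∀ (i : I ⟨c, f⟩) (j : I ⟨c, g⟩), le ⟨⟨c, f⟩, i⟩ ⟨⟨c, g⟩, j⟩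

/-- The set `seq(U)` for the colouring of the 2-cells by the ordinals `I f`, and the
outer colour `J`: an allowed total order on `Σ f, I f`, and a monotone map from it to `J`. -/
@[ext]
structure Seq (U : TwoOrdinal.{u}) (I : U.Cells → Type w) [∀ f, LinearOrder (I f)]
    (J : Type v) [LinearOrder J] extends CellOrder U I where
  W : (Σ f, I f) → J
  monotone_W : ∀ x y, le x y → W x ≤ W y

section Functoriality

variable {U : TwoOrdinal.{u}} {I I' : U.Cells → Type w} [∀ f, LinearOrder (I f)]
  [∀ f, LinearOrder (I' f)]

/-- The map of disjoint unions induced by a family of monotone maps. -/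
def sumMap (θ : ∀ f, I' f →o I f) (x : Σ f, I' f) : Σ f, I f := ⟨x.1, θ x.1 x.2⟩

theorem sumMap_mono (θ : ∀ f, I' f →o I f) {x y : Σ f, I' f} (h : x ≤ y) :
    sumMap θ x ≤ sumMap θ y := by
  obtain ⟨f, a, b, hab⟩ := h
  exact Sigma.LE.fiber f _ _ ((θ f).monotone hab)

theorem le_or_of_sumMap_eq (θ : ∀ f, I' f →o I f) {x y : Σ f, I' f}
    (h : sumMap θ x = sumMap θ y) : x ≤ y ∨ y ≤ x := by
  obtain ⟨f, i⟩ := x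
  obtain ⟨g, j⟩ := y
  obtain rfl : f = g := congrArg Sigma.fst h
  rcases le_total i j with h | h
  · exact Or.inl (Sigma.LE.fiber f _ _ h)
  · exact Or.inr (Sigma.LE.fiber f _ _ h)

/-- The order on `Σ f, I' f` for which `x < y` if the image of `x` precedes the image of `y` in
`Σ f, I f`, and elements `x`, `y` with the same image are compared in the `I' f` that
contains both. -/
def CellOrder.pullback (s : CellOrder U I) (θ : ∀ f, I' f →o I f) : CellOrder U I' where
  le x y := x ≤ y ∨ (sumMap θ x ≠ sumMap θ y ∧ s.le (sumMap θ x) (sumMap θ y))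
  trans x y z := by
    rintro (h | ⟨h, h'⟩) (k | ⟨k, k'⟩)
    · exact Or.inl (h.trans k)
    · by_cases e : sumMap θ x = sumMap θ y
      · exact Or.inr ⟨e ▸ k, e ▸ k'⟩
      · have h' := s.agrees _ _ (sumMap_mono θ h)
        refine Or.inr ⟨fun e' => e (s.antisymm _ _ h' (e' ▸ k')), s.trans _ _ _ h' k'⟩
    · by_cases e : sumMap θ y = sumMap θ z
      · exact Or.inr ⟨e ▸ h, e ▸ h'⟩
      · have k' := s.agrees _ _ (sumMap_mono θ k)
        refine Or.inr ⟨fun e' => e (s.antisymm _ _ k' (e' ▸ h')), s.trans _ _ _ h' k'⟩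
    · exact Or.inr ⟨fun e' => h (s.antisymm _ _ h' (e' ▸ k')), s.trans _ _ _ h' k'⟩
  antisymm x y := by
    rintro (h | ⟨h, h'⟩) (k | ⟨k, k'⟩)
    · exact le_antisymm h k
    · exact absurd (s.antisymm _ _ k' (s.agrees _ _ (sumMap_mono θ h))) k
    · exact absurd (s.antisymm _ _ h' (s.agrees _ _ (sumMap_mono θ k))) h
    · exact absurd (s.antisymm _ _ h' k') h
  total x y := by
    by_cases e : sumMap θ x = sumMap θ y
    · rcases le_or_of_sumMap_eq θ e with h | h
      · exact Or.inl (Or.inl h)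
      · exact Or.inr (Or.inl h)
    · rcases s.total (sumMap θ x) (sumMap θ y) with h | h
      · exact Or.inl (Or.inr ⟨e, h⟩)
      · exact Or.inr (Or.inr ⟨fun e' => e e'.symm, h⟩)
  agrees _ _ h := Or.inl h
  nested f g i₁ i₂ i hg h k := by
    have le_of {x y : Σ f, I' f} (h : x ≤ y ∨ (sumMap θ x ≠ sumMap θ y ∧
        s.le (sumMap θ x) (sumMap θ y))) : s.le (sumMap θ x) (sumMap θ y) :=
      h.elim (fun h => s.agrees _ _ (sumMap_mono θ h)) And.right
    exact s.nested f g (θ f i₁) (θ f i₂) (θ g i) hg (le_of h) (le_of k)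
  separated c f g hfg i j := by
    refine Or.inr ⟨fun e => ?_, s.separated c f g hfg _ _⟩
    have e₁ : (⟨c, f⟩ : U.Cells) = ⟨c, g⟩ := congrArg Sigma.fst e
    have e₂ : f = g := by simpa using e₁
    exact hfg.ne e₂

theorem CellOrder.le_of_pullback_le (s : CellOrder U I) (θ : ∀ f, I' f →o I f)
    {x y : Σ f, I' f} (h : (s.pullback θ).le x y) : s.le (sumMap θ x) (sumMap θ y) :=
  h.elim (fun h => s.agrees _ _ (sumMap_mono θ h)) And.right

theorem CellOrder.refl (s : CellOrder U I) (x : Σ f, I f) : s.le x x := s.agrees _ _ le_rfl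

theorem CellOrder.pullback_id (s : CellOrder U I) :
    s.pullback (fun _ => OrderHom.id) = s := by
  ext x y
  refine ⟨fun h => s.le_of_pullback_le _ h, fun h => ?_⟩
  by_cases e : x = y
  · exact Or.inl e.le
  · exact Or.inr ⟨e, h⟩

theorem CellOrder.pullback_pullback {I'' : U.Cells → Type w} [∀ f, LinearOrder (I'' f)]
    (s : CellOrder U I) (θ : ∀ f, I' f →o I f) (η : ∀ f, I'' f →o I' f) :
    (s.pullback θ).pullback η = s.pullback (fun f => (θ f).comp (η f)) := by
  ext x y
  constructor
  · rintro (h | ⟨h, h' | ⟨h', h''⟩⟩)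
    · exact Or.inl h
    · obtain ⟨f, i⟩ := x
      obtain ⟨g, j⟩ := y
      obtain ⟨_, a, b, hab⟩ := h'
      refine Or.inl (Sigma.LE.fiber f _ _ ?_)
      by_contra hc
      exact h (congrArg (Sigma.mk f) (le_antisymm hab ((η f).monotone (le_of_not_ge hc))))
    · exact Or.inr ⟨h', h''⟩
  · rintro (h | ⟨h, h'⟩)
    · exact Or.inl h
    · exact Or.inr ⟨fun e => h (congrArg (sumMap θ) e), Or.inr ⟨h, h'⟩⟩

/-- The contravariant functoriality of `seq(U)` in the ordinals `I f`. -/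
def Seq.pullback {J : Type v} [LinearOrder J] (s : Seq U I J) (θ : ∀ f, I' f →o I f) :
    Seq U I' J where
  toCellOrder := s.toCellOrder.pullback θ
  W x := s.W (sumMap θ x)
  monotone_W _ _ h := s.monotone_W _ _ (s.toCellOrder.le_of_pullback_le θ h)

/-- The covariant functoriality of `seq(U)` in the ordinal `J`. -/
def Seq.push {J : Type v} [LinearOrder J] {J' : Type v} [LinearOrder J'] (s : Seq U I J)
    (σ : J →o J') : Seq U I J' where
  toCellOrder := s.toCellOrder
  W x := σ (s.W x)
  monotone_W _ _ h := σ.monotone (s.monotone_W _ _ h)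

end Functoriality

/-- The poly-simplicial set, with one simplicial variable for each 2-cell,
of the allowed total orders on `Σ f, [n f]`. -/
def cellOrderPoly (U : TwoOrdinal.{u}) : (U.Cells → SimplexCategory)ᵒᵖ ⥤ Type u where
  obj n := CellOrder U (fun f => Fin ((n.unop f).len + 1))
  map θ := TypeCat.ofHom fun s => s.pullback (fun f => (θ.unop f).toOrderHom)
  map_id n := by
    refine ConcreteCategory.hom_ext _ _ fun s => ?_
    exact CellOrder.pullback_id s
  map_comp θ η := by
    refine ConcreteCategory.hom_ext _ _ fun s => ?_
    exact (CellOrder.pullback_pullback s _ _).symm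

/-- The poly-simplicial set `seq(U)^J`, with one simplicial variable for each 2-cell. -/
def seqPoly (U : TwoOrdinal.{u}) (J : Type v) [LinearOrder J] :
    (U.Cells → SimplexCategory)ᵒᵖ ⥤ Type (max u v) where
  obj n := Seq U (fun f => Fin ((n.unop f).len + 1)) J
  map θ := TypeCat.ofHom fun s => s.pullback (fun f => (θ.unop f).toOrderHom)
  map_id n := by
    refine ConcreteCategory.hom_ext _ _ fun s => ?_
    exact Seq.ext (congrArg CellOrder.le s.toCellOrder.pullback_id) rfl
  map_comp θ η := by
    refine ConcreteCategory.hom_ext _ _ fun s => ?_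
    exact Seq.ext (congrArg CellOrder.le (s.toCellOrder.pullback_pullback _ _).symm) rfl

/-- The functor `J ↦ seq(U)^J` from `Δ` to poly-simplicial sets. -/
def seqFunctor (U : TwoOrdinal.{u}) :
    SimplexCategory ⥤ (U.Cells → SimplexCategory)ᵒᵖ ⥤ Type u where
  obj J := seqPoly U (Fin (J.len + 1))
  map σ := { app := fun _ => TypeCat.ofHom fun s => s.push σ.toOrderHom }

end TwoOrdinal

/-! ### Topological realization of poly-simplicial sets -/

section Realization

variable {Φ : Type u}

/-- The disjoint union, over all multi-indices `n` and all elements of `X n`, of the products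
`∏ f, Δ^[n f]` of topological simplices. -/
abbrev PolyCells (X : (Φ → SimplexCategory)ᵒᵖ ⥤ Type v) : Type (max u v) :=
  Σ p : (Σ n : Φ → SimplexCategory, X.obj (op n)), ∀ f, stdSimplex ℝ (Fin ((p.1 f).len + 1))

/-- The gluing relation `(θ^* x, t) ∼ (x, θ_* t)` for all morphisms `θ` of multi-indices. -/
inductive PolyGlue (X : (Φ → SimplexCategory)ᵒᵖ ⥤ Type v) : PolyCells X → PolyCells X → Prop
  | glue {m n : Φ → SimplexCategory} (θ : m ⟶ n) (x : X.obj (op n))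
      (t : ∀ f, stdSimplex ℝ (Fin ((m f).len + 1))) :
      PolyGlue X ⟨⟨m, X.map θ.op x⟩, t⟩
        ⟨⟨n, x⟩, fun f => stdSimplex.map (θ f).toOrderHom (t f)⟩

/-- The poly-simplicial realization of a poly-simplicial set `X` whose simplicial variables are
indexed by `Φ`: the quotient of the disjoint union of all the products of simplices by the
equivalence relation generated by the gluing relation, with the quotient topology. -/
def PolyRealization (X : (Φ → SimplexCategory)ᵒᵖ ⥤ Type v) : Type (max u v) :=
  Quot (PolyGlue X)

instance (X : (Φ → SimplexCategory)ᵒᵖ ⥤ Type v) : TopologicalSpace (PolyRealization X) :=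
  inferInstanceAs (TopologicalSpace (Quot (PolyGlue X)))

end Realization

namespace TwoOrdinal

/-- The space `S(U, J)`: the realization of `seq(U)^J` with respect to all lower indices. -/
abbrev S (U : TwoOrdinal.{u}) (J : Type v) [LinearOrder J] : Type (max u v) :=
  PolyRealization (U.seqPoly J)

/-- The space `S(U)` of decompositions of a segment into subsegments labelled by the 2-cells:
a point is given by an allowed total order of the set `Σ f, [n f]` of the subsegments, and by
the lengths of the subsegments, the lengths of those with the same label `f` having sum 1 (and
thus defining a point of `Δ^[n f]`). The gluing relation adds and deletes subsegments of length 0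
and joins adjacent subsegments with the same label. -/
abbrev S₀ (U : TwoOrdinal.{u}) : Type u := PolyRealization U.cellOrderPoly

end TwoOrdinal

/-! ### Realization by complexes -/

section Complexes

open Limits MonoidalCategory CochainComplex.HomComplex

variable (k : Type u) [CommRing k]

/-- The ground ring `k`, as a module over itself. -/
abbrev baseMod : ModuleCat.{u} k := ModuleCat.of k k

/-- The complex `k`, concentrated in degree 0. -/
noncomputable abbrev unitComplex : ChainComplex (ModuleCat.{u} k) ℕ :=
  𝟙_ (ChainComplex (ModuleCat.{u} k) ℕ)

/-- The cosimplicial complex `[n] ↦ C_*(Δ^[n])` of normalized chains of simplices. -/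
noncomputable def simplexChains : SimplexCategory ⥤ ChainComplex (ModuleCat.{u} k) ℕ :=
  SSet.stdSimplex.{u} ⋙ SSet.normalizedChainComplexFunctorObj (baseMod k)

variable {k} in
/-- The map from simplicial 0-chains to `k` sending each vertex to `1`. -/
noncomputable def vertexSum (X : SSet.{u}) : (X.chainComplex (baseMod k)).X 0 ⟶ baseMod k :=
  Sigma.desc (fun _ => 𝟙 _)

variable {k} in
theorem ι_vertexSum (X : SSet.{u}) (x : X.obj (op (SimplexCategory.mk 0))) :
    X.ιChainComplex x ≫ vertexSum (k := k) X = 𝟙 _ :=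
  Sigma.ι_desc _ _

variable {k} in
/-- The augmentation of the simplicial chains of a simplicial set, sending each vertex to `1`. -/
noncomputable def chainsAugmentation (X : SSet.{u}) :
    X.chainComplex (baseMod k) ⟶
      (HomologicalComplex.single _ (ComplexShape.down ℕ) 0).obj (baseMod k) :=
  HomologicalComplex.mkHomToSingle (vertexSum X)
    (by
      intro i hi
      obtain rfl : i = 1 := by simpa using hi.symm
      apply SSet.chainComplex_hom_ext
      intro x
      rw [SSet.ιChainComplex_d_assoc, Fin.sum_univ_two, Limits.comp_zero, Preadditive.add_comp,
        Preadditive.zsmul_comp, Preadditive.zsmul_comp, ι_vertexSum, ι_vertexSum]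
      simp)

variable {k} in
theorem chainsAugmentation_naturality {X Y : SSet.{u}} (f : X ⟶ Y) :
    SSet.chainComplexMap f (baseMod k) ≫ chainsAugmentation Y = chainsAugmentation X := by
  apply HomologicalComplex.to_single_hom_ext
  apply SSet.chainComplex_hom_ext
  intro x
  rw [HomologicalComplex.comp_f, SSet.ι_chainComplexMap_f_assoc, chainsAugmentation,
    chainsAugmentation, HomologicalComplex.mkHomToSingle_f, HomologicalComplex.mkHomToSingle_f,
    reassoc_of% (ι_vertexSum (k := k) X), reassoc_of% (ι_vertexSum (k := k) Y)]

/-- The augmentation `C_*(Δ^[n]) ⟶ k`, sending each vertex to `1`, naturally in `[n]`. -/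
noncomputable def simplexChainsAugmentation :
    simplexChains k ⟶ (Functor.const _).obj (unitComplex k) where
  app n := (SSet.stdSimplex.obj n).fromNormalizedChainComplex (baseMod k) ≫ chainsAugmentation _
  naturality m n f := by
    refine Eq.trans ?_ (Category.comp_id _).symm
    change SSet.normalizedChainComplexMap (SSet.stdSimplex.map f) (baseMod k) ≫ _ ≫ _ = _ ≫ _
    rw [SSet.normalizedChainComplexMap]
    simp only [Category.assoc,
      SSet.toNormalizedChainComplex_fromNormalizedChainComplex_assoc]
    rw [SSet.chainComplexMap_PInfty_assoc, chainsAugmentation_naturality,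
      ← SSet.toNormalizedChainComplex_fromNormalizedChainComplex, Category.assoc,
      SSet.fromNormalizedChainComplex_toNormalizedChainComplex_assoc]

/-- For a list `l` of elements of `Φ`, the functor sending `n` to the tensor product of
the complexes `C_*(Δ^[n f])` for `f` in `l`. -/
noncomputable def boxChains {Φ : Type u} :
    List Φ → ((Φ → SimplexCategory) ⥤ ChainComplex (ModuleCat.{u} k) ℕ)
  | [] => (Functor.const _).obj (unitComplex k)
  | f :: l => (Pi.eval _ f ⋙ simplexChains k) ⊗ boxChains l

/-- The augmentation of the tensor product of the complexes `C_*(Δ^[n f])`. -/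
noncomputable def boxChainsAugmentation {Φ : Type u} :
    (l : List Φ) → (boxChains k l ⟶ (Functor.const _).obj (unitComplex k))
  | [] => 𝟙 _
  | f :: l => (Functor.whiskerLeft (Pi.eval _ f) (simplexChainsAugmentation k) ⊗ₘ
      boxChainsAugmentation l) ≫ {
        app := fun _ => (λ_ (unitComplex k)).hom
        naturality := fun _ _ _ => by
          dsimp
          erw [MonoidalCategory.id_tensorHom_id]
          simp }

/-- The bifunctor `(m, n) ↦ k[X m] ⊗ G n`, the copower of the complex `G n` by the set `X m`. -/
noncomputable def copowerBifunctor {I : Type u} [Category.{v} I]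
    (G : I ⥤ ChainComplex (ModuleCat.{u} k) ℕ) :
    (Iᵒᵖ ⥤ Type u) ⥤ (Iᵒᵖ ⥤ I ⥤ ChainComplex (ModuleCat.{u} k) ℕ) :=
  (Functor.whiskeringRight _ _ _).obj (G ⋙ sigmaConst).flip

/-- The functor sending a presheaf of sets `X` on `I` to the coend `k[X] ⊗_I G`. -/
noncomputable def chainRealization {I : Type u} [Category.{u} I]
    (G : I ⥤ ChainComplex (ModuleCat.{u} k) ℕ) :
    (Iᵒᵖ ⥤ Type u) ⥤ ChainComplex (ModuleCat.{u} k) ℕ :=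
  copowerBifunctor k G ⋙ coendFunctor _ _

variable {k} in
/-- The morphism `k[X] ⊗_I G ⟶ A` induced by the augmentation `k[X] ⟶ k`
and a natural transformation from `G` to a constant functor. -/
noncomputable def chainRealizationAugmentation {I : Type u} [Category.{u} I]
    {G : I ⥤ ChainComplex (ModuleCat.{u} k) ℕ} {A : ChainComplex (ModuleCat.{u} k) ℕ}
    (α : G ⟶ (Functor.const _).obj A) (X : Iᵒᵖ ⥤ Type u) :
    (chainRealization k G).obj X ⟶ A :=
  coend.desc (F := (copowerBifunctor k G).obj X)
    (fun n => Sigma.desc (fun _ => α.app n)) (by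
      intro m n g
      have h := α.naturality g
      dsimp at h
      rw [Category.comp_id] at h
      dsimp [copowerBifunctor, sigmaConst]
      apply Sigma.hom_ext
      intro x
      simp [h])

section HomDelta

variable {k}

/-- The `n`-cochains of the complex `hom_Δ(A, K)`: families of cochains of
degree `n` from `A J` to `K J`, natural in `J`. -/
def natCochains (A K : SimplexCategory ⥤ CochainComplex (ModuleCat.{u} k) ℤ) (n : ℤ) :
    Submodule k (∀ J : SimplexCategory, Cochain (A.obj J) (K.obj J) n) where
  carrier := {z | ∀ (J J' : SimplexCategory) (σ : J ⟶ J') (p q : ℤ) (h : p + n = q),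
    (z J).v p q h ≫ (K.map σ).f q = (A.map σ).f p ≫ (z J').v p q h}
  add_mem' hz hw J J' σ p q h := by
    simp [hz J J' σ p q h, hw J J' σ p q h]
  zero_mem' J J' σ p q h := by simp
  smul_mem' c z hz J J' σ p q h := by
    simp [hz J J' σ p q h]

/-- The differential of `hom_Δ(A, K)`, `δ z = d ∘ z - (-1)^|z| z ∘ d`. -/
noncomputable def natCochainsD (A K : SimplexCategory ⥤ CochainComplex (ModuleCat.{u} k) ℤ)
    (n m : ℤ) : natCochains A K n →ₗ[k] natCochains A K m :=
  LinearMap.restrict (LinearMap.pi fun J =>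
      (δ_hom k (A.obj J) (K.obj J) n m) ∘ₗ LinearMap.proj J) (by
    intro z hz J J' σ p q h
    by_cases hnm : n + 1 = m
    · have h₁ := hz J J' σ p (q - 1) (by lia)
      have h₂ := hz J J' σ (p + 1) q (by lia)
      simp only [LinearMap.pi_apply, LinearMap.comp_apply, LinearMap.proj_apply, δ_hom_apply,
        δ_v n m hnm _ p q h (q - 1) (p + 1) rfl rfl, Preadditive.add_comp, Preadditive.comp_add,
        Linear.units_smul_comp, Linear.comp_units_smul, Category.assoc, h₂]
      rw [← HomologicalComplex.Hom.comm, reassoc_of% h₁, HomologicalComplex.Hom.comm_assoc]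
    · simp [δ_shape _ _ hnm])

/-- The complex `hom_Δ(A, K)` of two cosimplicial complexes `A` and `K`. -/
noncomputable def homDelta (A K : SimplexCategory ⥤ CochainComplex (ModuleCat.{u} k) ℤ) :
    CochainComplex (ModuleCat.{u} k) ℤ where
  X n := ModuleCat.of k (natCochains A K n)
  d n m := ModuleCat.ofHom (natCochainsD A K n m)
  shape n m h := by
    refine ModuleCat.hom_ext (LinearMap.ext fun z => Subtype.ext (funext fun J => ?_))
    exact δ_shape n m h (z.1 J)
  d_comp_d' n m l _ _ := by
    refine ModuleCat.hom_ext (LinearMap.ext fun z => Subtype.ext (funext fun J => ?_))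
    exact δ_δ n m l (z.1 J)

/-- The morphism `hom_Δ(A, K) ⟶ k` given by a morphism `v` from `k` to `A [0]` and
a morphism `ε` from `K [0]` to `k`: it sends `z` to the value at `1` of `ε ∘ z [0] ∘ v`. -/
noncomputable def homDeltaAugmentation
    {A K : SimplexCategory ⥤ CochainComplex (ModuleCat.{u} k) ℤ}
    (v : (HomologicalComplex.single _ _ 0).obj (baseMod k) ⟶ A.obj (SimplexCategory.mk 0))
    (ε : K.obj (SimplexCategory.mk 0) ⟶ (HomologicalComplex.single _ _ 0).obj (baseMod k)) :
    homDelta A K ⟶ (HomologicalComplex.single _ _ 0).obj (baseMod k) :=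
  HomologicalComplex.mkHomToSingle
    (ModuleCat.ofHom
      { toFun := fun z =>
          ((HomologicalComplex.singleObjXSelf (ComplexShape.up ℤ) 0 (baseMod k)).inv ≫ v.f 0 ≫
            (z.1 (SimplexCategory.mk 0)).v 0 0 rfl ≫ ε.f 0 ≫
            (HomologicalComplex.singleObjXSelf (ComplexShape.up ℤ) 0 (baseMod k)).hom).hom (1 : k)
        map_add' := fun z w => by simp
        map_smul' := fun c z => by simp })
    (by
      rintro i hi
      obtain rfl : i = -1 := by
        have : i + 1 = 0 := hi
        lia
      refine ModuleCat.hom_ext (LinearMap.ext fun z => ?_)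
      have h₁ : v.f 0 ≫ (A.obj (SimplexCategory.mk 0)).d 0 1 = 0 := by
        rw [HomologicalComplex.Hom.comm]; simp
      have h₂ : (K.obj (SimplexCategory.mk 0)).d (-1) 0 ≫ ε.f 0 = 0 := by
        rw [← HomologicalComplex.Hom.comm]; simp
      have h : v.f 0 ≫ (δ (-1) 0 (z.1 (SimplexCategory.mk 0))).v 0 0 rfl ≫ ε.f 0 = 0 := by
        rw [δ_v (-1) 0 rfl _ 0 0 rfl (-1) 1 rfl rfl]
        simp [h₂, reassoc_of% h₁]
      change ((HomologicalComplex.singleObjXSelf (ComplexShape.up ℤ) 0 (baseMod k)).inv ≫ v.f 0 ≫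
        (δ (-1) 0 (z.1 (SimplexCategory.mk 0))).v 0 0 rfl ≫ ε.f 0 ≫
        (HomologicalComplex.singleObjXSelf (ComplexShape.up ℤ) 0 (baseMod k)).hom).hom (1 : k) = 0
      rw [reassoc_of% h]
      simp)

end HomDelta

/-- A chain complex, regarded as a cochain complex in degrees `≤ 0`. -/
noncomputable abbrev toCochain :
    ChainComplex (ModuleCat.{u} k) ℕ ⥤ CochainComplex (ModuleCat.{u} k) ℤ :=
  ComplexShape.embeddingDownNat.extendFunctor _

/-- The complex `k` in degree 0. -/
noncomputable def toCochainUnitIso :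
    (toCochain k).obj (unitComplex k) ≅ (HomologicalComplex.single _ _ 0).obj (baseMod k) :=
  HomologicalComplex.extendSingleIso ComplexShape.embeddingDownNat (baseMod k) 0 0 rfl

/-- The morphism `k ⟶ C_*(Δ^[0])` sending `1` to the vertex of `Δ^[0]`. -/
noncomputable def vertexMap :
    unitComplex k ⟶ (simplexChains k).obj (SimplexCategory.mk 0) :=
  HomologicalComplex.mkHomFromSingle
    ((SSet.stdSimplex.obj (SimplexCategory.mk 0)).ιNormalizedChainComplex (R := baseMod k)
      (SSet.stdSimplex.objEquiv.symm (𝟙 _)))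
    (fun i hi => by simp at hi)

namespace TwoOrdinal

/-- The cosimplicial complex `k[seq(U)] ⊗ C_*(Δ^•)^{⊠ cells}`, the tensor product being the coend
over the lower indices of `seq(U)`. -/
noncomputable def seqChains (U : TwoOrdinal.{u}) :
    SimplexCategory ⥤ ChainComplex (ModuleCat.{u} k) ℕ :=
  U.seqFunctor ⋙ chainRealization k (boxChains k U.cellList)

/-- The complex `O(U) = |seq(U)| = hom_Δ(C_*(Δ^•), k[seq(U)] ⊗ C_*(Δ^•)^{⊠ cells})`. -/
noncomputable def O (U : TwoOrdinal.{u}) : CochainComplex (ModuleCat.{u} k) ℤ :=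
  homDelta (simplexChains k ⋙ toCochain k) (U.seqChains k ⋙ toCochain k)

/-- The augmentation `O(U) ⟶ triv(U) = k`. -/
noncomputable def augmentation (U : TwoOrdinal.{u}) :
    U.O k ⟶ (HomologicalComplex.single _ _ 0).obj (baseMod k) :=
  homDeltaAugmentation
    ((toCochainUnitIso k).inv ≫ (toCochain k).map (vertexMap k))
    ((toCochain k).map (chainRealizationAugmentation (boxChainsAugmentation k U.cellList) _) ≫
      (toCochainUnitIso k).hom)

end TwoOrdinal

end Complexes

/-! Algebraic half, part (c). For a fixed ordinal J, the complex k[seq(U)^J] ⊗ C_*^{⊠} is homotopy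
equivalent to k. A last element can be added to `I f`, placed after everything else and sent to the
last element of J. The cone homotopy on C_*(Δ^•) then deforms the old elements of `I f` to the new
one and collapses the label f. Conditions 2 and 3 survive if every label that still has old elements
is at most every label that receives a new one. Labels are therefore collapsed from the largest down
(`homotopy_id_collapse`), and at the end nothing of the original element of seq(U) is left, so that
the map factors through the augmentation.

These contractions are not natural in J, since monotone maps need not preserve last elements. This
does no harm: in each degree C_*(Δ^•) is a retract of a corepresentable cosimplicial module, hence
projective (`simplexChains_exists_lift`). Natural cochains can thus be constructed one source degree
at a time from objectwise data (`exists_extension`). The only obstruction is a natural map from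
C_n(Δ^•) to a constant module; it vanishes for n > 0 and is detected on the vertex for n = 0, where
it is the augmentation.

Geometric half, parts (a) and (b). A point of S(U, J) is determined by two families of numbers: for
each 2-cell g, the total length of the subsegments of strictly higher level that precede those
labelled g, and for each j, the total length sent to j. By condition 2 the first does not depend on
the subsegment of g that is used. The coordinates respect the gluing and take values in a product of
two convex sets, `positionSet` and `amountSet`.

They are injective: two points have representatives with the same strictly positive weights
(`exists_common_subdivision`), and then the positions determine the order by descending induction on
the level, while the amounts determine W. They are surjective: unit segments are inserted in
decreasing order of labels, each in one piece at its prescribed position, cutting those already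
present (`exists_isPlacement`). The number of cuts is bounded, so S(U, J) is compact and the
coordinates are a homeomorphism onto their image. On one level the positions form a monotone family
in a segment, and such families form a simplex; the amounts form a rescaled simplex as soon as there
is a 2-cell. -/

section Cone

/-! ### Cones in the simplex category -/

open SimplexCategory

/-- The extension of a monotone map by last elements. -/
def coneHom {m n : ℕ} (θ : Fin (m + 1) →o Fin (n + 1)) : Fin (m + 2) →o Fin (n + 2) where
  toFun := Fin.lastCases (Fin.last _) (fun i => (θ i).castSucc)
  monotone' := by
    intro i j h
    induction j using Fin.lastCases with
    | last => simp [Fin.le_last]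
    | cast j =>
      induction i using Fin.lastCases with
      | last => exact absurd h (by simp)
      | cast i => simpa using θ.monotone (by simpa using h)

@[simp]
theorem coneHom_castSucc {m n : ℕ} (θ : Fin (m + 1) →o Fin (n + 1)) (i : Fin (m + 1)) :
    coneHom θ i.castSucc = (θ i).castSucc :=
  Fin.lastCases_castSucc (motive := fun _ => Fin (n + 2)) _

@[simp]
theorem coneHom_last {m n : ℕ} (θ : Fin (m + 1) →o Fin (n + 1)) :
    coneHom θ (Fin.last _) = Fin.last _ :=
  Fin.lastCases_last (motive := fun _ => Fin (n + 2))

/-- The functor `[n] ↦ [n + 1]` adding a last element. -/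
def coneFunctor : SimplexCategory ⥤ SimplexCategory where
  obj n := mk (n.len + 1)
  map θ := Hom.mk (coneHom θ.toOrderHom)
  map_id n := by
    ext i : 3
    change coneHom OrderHom.id i = i
    induction i using Fin.lastCases <;> simp
  map_comp θ η := by
    ext i : 3
    change coneHom (η.toOrderHom.comp θ.toOrderHom) i =
      coneHom η.toOrderHom (coneHom θ.toOrderHom i)
    induction i using Fin.lastCases <;> simp

/-- The cone of a simplex. -/
def coneMap {q : ℕ} {n : SimplexCategory} (s : mk q ⟶ n) : mk (q + 1) ⟶ coneFunctor.obj n :=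
  coneFunctor.map s

/-- The inclusion of `[n]` in `[n + 1]` as the first elements. -/
def coneIncl (n : SimplexCategory) : n ⟶ coneFunctor.obj n :=
  Hom.mk Fin.castSuccOrderEmb.toOrderHom

theorem coneIncl_naturality {m n : SimplexCategory} (θ : m ⟶ n) :
    θ ≫ coneIncl n = coneIncl m ≫ coneFunctor.map θ := by
  ext i : 3
  exact (coneHom_castSucc θ.toOrderHom i).symm

/-- The last vertex of `[n + 1]`. -/
def coneApex (n : SimplexCategory) : mk 0 ⟶ coneFunctor.obj n :=
  Hom.mk ⟨fun _ => Fin.last _, fun _ _ _ => le_rfl⟩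

@[simp]
theorem coneApex_map {m n : SimplexCategory} (θ : m ⟶ n) :
    coneApex m ≫ coneFunctor.map θ = coneApex n := by
  ext i : 3
  exact (coneHom_last θ.toOrderHom)

theorem δ_castSucc_coneMap {q : ℕ} {n : SimplexCategory} (s : mk (q + 1) ⟶ n) (i : Fin (q + 2)) :
    δ i.castSucc ≫ coneMap s = coneMap (δ i ≫ s) := by
  refine Eq.trans ?_ (coneFunctor.map_comp _ _).symm
  refine congrArg (· ≫ coneFunctor.map s) ?_
  ext j : 3
  change i.castSucc.succAbove j = coneHom i.succAboveOrderEmb.toOrderHom j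
  induction j using Fin.lastCases with
  | last =>
    rw [coneHom_last]
    exact Fin.succAbove_of_lt_succ _ _ (by simp)
  | cast j =>
    rw [coneHom_castSucc]
    exact Fin.castSucc_succAbove_castSucc

theorem δ_last_coneMap {q : ℕ} {n : SimplexCategory} (s : mk q ⟶ n) :
    δ (Fin.last (q + 1)) ≫ coneMap s = s ≫ coneIncl n := by
  refine Eq.trans ?_ (coneIncl_naturality s).symm
  refine congrArg (· ≫ coneFunctor.map s) ?_
  ext j : 3
  change (Fin.last (q + 1)).succAbove j = j.castSucc
  simp

theorem δ_zero_coneMap {n : SimplexCategory} (s : mk 0 ⟶ n) :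
    δ 0 ≫ coneMap s = coneApex n := by
  refine Eq.trans ?_ (coneApex_map s)
  refine congrArg (· ≫ coneFunctor.map s) ?_
  ext j : 3
  fin_cases j
  rfl

end Cone

/-! ### Chains of simplices and the cone homotopy -/

section UnnormalizedChains

variable (k : Type u) [CommRing k]

/-- The cosimplicial complex of unnormalized chains of simplices. -/
noncomputable def freeChains : SimplexCategory ⥤ ChainComplex (ModuleCat.{u} k) ℕ :=
  SSet.stdSimplex.{u} ⋙ (SSet.chainComplexFunctor _).obj (baseMod k)

namespace freeChains

variable {k}

/-- The generator of unnormalized chains given by a simplex. -/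
noncomputable def gen {q : ℕ} {n : SimplexCategory} (s : SimplexCategory.mk q ⟶ n) :
    baseMod k ⟶ ((freeChains k).obj n).X q :=
  SSet.ιChainComplex (SSet.stdSimplex.obj n) (SSet.stdSimplex.objEquiv.symm s)

theorem hom_ext {q : ℕ} {n : SimplexCategory} {Z : ModuleCat.{u} k}
    {f g : ((freeChains k).obj n).X q ⟶ Z}
    (h : ∀ s : SimplexCategory.mk q ⟶ n, gen s ≫ f = gen s ≫ g) : f = g :=
  SSet.chainComplex_hom_ext (fun s => h (SSet.stdSimplex.objEquiv s))

theorem exists_desc {q : ℕ} {n : SimplexCategory} {Z : ModuleCat.{u} k}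
    (a : (SimplexCategory.mk q ⟶ n) → (baseMod k ⟶ Z)) :
    ∃ f : ((freeChains k).obj n).X q ⟶ Z, ∀ s, gen s ≫ f = a s :=
  ⟨Limits.Sigma.desc fun s => a (SSet.stdSimplex.objEquiv s), fun _ => Limits.Sigma.ι_desc _ _⟩

/-- The linear map on unnormalized chains with given values on the simplices. -/
noncomputable def desc {q : ℕ} {n : SimplexCategory} {Z : ModuleCat.{u} k}
    (a : (SimplexCategory.mk q ⟶ n) → (baseMod k ⟶ Z)) : ((freeChains k).obj n).X q ⟶ Z :=
  (exists_desc a).choose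

@[simp]
theorem gen_desc {q : ℕ} {n : SimplexCategory} {Z : ModuleCat.{u} k}
    (a : (SimplexCategory.mk q ⟶ n) → (baseMod k ⟶ Z)) (s) : gen s ≫ desc a = a s :=
  (exists_desc a).choose_spec s

@[simp]
theorem gen_desc_assoc {q : ℕ} {n : SimplexCategory} {Z Z' : ModuleCat.{u} k}
    (a : (SimplexCategory.mk q ⟶ n) → (baseMod k ⟶ Z)) (s) (h : Z ⟶ Z') :
    gen s ≫ desc a ≫ h = a s ≫ h := by
  rw [← Category.assoc, gen_desc]

@[simp]
theorem gen_map {q : ℕ} {m n : SimplexCategory} (s : SimplexCategory.mk q ⟶ m) (θ : m ⟶ n) :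
    gen s ≫ ((freeChains k).map θ).f q = gen (s ≫ θ) :=
  SSet.ι_chainComplexMap_f (SSet.stdSimplex.obj m) (SSet.stdSimplex.obj n) (SSet.stdSimplex.map θ)
    (baseMod k) (SSet.stdSimplex.objEquiv.symm s)

@[simp]
theorem gen_map_assoc {q : ℕ} {m n : SimplexCategory} (s : SimplexCategory.mk q ⟶ m) (θ : m ⟶ n)
    {Z : ModuleCat.{u} k} (h : ((freeChains k).obj n).X q ⟶ Z) :
    gen s ≫ ((freeChains k).map θ).f q ≫ h = gen (s ≫ θ) ≫ h := by
  rw [← Category.assoc, gen_map]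

theorem gen_d {q : ℕ} {n : SimplexCategory} (s : SimplexCategory.mk (q + 1) ⟶ n) :
    gen s ≫ ((freeChains k).obj n).d (q + 1) q =
      ∑ i : Fin (q + 2), (-1 : ℤ) ^ i.val • gen (SimplexCategory.δ i ≫ s) :=
  SSet.ιChainComplex_d (SSet.stdSimplex.obj n) (baseMod k) (SSet.stdSimplex.objEquiv.symm s)

theorem gen_d_assoc {q : ℕ} {n : SimplexCategory} (s : SimplexCategory.mk (q + 1) ⟶ n)
    {Z : ModuleCat.{u} k} (h : ((freeChains k).obj n).X q ⟶ Z) :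
    gen s ≫ ((freeChains k).obj n).d (q + 1) q ≫ h =
      (∑ i : Fin (q + 2), (-1 : ℤ) ^ i.val • gen (SimplexCategory.δ i ≫ s)) ≫ h := by
  rw [← Category.assoc, gen_d]

/-- The generator of the unit complex. -/
noncomputable def unitGen : baseMod k ⟶ (unitComplex k).X 0 :=
  (HomologicalComplex.singleObjXSelf _ 0 (baseMod k)).inv

/-- The augmentation of unnormalized chains. -/
noncomputable def aug : freeChains k ⟶ (Functor.const _).obj (unitComplex k) where
  app _ := chainsAugmentation _
  naturality _ _ _ := (chainsAugmentation_naturality _).trans (Category.comp_id _).symm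

theorem gen_aug {n : SimplexCategory} (s : SimplexCategory.mk 0 ⟶ n) :
    gen s ≫ ((aug (k := k)).app n).f 0 = unitGen := by
  have h : ((aug (k := k)).app n).f 0 = vertexSum (SSet.stdSimplex.obj n) ≫
      (HomologicalComplex.singleObjXSelf _ 0 (baseMod k)).inv := by
    dsimp only [aug, chainsAugmentation]
    exact HomologicalComplex.mkHomToSingle_f _ _
  rw [h]
  exact (Category.assoc _ _ _).symm.trans ((congrArg (· ≫ _) (ι_vertexSum _ _)).trans
    (Category.id_comp _))

theorem gen_aug_assoc {n : SimplexCategory} (s : SimplexCategory.mk 0 ⟶ n)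
    {Z : ModuleCat.{u} k} (h : (unitComplex k).X 0 ⟶ Z) :
    gen s ≫ ((aug (k := k)).app n).f 0 ≫ h = unitGen ≫ h :=
  (Category.assoc _ _ _).symm.trans (congrArg (· ≫ h) (gen_aug s))

/-- The morphism from the unit complex to unnormalized chains given by a vertex. -/
noncomputable def vertex {n : SimplexCategory} (s : SimplexCategory.mk 0 ⟶ n) :
    unitComplex k ⟶ (freeChains k).obj n :=
  HomologicalComplex.mkHomFromSingle (gen s) (fun i hi => by simp at hi)

@[simp]
theorem unitGen_vertex {n : SimplexCategory} (s : SimplexCategory.mk 0 ⟶ n) :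
    unitGen ≫ (vertex (k := k) s).f 0 = gen s := by
  refine (congrArg (unitGen ≫ ·) (HomologicalComplex.mkHomFromSingle_f ..)).trans ?_
  exact Iso.inv_hom_id_assoc _ _

@[simp]
theorem unitGen_vertex_assoc {n : SimplexCategory} (s : SimplexCategory.mk 0 ⟶ n)
    {Z : ModuleCat.{u} k} (h : ((freeChains k).obj n).X 0 ⟶ Z) :
    unitGen ≫ (vertex (k := k) s).f 0 ≫ h = gen s ≫ h := by
  rw [← Category.assoc, unitGen_vertex]

theorem unit_hom_ext {K : ChainComplex (ModuleCat.{u} k) ℕ} {f g : unitComplex k ⟶ K}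
    (h : unitGen ≫ f.f 0 = unitGen ≫ g.f 0) : f = g := by
  apply HomologicalComplex.from_single_hom_ext
  exact (cancel_epi (HomologicalComplex.singleObjXSelf _ 0 (baseMod k)).inv).1 h

theorem unit_X_isZero (q : ℕ) : Limits.IsZero ((unitComplex k).X (q + 1)) :=
  HomologicalComplex.isZero_single_obj_X _ _ _ _ (by simp)

@[simp]
theorem vertex_map {m n : SimplexCategory} (s : SimplexCategory.mk 0 ⟶ m) (θ : m ⟶ n) :
    vertex (k := k) s ≫ (freeChains k).map θ = vertex (s ≫ θ) := by
  apply unit_hom_ext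
  rw [HomologicalComplex.comp_f, unitGen_vertex_assoc, gen_map, unitGen_vertex]

@[simp]
theorem vertex_map_assoc {m n : SimplexCategory} (s : SimplexCategory.mk 0 ⟶ m) (θ : m ⟶ n)
    {K : ChainComplex (ModuleCat.{u} k) ℕ} (h : (freeChains k).obj n ⟶ K) :
    vertex (k := k) s ≫ (freeChains k).map θ ≫ h = vertex (s ≫ θ) ≫ h := by
  rw [← Category.assoc, vertex_map]

/-- The inclusion of normalized chains in unnormalized chains. -/
noncomputable def fromNorm : simplexChains k ⟶ freeChains k where
  app n := SSet.fromNormalizedChainComplex _ _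
  naturality m n f := by
    change SSet.normalizedChainComplexMap (SSet.stdSimplex.map f) (baseMod k) ≫ _ =
      _ ≫ SSet.chainComplexMap (SSet.stdSimplex.map f) (baseMod k)
    rw [SSet.normalizedChainComplexMap]
    simp only [Category.assoc, SSet.toNormalizedChainComplex_fromNormalizedChainComplex]
    rw [SSet.chainComplexMap_PInfty, ← SSet.toNormalizedChainComplex_fromNormalizedChainComplex,
      Category.assoc, SSet.fromNormalizedChainComplex_toNormalizedChainComplex_assoc]

/-- The projection of unnormalized chains to normalized chains. -/
noncomputable def toNorm : freeChains k ⟶ simplexChains k where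
  app _ := SSet.toNormalizedChainComplex _ _
  naturality _ _ _ := (SSet.toNormalizedChainComplex_normalizedChainComplexMap _ _).symm

@[simp]
theorem fromNorm_toNorm : fromNorm (k := k) ≫ toNorm = 𝟙 _ := by
  ext n : 2
  exact SSet.fromNormalizedChainComplex_toNormalizedChainComplex _ _

theorem fromNorm_aug : fromNorm (k := k) ≫ aug = simplexChainsAugmentation k := rfl

theorem vertex_toNorm : vertex (k := k) (𝟙 (SimplexCategory.mk 0)) ≫ toNorm.app _ =
    vertexMap k := by
  apply unit_hom_ext
  rw [HomologicalComplex.comp_f, unitGen_vertex_assoc, vertexMap]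
  refine Eq.trans ?_ (congrArg (unitGen ≫ ·) (HomologicalComplex.mkHomFromSingle_f ..)).symm
  exact (Iso.inv_hom_id_assoc _ _).symm

/-- Degenerate simplices die in the normalized chains. In particular, so do all simplices of
positive dimension of a point. -/
theorem gen_toNorm_comp {q : ℕ} {n : SimplexCategory} (s : SimplexCategory.mk q ⟶ n)
    (i : Fin (q + 1)) :
    gen (k := k) (SimplexCategory.σ i ≫ s) ≫ (toNorm.app n).f (q + 1) = 0 := by
  refine (SSet.ιChainComplex_toNormalizedChainComplex_f ..).trans ?_
  apply SSet.ιNormalizedChainComplex_eq_zero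
  rw [SSet.degenerate_eq_iUnion_range_σ]
  exact Set.mem_iUnion.2 ⟨i, SSet.stdSimplex.objEquiv.symm s, rfl⟩

theorem vertexMap_aug : vertexMap k ≫ (simplexChainsAugmentation k).app _ = 𝟙 _ := by
  rw [← vertex_toNorm, ← fromNorm_aug, NatTrans.comp_app, Category.assoc]
  apply unit_hom_ext
  have h : ((toNorm (k := k)).app (SimplexCategory.mk 0)).f 0 ≫ (fromNorm.app _).f 0 = 𝟙 _ :=
    (SSet.toNormalizedChainComplex_f_fromNormalizedChainComplex_f _ _ _).trans
      (AlgebraicTopology.DoldKan.PInfty_f_0)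
  rw [HomologicalComplex.comp_f, unitGen_vertex_assoc, HomologicalComplex.comp_f,
    HomologicalComplex.comp_f, reassoc_of% h, gen_aug]
  exact (Category.comp_id _).symm

variable (k)

/-- The map `C_p(Δ^n) ⟶ C_{p+1}(Δ^{n+1})` of unnormalized chains joining a simplex with the
last vertex, up to a sign. -/
noncomputable def cone (n : SimplexCategory) : (p q : ℕ) →
    (((freeChains k).obj n).X p ⟶ ((freeChains k).obj (coneFunctor.obj n)).X q) := fun p q =>
  if h : p + 1 = q then
    -- The apex is the last vertex, so the face opposite to it enters the boundary of the cone with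
    -- sign (-1)^q. This factor makes its coefficient 1.
    desc fun s => (-1 : ℤ) ^ q • gen (eqToHom (by rw [← h]) ≫ coneMap s)
  else 0

variable {k}

theorem gen_cone (n : SimplexCategory) (q : ℕ) (s : SimplexCategory.mk q ⟶ n) :
    gen s ≫ cone k n q (q + 1) = (-1 : ℤ) ^ (q + 1) • gen (coneMap s) := by
  rw [cone, dif_pos rfl, gen_desc, eqToHom_refl, Category.id_comp]

theorem gen_cone_assoc (n : SimplexCategory) (q : ℕ) (s : SimplexCategory.mk q ⟶ n)
    {Z : ModuleCat.{u} k} (h : ((freeChains k).obj (coneFunctor.obj n)).X (q + 1) ⟶ Z) :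
    gen s ≫ cone k n q (q + 1) ≫ h = ((-1 : ℤ) ^ (q + 1) • gen (coneMap s)) ≫ h := by
  rw [← Category.assoc, gen_cone]

theorem cone_eq_zero (n : SimplexCategory) {p q : ℕ} (h : p + 1 ≠ q) : cone k n p q = 0 :=
  dif_neg h

theorem cone_naturality {m n : SimplexCategory} (θ : m ⟶ n) (p q : ℕ) :
    ((freeChains k).map θ).f p ≫ cone k n p q =
      cone k m p q ≫ ((freeChains k).map (coneFunctor.map θ)).f q := by
  by_cases h : p + 1 = q
  · subst h
    apply hom_ext
    intro s
    rw [gen_map_assoc, gen_cone, gen_cone_assoc, Preadditive.zsmul_comp]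
    refine congrArg _ ?_
    exact (congrArg gen (Functor.map_comp _ _ _)).trans
      (gen_map (k := k) (coneMap s) (coneFunctor.map θ)).symm
  · rw [cone_eq_zero _ h, cone_eq_zero _ h, Limits.comp_zero, Limits.zero_comp]

theorem cone_comm_zero (n : SimplexCategory) :
    ((freeChains k).map (coneIncl n)).f 0 =
      cone k n 0 1 ≫ ((freeChains k).obj (coneFunctor.obj n)).d 1 0 +
        (aug.app n ≫ vertex (coneApex n)).f 0 := by
  apply hom_ext
  intro s
  have h := gen_cone_assoc (k := k) n 0 s (((freeChains k).obj (coneFunctor.obj n)).d (0 + 1) 0)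
  have h' := gen_aug_assoc (k := k) s ((vertex (coneApex n)).f 0)
  rw [Preadditive.comp_add, HomologicalComplex.comp_f, h', unitGen_vertex, h,
    Preadditive.zsmul_comp, gen_d, Fin.sum_univ_two, δ_zero_coneMap, gen_map,
    show (1 : Fin (0 + 2)) = Fin.last 1 from rfl, δ_last_coneMap]
  simp

/-- The faces through the apex cancel against the cone of the boundary, because the signs of `cone`
in consecutive degrees are opposite. The face opposite to the apex survives, and the augmentation
term is zero in positive degrees. -/
theorem cone_comm_succ (n : SimplexCategory) (q : ℕ) :
    ((freeChains k).map (coneIncl n)).f (q + 1) =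
      ((freeChains k).obj n).d (q + 1) q ≫ cone k n q (q + 1) +
      cone k n (q + 1) (q + 2) ≫
        ((freeChains k).obj (coneFunctor.obj n)).d (q + 2) (q + 1) +
        (aug.app n ≫ vertex (coneApex n)).f (q + 1) := by
  apply hom_ext
  intro s
  have h : (aug.app n ≫ vertex (k := k) (coneApex n)).f (q + 1) = 0 := by
    rw [HomologicalComplex.comp_f]
    exact (congrArg (· ≫ _) ((unit_X_isZero q).eq_of_tgt _ 0)).trans Limits.zero_comp
  have h' := gen_cone_assoc (k := k) n (q + 1) s
    (((freeChains k).obj (coneFunctor.obj n)).d (q + 1 + 1) (q + 1))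
  rw [h, add_zero, Preadditive.comp_add, gen_d_assoc, h', gen_map,
    Preadditive.zsmul_comp, Preadditive.sum_comp, gen_d, Fin.sum_univ_castSucc (n := q + 2),
      δ_last_coneMap]
  simp_rw [Preadditive.zsmul_comp, gen_cone, δ_castSucc_coneMap]
  rw [smul_add, Finset.smul_sum, ← add_assoc, ← Finset.sum_add_distrib, Finset.sum_eq_zero,
    zero_add, smul_smul]
  · simp [← pow_add, ← two_mul]
  · intro i _
    simp only [smul_smul, ← add_smul]
    convert zero_smul ℤ _
    simp
    ring

/-- The homotopy, on unnormalized chains, between the inclusion of a simplex in its cone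
and the constant map to the apex. -/
noncomputable def coneHomotopy (n : SimplexCategory) :
    Homotopy ((freeChains k).map (coneIncl n)) (aug.app n ≫ vertex (coneApex n)) where
  hom := cone k n
  zero i j h := cone_eq_zero n h
  comm i := by
    cases i with
    | zero =>
      rw [Homotopy.dNext_zero_chainComplex, Homotopy.prevD_chainComplex, zero_add]
      exact cone_comm_zero n
    | succ i =>
      rw [Homotopy.dNext_succ_chainComplex, Homotopy.prevD_chainComplex]
      exact cone_comm_succ n i

end freeChains

end UnnormalizedChains

/-! ### Cone homotopies on normalized chains and their tensor products -/

section BoxHomotopy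

open MonoidalCategory freeChains

variable {k : Type u} [CommRing k]

/-- The map from the chains of a simplex to those of `Δ^n` concentrated on a vertex of `Δ^n`. -/
noncomputable def constChains (m : SimplexCategory) {n : SimplexCategory}
    (s : SimplexCategory.mk 0 ⟶ n) : (simplexChains k).obj m ⟶ (simplexChains k).obj n :=
  (simplexChainsAugmentation k).app m ≫ vertexMap k ≫ (simplexChains k).map s

theorem map_simplexChainsAugmentation {m n : SimplexCategory} (θ : m ⟶ n) :
    (simplexChains k).map θ ≫ (simplexChainsAugmentation k).app n =
      (simplexChainsAugmentation k).app m :=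
  ((simplexChainsAugmentation k).naturality θ).trans (Category.comp_id _)

theorem map_constChains {m m' n : SimplexCategory} (θ : m' ⟶ m) (s : SimplexCategory.mk 0 ⟶ n) :
    (simplexChains k).map θ ≫ constChains m s = constChains m' s := by
  rw [constChains, reassoc_of% (map_simplexChainsAugmentation (k := k) θ), constChains]

theorem constChains_map (m : SimplexCategory) {n n' : SimplexCategory}
    (s : SimplexCategory.mk 0 ⟶ n) (θ : n ⟶ n') :
    constChains m s ≫ (simplexChains k).map θ = constChains m (s ≫ θ) := by
  rw [constChains, constChains, Functor.map_comp, Category.assoc, Category.assoc]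

theorem fromNorm_aug_vertex_toNorm (m : SimplexCategory) {n : SimplexCategory}
    (s : SimplexCategory.mk 0 ⟶ n) :
    fromNorm.app m ≫ (aug.app m ≫ vertex s) ≫ toNorm.app n = constChains (k := k) m s := by
  rw [constChains, ← vertex_toNorm, ← fromNorm_aug, NatTrans.comp_app]
  simp only [Category.assoc]
  rw [← toNorm.naturality s, vertex_map_assoc, Category.id_comp]

theorem fromNorm_map_toNorm {m n : SimplexCategory} (θ : m ⟶ n) :
    fromNorm.app m ≫ (freeChains k).map θ ≫ toNorm.app n = (simplexChains k).map θ := by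
  rw [toNorm.naturality, ← NatTrans.comp_app_assoc, fromNorm_toNorm]
  exact Category.id_comp _

/-- The homotopy, on normalized chains, between the inclusion of a simplex in its cone
and the constant map to the apex. -/
noncomputable def simplexConeHomotopy (n : SimplexCategory) :
    Homotopy ((simplexChains k).map (coneIncl n)) (constChains n (coneApex n)) :=
  (Homotopy.ofEq (fromNorm_map_toNorm _).symm).trans
    ((((coneHomotopy n).compRight (toNorm.app _)).compLeft (fromNorm.app n)).trans
      (Homotopy.ofEq (fromNorm_aug_vertex_toNorm _ _)))

theorem simplexConeHomotopy_hom (n : SimplexCategory) (p q : ℕ) :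
    (simplexConeHomotopy (k := k) n).hom p q =
      (fromNorm.app n).f p ≫ cone k n p q ≫ (toNorm.app (coneFunctor.obj n)).f q := by
  simp [simplexConeHomotopy, coneHomotopy]

/-- It is the naturality of the homotopy itself, and not only of its two ends, that lets it pass to
the coend. -/
theorem simplexConeHomotopy_naturality {m n : SimplexCategory} (θ : m ⟶ n) (p q : ℕ) :
    ((simplexChains k).map θ).f p ≫ (simplexConeHomotopy n).hom p q =
      (simplexConeHomotopy m).hom p q ≫ ((simplexChains k).map (coneFunctor.map θ)).f q := by
  have h₁ := HomologicalComplex.congr_hom ((fromNorm (k := k)).naturality θ) p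
  have h₂ := HomologicalComplex.congr_hom ((toNorm (k := k)).naturality (coneFunctor.map θ)) q
  rw [HomologicalComplex.comp_f, HomologicalComplex.comp_f] at h₁ h₂
  rw [simplexConeHomotopy_hom, simplexConeHomotopy_hom, reassoc_of% h₁, Category.assoc,
    Category.assoc, ← h₂, reassoc_of% (cone_naturality (k := k) θ p q)]

variable {Φ : Type u}

/-- The tensor product of a family of morphisms between complexes `C_*(Δ^[n f])`. -/
noncomputable def boxHom {n n' : Φ → SimplexCategory}
    (α : ∀ f, (simplexChains k).obj (n f) ⟶ (simplexChains k).obj (n' f)) :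
    (l : List Φ) → ((boxChains k l).obj n ⟶ (boxChains k l).obj n')
  | [] => 𝟙 _
  | f :: l => α f ⊗ₘ boxHom α l

theorem boxHom_comp {n n' n'' : Φ → SimplexCategory}
    (α : ∀ f, (simplexChains k).obj (n f) ⟶ (simplexChains k).obj (n' f))
    (β : ∀ f, (simplexChains k).obj (n' f) ⟶ (simplexChains k).obj (n'' f)) (l : List Φ) :
    boxHom α l ≫ boxHom β l = boxHom (fun f => α f ≫ β f) l := by
  induction l with
  | nil => exact Category.id_comp _
  | cons f l ih =>
    exact (tensorHom_comp_tensorHom _ _ _ _).trans (congrArg (_ ⊗ₘ ·) ih)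

theorem boxChains_map {n n' : Φ → SimplexCategory} (θ : n ⟶ n') (l : List Φ) :
    (boxChains k l).map θ = boxHom (fun f => (simplexChains k).map (θ f)) l := by
  induction l with
  | nil => rfl
  | cons f l ih => exact congrArg (((simplexChains k).map (θ f)) ⊗ₘ ·) ih

/-- The morphism from the unit to a tensor product of complexes `C_*(Δ^[0])` given by
the vertices. -/
noncomputable def boxVertex : (l : List Φ) → (unitComplex k ⟶ (boxChains k l).obj
    (fun _ => SimplexCategory.mk 0))
  | [] => 𝟙 _
  | _ :: l => (λ_ (unitComplex k)).inv ≫ (vertexMap k ⊗ₘ boxVertex l)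

theorem boxHom_constChains (n : Φ → SimplexCategory) (l : List Φ) :
    boxHom (k := k) (fun f => constChains (n f) (𝟙 (SimplexCategory.mk 0))) l =
      (boxChainsAugmentation k l).app n ≫ boxVertex l := by
  induction l with
  | nil => exact (Category.comp_id _).symm
  | cons f l ih =>
    change constChains (n f) (𝟙 (SimplexCategory.mk 0)) ⊗ₘ boxHom _ l =
      ((((simplexChainsAugmentation k).app (n f)) ⊗ₘ
      (boxChainsAugmentation k l).app n) ≫ (λ_ (unitComplex k)).hom) ≫
        (λ_ (unitComplex k)).inv ≫ (vertexMap k ⊗ₘ boxVertex l)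
    have h : constChains (n f) (𝟙 (SimplexCategory.mk 0)) =
        (simplexChainsAugmentation k).app (n f) ≫ vertexMap k := by
      rw [constChains, CategoryTheory.Functor.map_id, Category.comp_id]
    rw [ih, h, Category.assoc, Iso.hom_inv_id_assoc, tensorHom_comp_tensorHom]

theorem boxVertex_augmentation (l : List Φ) :
    boxVertex (k := k) l ≫ (boxChainsAugmentation k l).app _ = 𝟙 _ := by
  induction l with
  | nil => exact (Category.comp_id _)
  | cons f l ih =>
    change ((λ_ (unitComplex k)).inv ≫ (vertexMap k ⊗ₘ boxVertex l)) ≫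
      (((simplexChainsAugmentation k).app (SimplexCategory.mk 0)) ⊗ₘ
      (boxChainsAugmentation k l).app _) ≫ (λ_ (unitComplex k)).hom = _
    rw [Category.assoc, tensorHom_comp_tensorHom_assoc]
    erw [ih, vertexMap_aug, id_tensorHom_id]
    rw [Category.id_comp, Iso.inv_hom_id]
 
open HomologicalComplex

/-- The tensor product of homotopies between maps of chain complexes. -/
noncomputable def tensorHomotopy {K K' L L' : ChainComplex (ModuleCat.{u} k) ℕ} {α α' : K ⟶ K'}
    {β β' : L ⟶ L'} (h : Homotopy α α') (h' : Homotopy β β') :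
    Homotopy (α ⊗ₘ β) (α' ⊗ₘ β') :=
  Homotopy.trans (mapBifunctorMapHomotopy₁ h β (curriedTensor (ModuleCat.{u} k))
    (ComplexShape.down ℕ))
    (mapBifunctorMapHomotopy₂ α' h' (curriedTensor (ModuleCat.{u} k)) (ComplexShape.down ℕ))

theorem map_app_comp_obj_map {C D E : Type*} [Category* C] [Category* D] [Category* E]
    (F : C ⥤ D ⥤ E) {X X' X'' : C} {Y Y' Y'' : D} (f : X ⟶ X') (f' : X' ⟶ X'') (g : Y ⟶ Y')
    (g' : Y' ⟶ Y'') {Z : E} (z : (F.obj X'').obj Y'' ⟶ Z) :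
    (F.map f).app Y ≫ (F.obj X').map g ≫ (F.map f').app Y' ≫ (F.obj X'').map g' ≫ z =
      (F.map (f ≫ f')).app Y ≫ (F.obj X'').map (g ≫ g') ≫ z := by
  simp

theorem ιMapBifunctorOrZero_map {K K' L L' : ChainComplex (ModuleCat.{u} k) ℕ} (a : K ⟶ K')
    (b : L ⟶ L') (i j q : ℕ) :
    ιMapBifunctorOrZero K L (curriedTensor (ModuleCat.{u} k)) (ComplexShape.down ℕ) i j q ≫
        (mapBifunctorMap a b (curriedTensor (ModuleCat.{u} k)) (ComplexShape.down ℕ)).f q =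
      ((curriedTensor (ModuleCat.{u} k)).map (a.f i)).app (L.X j) ≫
        ((curriedTensor (ModuleCat.{u} k)).obj (K'.X i)).map (b.f j) ≫
          ιMapBifunctorOrZero K' L' (curriedTensor (ModuleCat.{u} k)) (ComplexShape.down ℕ)
            i j q := by
  by_cases h : ComplexShape.π (ComplexShape.down ℕ) (ComplexShape.down ℕ) (ComplexShape.down ℕ)
      (i, j) = q
  · rw [ιMapBifunctorOrZero_eq _ _ _ _ _ _ _ h, ιMapBifunctorOrZero_eq _ _ _ _ _ _ _ h,
      ι_mapBifunctorMap]
  · rw [ιMapBifunctorOrZero_eq_zero _ _ _ _ _ _ _ h, ιMapBifunctorOrZero_eq_zero _ _ _ _ _ _ _ h,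
      Limits.zero_comp, Limits.comp_zero, Limits.comp_zero]

/-- The homotopy `tensorHomotopy` first moves the left factor with β fixed, then the right factor
with α' fixed. Hence the only squares needed, apart from those of the two homotopies, are the ones
for β and α'. -/
theorem tensorHomotopy_naturality {K K' L L' K₁ K₁' L₁ L₁' : ChainComplex (ModuleCat.{u} k) ℕ}
    {α α' : K ⟶ K'} {β β' : L ⟶ L'} (h : Homotopy α α') (h' : Homotopy β β') 
    {α₁ α₁' : K₁ ⟶ K₁'} {β₁ β₁' : L₁ ⟶ L₁'} (h₁ : Homotopy α₁ α₁') (h₁' : Homotopy β₁ β₁')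
    (a : K ⟶ K₁) (a' : K' ⟶ K₁') (b : L ⟶ L₁) (b' : L' ⟶ L₁')
    (hα' : a ≫ α₁' = α' ≫ a') (hβ : b ≫ β₁ = β ≫ b') 
    (hh : ∀ p q, a.f p ≫ h₁.hom p q = h.hom p q ≫ a'.f q)
    (hh' : ∀ p q, b.f p ≫ h₁'.hom p q = h'.hom p q ≫ b'.f q) (p q : ℕ) :
    (a ⊗ₘ b).f p ≫ (tensorHomotopy h₁ h₁').hom p q =
      (tensorHomotopy h h').hom p q ≫ (a' ⊗ₘ b').f q := by
  have e₁ : ∀ (p q : ℕ), (mapBifunctorMap a b (curriedTensor (ModuleCat.{u} k))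
    (ComplexShape.down ℕ)).f p ≫
      mapBifunctorMapHomotopy.hom₁ h₁ β₁ (curriedTensor (ModuleCat.{u} k))
        (ComplexShape.down ℕ) p q =
      mapBifunctorMapHomotopy.hom₁ h β (curriedTensor (ModuleCat.{u} k)) (ComplexShape.down ℕ) p q ≫
        (mapBifunctorMap a' b' (curriedTensor (ModuleCat.{u} k)) (ComplexShape.down ℕ)).f q := by
    intro p q
    apply mapBifunctor.hom_ext
    intro i j hij
    rw [ι_mapBifunctorMap_assoc,
      mapBifunctorMapHomotopy.ιMapBifunctor_hom₁ _ _ _ _ _ _ _ _ _ hij rfl,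
      reassoc_of% (mapBifunctorMapHomotopy.ιMapBifunctor_hom₁ h β (curriedTensor (ModuleCat.{u} k))
        (ComplexShape.down ℕ) _ i j p q hij rfl)]
    simp only [Linear.comp_units_smul, Linear.units_smul_comp, Category.assoc]
    refine congrArg _ ?_
    rw [ιMapBifunctorOrZero_map, map_app_comp_obj_map, map_app_comp_obj_map, hh,
      ← comp_f b β₁, hβ, comp_f]
  have e₂ : ∀ (p q : ℕ), (mapBifunctorMap a b (curriedTensor (ModuleCat.{u} k))
    (ComplexShape.down ℕ)).f p ≫
      mapBifunctorMapHomotopy.hom₂ α₁' h₁' (curriedTensor (ModuleCat.{u} k))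
        (ComplexShape.down ℕ) p q =
      mapBifunctorMapHomotopy.hom₂ α' h' (curriedTensor (ModuleCat.{u} k))
        (ComplexShape.down ℕ) p q ≫
        (mapBifunctorMap a' b' (curriedTensor (ModuleCat.{u} k)) (ComplexShape.down ℕ)).f q := by
    intro p q
    apply mapBifunctor.hom_ext
    intro i j hij
    rw [ι_mapBifunctorMap_assoc,
      mapBifunctorMapHomotopy.ιMapBifunctor_hom₂ _ _ _ _ _ _ _ _ _ hij rfl,
      reassoc_of% (mapBifunctorMapHomotopy.ιMapBifunctor_hom₂ α' h' (curriedTensor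
        (ModuleCat.{u} k))
        (ComplexShape.down ℕ) i _ j p q hij rfl)]
    simp only [Linear.comp_units_smul, Linear.units_smul_comp, Category.assoc]
    refine congrArg _ ?_
    rw [ιMapBifunctorOrZero_map, map_app_comp_obj_map, map_app_comp_obj_map, hh',
      ← comp_f a α₁', hα', comp_f]
  refine (Preadditive.comp_add _ _ _ _ _ _).trans ?_
  refine Eq.trans ?_ (Preadditive.add_comp _ _ _ _ _ _).symm
  exact congrArg₂ (· + ·) (e₁ p q) (e₂ p q)

/-- The tensor product of a family of homotopies. -/
noncomputable def boxHomotopy {n n' : Φ → SimplexCategory}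
    {α β : ∀ f, (simplexChains k).obj (n f) ⟶ (simplexChains k).obj (n' f)}
    (h : ∀ f, Homotopy (α f) (β f)) : (l : List Φ) → Homotopy (boxHom α l) (boxHom β l)
  | [] => Homotopy.refl _
  | f :: l => tensorHomotopy (h f) (boxHomotopy h l)

theorem boxHomotopy_naturality {n n' m m' : Φ → SimplexCategory}
    {α β : ∀ f, (simplexChains k).obj (n f) ⟶ (simplexChains k).obj (n' f)}
    {α₁ β₁ : ∀ f, (simplexChains k).obj (m f) ⟶ (simplexChains k).obj (m' f)}
    (h : ∀ f, Homotopy (α f) (β f)) (h₁ : ∀ f, Homotopy (α₁ f) (β₁ f)) (θ : n ⟶ m) (θ' : n' ⟶ m')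
    (hα : ∀ f, (simplexChains k).map (θ f) ≫ α₁ f = α f ≫ (simplexChains k).map (θ' f))
    (hβ : ∀ f, (simplexChains k).map (θ f) ≫ β₁ f = β f ≫ (simplexChains k).map (θ' f))
    (hh : ∀ f p q, ((simplexChains k).map (θ f)).f p ≫ (h₁ f).hom p q =
      (h f).hom p q ≫ ((simplexChains k).map (θ' f)).f q) (l : List Φ) (p q : ℕ) :
    ((boxChains k l).map θ).f p ≫ (boxHomotopy h₁ l).hom p q =
      (boxHomotopy h l).hom p q ≫ ((boxChains k l).map θ').f q := by
  induction l generalizing p q with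
  | nil => exact Limits.comp_zero.trans Limits.zero_comp.symm
  | cons f l ih =>
    refine tensorHomotopy_naturality (h f) (boxHomotopy h l) (h₁ f) (boxHomotopy h₁ l) _ _ _ _
      (hβ f) ?_ (hh f) ih p q
    rw [boxChains_map, boxChains_map, boxHom_comp, boxHom_comp]
    exact congrArg (boxHom · l) (funext hα)

end BoxHomotopy

/-! ### Maps and homotopies out of the coend -/

section ChainRealizationMaps

open Limits

variable {k : Type u} [CommRing k] {I : Type u} [Category.{u} I]

/-- The map `G n ⟶ k[X] ⊗ G` given by an element of `X n`. -/
noncomputable def ιRealization (G : I ⥤ ChainComplex (ModuleCat.{u} k) ℕ) {X : Iᵒᵖ ⥤ Type u}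
    {n : I} (x : X.obj (op n)) : G.obj n ⟶ (chainRealization k G).obj X :=
  Sigma.ι (fun _ : X.obj (op n) => G.obj n) x ≫ coend.ι ((copowerBifunctor k G).obj X) n

variable (G : I ⥤ ChainComplex (ModuleCat.{u} k) ℕ) {X : Iᵒᵖ ⥤ Type u}

theorem map_ιRealization {m n : I} (θ : m ⟶ n) (x : X.obj (op n)) :
    G.map θ ≫ ιRealization G x = ιRealization G (X.map θ.op x) := by
  have h := Sigma.ι (fun _ : X.obj (op n) => G.obj m) x ≫=
    (coend.condition ((copowerBifunctor k G).obj X) θ)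
  dsimp [copowerBifunctor, sigmaConst] at h
  simp at h
  exact h.symm

theorem realization_hom_ext {K : ChainComplex (ModuleCat.{u} k) ℕ}
    {f g : (chainRealization k G).obj X ⟶ K}
    (h : ∀ n (x : X.obj (op n)), ιRealization G x ≫ f = ιRealization G x ≫ g) :
    f = g := by
  refine coend.hom_ext (F := (copowerBifunctor k G).obj X) fun n => Sigma.hom_ext _ _ fun x => ?_
  exact (Category.assoc _ _ _).symm.trans ((h n x).trans (Category.assoc _ _ _))

theorem realization_exists_desc {K : ChainComplex (ModuleCat.{u} k) ℕ}
    (a : ∀ n, X.obj (op n) → (G.obj n ⟶ K))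
    (ha : ∀ m n (θ : m ⟶ n) (x : X.obj (op n)), G.map θ ≫ a n x = a m (X.map θ.op x)) :
    ∃ φ : (chainRealization k G).obj X ⟶ K,
      ∀ n (x : X.obj (op n)), ιRealization G x ≫ φ = a n x := by
  refine ⟨coend.desc (F := (copowerBifunctor k G).obj X) (fun n => Sigma.desc (a n)) ?_, ?_⟩
  · intro m n θ
    dsimp [copowerBifunctor, sigmaConst]
    apply Sigma.hom_ext
    intro x
    simp [ha]
  · intro n x
    refine (Category.assoc _ _ _).trans ?_
    exact (Sigma.ι _ x ≫= coend.ι_desc _ _ n).trans (Sigma.ι_desc _ _)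

section Double

variable {K L : ChainComplex (ModuleCat.{u} k) ℕ}

/-- The contractible complex with two nonzero terms, equal to `Z`. -/
noncomputable abbrev diskComplex (p : ℕ) (Z : ModuleCat.{u} k) :
    ChainComplex (ModuleCat.{u} k) ℕ :=
  HomologicalComplex.double (𝟙 Z) (show (ComplexShape.down ℕ).Rel (p + 1) p from rfl)

/-- The term of lower degree of the complex `diskComplex p Z`. -/
noncomputable def diskXIso (p : ℕ) (Z : ModuleCat.{u} k) : (diskComplex p Z).X p ≅ Z :=
  HomologicalComplex.doubleXIso₁ _ _ (by lia)

/-- The term of higher degree of the complex `diskComplex p Z`. -/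
noncomputable def diskXSuccIso (p : ℕ) (Z : ModuleCat.{u} k) :
    (diskComplex p Z).X (p + 1) ≅ Z :=
  HomologicalComplex.doubleXIso₀ _ _

theorem diskComplex_d (p : ℕ) (Z : ModuleCat.{u} k) :
    (diskComplex p Z).d (p + 1) p = (diskXSuccIso p Z).hom ≫ (diskXIso p Z).inv :=
  (HomologicalComplex.double_d _ _ (by lia)).trans (congrArg (_ ≫ ·) (Category.id_comp _))

/-- A linear map from the chains of a given degree, as a morphism of complexes. -/
noncomputable def toDisk {p : ℕ} {Z : ModuleCat.{u} k} (φ : K.X p ⟶ Z) : K ⟶ diskComplex p Z where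
  f q := if h : q = p then eqToHom (by rw [h]) ≫ φ ≫ (diskXIso p Z).inv ≫ eqToHom (by rw [h])
    else if h : q = p + 1 then K.d q p ≫ φ ≫ (diskXSuccIso p Z).inv ≫
      eqToHom (by rw [h]) else 0
  comm' i j hij := by
    obtain rfl : j + 1 = i := hij
    by_cases h : j = p
    · subst h
      rw [diskComplex_d]
      simp
    · by_cases h' : j = p + 1
      · subst h'
        rw [HomologicalComplex.double_d_eq_zero₀ _ _ _ _ (by lia)]
        simp
      · rw [HomologicalComplex.double_d_eq_zero₁ _ _ _ _ h]
        simp [h, h']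

theorem toDisk_f {p : ℕ} {Z : ModuleCat.{u} k} (φ : K.X p ⟶ Z) :
    (toDisk φ).f p = φ ≫ (diskXIso p Z).inv := by
  simp [toDisk]

theorem toDisk_f_succ {p : ℕ} {Z : ModuleCat.{u} k} (φ : K.X p ⟶ Z) :
    (toDisk φ).f (p + 1) = K.d (p + 1) p ≫ φ ≫ (diskXSuccIso p Z).inv := by
  simp [toDisk]

theorem comp_toDisk {p : ℕ} {Z : ModuleCat.{u} k} (φ : L.X p ⟶ Z) (f : K ⟶ L) :
    f ≫ toDisk φ = toDisk (f.f p ≫ φ) := by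
  apply HomologicalComplex.to_double_hom_ext
  · rw [HomologicalComplex.comp_f, toDisk_f_succ, toDisk_f_succ,
      HomologicalComplex.Hom.comm_assoc, Category.assoc]
  · rw [HomologicalComplex.comp_f, toDisk_f, toDisk_f, Category.assoc]

end Double

/-- The coend is taken in chain complexes, whereas the components of a homotopy are mere linear
maps. A linear map out of the degree p part amounts to a morphism to a disk complex, which transfers
the universal property to each degree. -/
theorem realization_hom_ext_f {p : ℕ} {Z : ModuleCat.{u} k}
    {f g : ((chainRealization k G).obj X).X p ⟶ Z}
    (h : ∀ n (x : X.obj (op n)), (ιRealization G x).f p ≫ f = (ιRealization G x).f p ≫ g) :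
    f = g := by
  have e : toDisk f = toDisk g := by
    apply realization_hom_ext
    intro n x
    rw [comp_toDisk, comp_toDisk, h]
  have e' := HomologicalComplex.congr_hom e p
  rwa [toDisk_f, toDisk_f, cancel_mono] at e'

theorem realization_exists_desc_f {p : ℕ} {Z : ModuleCat.{u} k}
    (a : ∀ n, X.obj (op n) → ((G.obj n).X p ⟶ Z))
    (ha : ∀ m n (θ : m ⟶ n) (x : X.obj (op n)),
      (G.map θ).f p ≫ a n x = a m (X.map θ.op x)) :
    ∃ φ : ((chainRealization k G).obj X).X p ⟶ Z,
      ∀ n (x : X.obj (op n)), (ιRealization G x).f p ≫ φ = a n x := by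
  obtain ⟨φ, hφ⟩ := realization_exists_desc G (X := X) (fun n x => toDisk (a n x))
    (fun m n θ x => by rw [comp_toDisk, ha])
  refine ⟨φ.f p ≫ (diskXIso p Z).hom, fun n x => ?_⟩
  have e := HomologicalComplex.congr_hom (hφ n x) p
  rw [HomologicalComplex.comp_f, toDisk_f] at e
  rw [reassoc_of% e, Iso.inv_hom_id, Category.comp_id]

theorem ιRealization_augmentation {G : I ⥤ ChainComplex (ModuleCat.{u} k) ℕ}
    {A : ChainComplex (ModuleCat.{u} k) ℕ}
    (α : G ⟶ (Functor.const _).obj A) {n : I} (x : X.obj (op n)) :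
    ιRealization G x ≫ chainRealizationAugmentation α X = α.app n := by
  refine (Category.assoc _ _ _).trans ?_
  exact (Sigma.ι _ x ≫= coend.ι_desc _ _ n).trans (Sigma.ι_desc _ _)

/-- Naturally homotopic families of maps induce homotopic maps from the realization. -/
theorem realization_homotopy {K : ChainComplex (ModuleCat.{u} k) ℕ}
    {f g : (chainRealization k G).obj X ⟶ K}
    (h : ∀ n (x : X.obj (op n)), Homotopy (ιRealization G x ≫ f) (ιRealization G x ≫ g))
    (hh : ∀ m n (θ : m ⟶ n) (x : X.obj (op n)) (p q : ℕ),
      (G.map θ).f p ≫ (h n x).hom p q = (h m (X.map θ.op x)).hom p q) :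
    Nonempty (Homotopy f g) := by
  choose φ hφ using fun p q => realization_exists_desc_f G (p := p) (fun n x => (h n x).hom p q)
    (fun m n θ x => hh m n θ x p q)
  refine ⟨⟨φ, fun i j hij => ?_, fun i => ?_⟩⟩
  · apply realization_hom_ext_f
    intro n x
    rw [hφ, (h n x).zero i j hij, comp_zero]
  · apply realization_hom_ext_f
    intro n x
    have e := (h n x).comm i
    rw [HomologicalComplex.comp_f, HomologicalComplex.comp_f] at e
    rw [e, Preadditive.comp_add, Preadditive.comp_add, Homotopy.prevD_chainComplex,
      Homotopy.prevD_chainComplex, reassoc_of% (hφ i (i + 1) n x)]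
    congr 2
    cases i with
    | zero => rw [Homotopy.dNext_zero_chainComplex, Homotopy.dNext_zero_chainComplex, comp_zero]
    | succ i =>
      rw [Homotopy.dNext_succ_chainComplex, Homotopy.dNext_succ_chainComplex,
        HomologicalComplex.Hom.comm_assoc, hφ]

end ChainRealizationMaps

/-! ### Adding last elements to allowed orders -/

namespace TwoOrdinal

section Extension

variable {U : TwoOrdinal.{u}} {I I' : U.Cells → Type w} [∀ f, LinearOrder (I f)]
  [∀ f, LinearOrder (I' f)]

/-- The order on the disjoint union of the sets `I f` with a last element added, for which the
new elements follow all the others, in the lexicographic order of their labels. -/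
def CellOrder.extLE (s : CellOrder U I) : (Σ f, WithTop (I f)) → (Σ f, WithTop (I f)) → Prop
  | ⟨f, some a⟩, ⟨g, some b⟩ => s.le ⟨f, a⟩ ⟨g, b⟩
  | ⟨_, some _⟩, ⟨_, none⟩ => True
  | ⟨_, none⟩, ⟨_, some _⟩ => False
  | ⟨f, none⟩, ⟨g, none⟩ => toLex f ≤ toLex g

/-- The elements of `WithTop (I f)` which are allowed at `f` by conditions `P` and `Q`. -/
abbrev ExtIndex (I : U.Cells → Type w) (P Q : U.Cells → Prop) (f : U.Cells) : Type w :=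
  {a : WithTop (I f) // (a ≠ ⊤ → P f) ∧ (a = ⊤ → Q f)}

/-- The underlying element of the disjoint union of the sets `WithTop (I f)`. -/
def ExtIndex.val {P Q : U.Cells → Prop} (x : Σ f, ExtIndex I P Q f) : Σ f, WithTop (I f) :=
  ⟨x.1, x.2.1⟩

/-- The extension of an allowed order to some of the last elements added to the sets `I f`. -/
def CellOrder.addTop (s : CellOrder U I) (P Q : U.Cells → Prop)
    (hPQ : ∀ f g, P f → Q g → toLex f ≤ toLex g) : CellOrder U (ExtIndex I P Q) where
  le x y := s.extLE (ExtIndex.val x) (ExtIndex.val y)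
  trans := by
    rintro ⟨f, ⟨_ | a, ha⟩⟩ ⟨g, ⟨_ | b, hb⟩⟩ ⟨h, ⟨_ | c, hc⟩⟩ h₁ h₂
    exacts [le_trans (α := Σₗ c : Arr U.C, Arr (U.F c)) h₁ h₂, h₂, h₁.elim, h₁.elim, trivial,
      h₂.elim,
      trivial, s.trans _ _ _ h₁ h₂]
  antisymm := by
    rintro ⟨f, ⟨_ | a, ha⟩⟩ ⟨g, ⟨_ | b, hb⟩⟩ h₁ h₂
    · obtain rfl : f = g := le_antisymm (α := Σₗ c : Arr U.C, Arr (U.F c)) h₁ h₂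
      rfl
    · exact h₁.elim
    · exact h₂.elim
    · obtain ⟨rfl, h⟩ := Sigma.mk.inj_iff.1 (s.antisymm _ _ h₁ h₂)
      obtain rfl := eq_of_heq h
      rfl
  total := by
    rintro ⟨f, ⟨_ | a, ha⟩⟩ ⟨g, ⟨_ | b, hb⟩⟩
    · exact le_total (α := Σₗ c : Arr U.C, Arr (U.F c)) _ _
    · exact Or.inr trivial
    · exact Or.inl trivial
    · exact s.total _ _
  agrees := by
    rintro _ _ ⟨f, ⟨_ | a, ha⟩, ⟨_ | b, hb⟩, h⟩
    · exact le_refl (α := Σₗ c : Arr U.C, Arr (U.F c)) _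
    · exact absurd (show (⊤ : WithTop (I f)) ≤ (b : WithTop (I f)) from h) (by simp)
    · exact trivial
    · exact s.agrees _ _ (Sigma.LE.fiber f _ _ (WithTop.coe_le_coe.1 h))
  nested := by
    rintro f g ⟨i₁, h₁⟩ ⟨i₂, h₂⟩ ⟨i, hi⟩ hg h k
    have key : toLex f ≤ toLex g → toLex g ≤ toLex f → False := fun h₁ h₂ =>
      hg (le_antisymm (α := Σₗ c : Arr U.C, Arr (U.F c)) h₂ h₁)
    rcases i with _ | i
    · rcases i₂ with _ | i₂
      · rcases i₁ with _ | i₁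
        · exact (key h k).elim
        · exact (key (hPQ f g (h₁.1 (WithTop.coe_ne_top (a := i₁))) (hi.2 rfl)) k).elim
      · exact k.elim
    · rcases i₁ with _ | i₁
      · exact h.elim
      · rcases i₂ with _ | i₂
        -- An old element of g lies between an old element of f and the new one. Here `hPQ` gives g
        -- ≤ f, and on a common level condition 3 would put all of g before f; so the level of g is
        -- strictly lower.
        · have hgf := hPQ g f (hi.1 (WithTop.coe_ne_top (a := i))) (h₂.2 rfl)
          rcases Sigma.Lex.le_def.1 hgf with h' | ⟨h', h''⟩
          · exact h'
          · obtain ⟨c, f⟩ := f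
            obtain ⟨d, g⟩ := g
            obtain rfl : d = c := h'
            have hlt : g < f := lt_of_le_of_ne h'' (fun e => hg (by rw [e]))
            have := s.antisymm _ _ h (s.separated d g f hlt i i₁)
            exact (hg (congrArg Sigma.fst this).symm).elim
        · exact s.nested f g i₁ i₂ i hg h k
  separated := by
    rintro c f g hfg ⟨_ | i, hi⟩ ⟨_ | j, hj⟩
    · exact Sigma.Lex.le_def.2 (Or.inr ⟨rfl, hfg.le⟩)
    · rcases Sigma.Lex.le_def.1 (hPQ ⟨c, g⟩ ⟨c, f⟩ (hj.1 (WithTop.coe_ne_top (a := j))) (hi.2 rfl))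
        with h' | ⟨h', h''⟩
      · exact (lt_irrefl _ h').elim
      · exact (not_lt_of_ge h'' hfg).elim
    · exact trivial
    · exact s.separated c f g hfg i j

/-- The map of disjoint unions induced by a family of maps `I' f → WithTop (I f)`. -/
def topMap (ρ : ∀ f, I' f →o WithTop (I f)) (x : Σ f, I' f) : Σ f, WithTop (I f) :=
  ⟨x.1, ρ x.1 x.2⟩

/-- The condition on a family of maps `I' f → WithTop (I f)` under which an
allowed order on `Σ f, I f` induces one on `Σ f, I' f`. -/
def TopCompatible (ρ : ∀ f, I' f →o WithTop (I f)) : Prop :=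
  ∀ f g a b, ρ f a ≠ ⊤ → ρ g b = ⊤ → toLex f ≤ toLex g

/-- The allowed order on `Σ f, I' f` induced by one on `Σ f, I f`, for which the
elements with image `⊤` follow all the others. -/
def CellOrder.extend (s : CellOrder U I) (ρ : ∀ f, I' f →o WithTop (I f)) (hρ : TopCompatible ρ) :
    CellOrder U I' :=
  -- Old elements are kept only for labels where ρ takes a value other than `⊤`, and the new one
  -- only where it takes the value `⊤`. The hypothesis on labels in `addTop` then reduces to `hρ`.
  (s.addTop (fun f => ∃ a, ρ f a ≠ ⊤) (fun f => ∃ a, ρ f a = ⊤)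
    (fun f g ⟨a, ha⟩ ⟨b, hb⟩ => hρ f g a b ha hb)).pullback
      (fun f => ⟨fun a => ⟨ρ f a, fun h => ⟨a, h⟩, fun h => ⟨a, h⟩⟩, fun _ _ h => (ρ f).monotone h⟩)

theorem CellOrder.extend_le (s : CellOrder U I) (ρ : ∀ f, I' f →o WithTop (I f))
    (hρ : TopCompatible ρ) (x y : Σ f, I' f) :
    (s.extend ρ hρ).le x y ↔
      x ≤ y ∨ (topMap ρ x ≠ topMap ρ y ∧ s.extLE (topMap ρ x) (topMap ρ y)) := by
  refine or_congr Iff.rfl (and_congr (not_congr ?_) Iff.rfl)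
  obtain ⟨f, a⟩ := x
  obtain ⟨g, b⟩ := y
  constructor
  · exact fun h => congrArg ExtIndex.val h
  · intro h
    obtain rfl : f = g := congrArg Sigma.fst h
    refine congrArg (Sigma.mk f) (Subtype.ext ?_)
    exact eq_of_heq (Sigma.mk.inj_iff.1 h).2

theorem CellOrder.extend_pullback {I'' : U.Cells → Type w} [∀ f, LinearOrder (I'' f)]
    (s : CellOrder U I) (ρ : ∀ f, I' f →o WithTop (I f)) (hρ : TopCompatible ρ)
    (η : ∀ f, I'' f →o I' f) (ρ' : ∀ f, I'' f →o WithTop (I f)) (hρ' : TopCompatible ρ')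
    (h : ∀ f a, ρ f (η f a) = ρ' f a) :
    (s.extend ρ hρ).pullback η = s.extend ρ' hρ' := by
  have e : ∀ x, topMap ρ (sumMap η x) = topMap ρ' x := fun x => congrArg (Sigma.mk x.1) (h _ _)
  ext x y
  rw [extend, pullback_pullback, extend_le]
  refine or_congr Iff.rfl (and_congr (not_congr ?_) ?_)
  · rw [← e, ← e]
    obtain ⟨f, a⟩ := x
    obtain ⟨g, b⟩ := y
    constructor
    · exact fun h => congrArg ExtIndex.val h
    · intro h
      obtain rfl : f = g := congrArg Sigma.fst h
      refine congrArg (Sigma.mk f) (Subtype.ext ?_)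
      exact eq_of_heq (Sigma.mk.inj_iff.1 h).2
  · rw [← e, ← e]
    rfl

/-- Together with `extend_pullback`, this makes the extension natural: both ways around the square
are the extension of s along one family of maps to `WithTop (I f)`. -/
theorem CellOrder.pullback_extend {I₁ : U.Cells → Type w} [∀ f, LinearOrder (I₁ f)]
    (s : CellOrder U I) (θ : ∀ f, I₁ f →o I f) (ρ : ∀ f, I' f →o WithTop (I₁ f))
    (hρ : TopCompatible ρ) (ρ' : ∀ f, I' f →o WithTop (I f)) (hρ' : TopCompatible ρ')
    (h : ∀ f a, ρ' f a = (ρ f a).map (θ f)) :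
    (s.pullback θ).extend ρ hρ = s.extend ρ' hρ' := by
  ext ⟨f, a⟩ ⟨g, b⟩
  rw [extend_le, extend_le]
  simp only [topMap, h]
  by_cases hab : (⟨f, a⟩ : Σ f, I' f) ≤ ⟨g, b⟩
  · simp [hab]
  refine or_congr Iff.rfl ?_
  rcases ha : ρ f a with _ | a' <;> rcases hb : ρ g b with _ | b'
  · refine and_congr (not_congr ?_) Iff.rfl
    constructor <;> intro e <;> obtain rfl : f = g := congrArg Sigma.fst e <;> rfl
  · exact ⟨fun h => h.2.elim, fun h => h.2.elim⟩
  · refine and_congr (not_congr ?_) Iff.rfl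
    constructor <;> intro e <;> obtain rfl : f = g := congrArg Sigma.fst e
    · exact absurd (eq_of_heq (Sigma.mk.inj_iff.1 e).2) (WithTop.coe_ne_top (a := a'))
    · exact absurd (eq_of_heq (Sigma.mk.inj_iff.1 e).2) (WithTop.coe_ne_top (a := θ f a'))
  · constructor
    · rintro ⟨hne, hle | ⟨hne', hle⟩⟩
      -- The comparison takes place inside one label. If b ≤ a held, monotonicity of ρ would force
      -- a' = b'; hence a ≤ b, which `hab` excludes.
      · refine absurd ?_ hab
        obtain ⟨_, _, _, hab'⟩ := hle
        refine Sigma.LE.fiber f _ _ (le_of_not_ge fun hba => hne ?_)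
        have := (ρ f).monotone hba
        rw [ha, hb] at this
        exact congrArg (fun z => (⟨f, some z⟩ : Σ f, WithTop (I₁ f)))
          (le_antisymm hab' (WithTop.coe_le_coe.1 this))
      · refine ⟨fun e => hne' ?_, hle⟩
        obtain rfl : f = g := congrArg Sigma.fst e
        exact congrArg (Sigma.mk f) (WithTop.coe_injective (eq_of_heq (Sigma.mk.inj_iff.1 e).2))
    · rintro ⟨hne, hle⟩
      have hne' : sumMap θ ⟨f, a'⟩ ≠ sumMap θ ⟨g, b'⟩ := fun e => hne (by
        obtain rfl : f = g := congrArg Sigma.fst e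
        exact congrArg (fun z => (⟨f, some z⟩ : Σ f, WithTop (I f)))
          (eq_of_heq (Sigma.mk.inj_iff.1 e).2))
      refine ⟨fun e => hne' ?_, Or.inr ⟨hne', hle⟩⟩
      obtain rfl : f = g := congrArg Sigma.fst e
      rw [WithTop.coe_injective (eq_of_heq (Sigma.mk.inj_iff.1 e).2)]

theorem CellOrder.extend_coe (s : CellOrder U I) (ρ : ∀ f, I f →o WithTop (I f))
    (hρ : TopCompatible ρ) (h : ∀ f a, ρ f a = a) : s.extend ρ hρ = s := by
  ext ⟨f, a⟩ ⟨g, b⟩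
  rw [extend_le]
  simp only [topMap, h]
  constructor
  · rintro (h | ⟨-, h⟩)
    · exact s.agrees _ _ h
    · exact h
  · intro h'
    by_cases e : (⟨f, a⟩ : Σ f, I f) = ⟨g, b⟩
    · exact Or.inl e.le
    · refine Or.inr ⟨fun e' => e ?_, h'⟩
      obtain rfl : f = g := congrArg Sigma.fst e'
      simpa using e'

/-- Once every element goes to `⊤`, the comparison only sees the labels and the orders of the sets
`I' f`. This independence of s is why the final collapse factors through the augmentation. -/
theorem CellOrder.extend_top {I₁ : U.Cells → Type w} [∀ f, LinearOrder (I₁ f)]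
    (s : CellOrder U I) (s₁ : CellOrder U I₁) (ρ : ∀ f, I' f →o WithTop (I f))
    (hρ : TopCompatible ρ)  (ρ₁ : ∀ f, I' f →o WithTop (I₁ f)) (hρ₁ : TopCompatible ρ₁)
    (h : ∀ f a, ρ f a = ⊤) (h₁ : ∀ f a, ρ₁ f a = ⊤) : s.extend ρ hρ = s₁.extend ρ₁ hρ₁ := by
  ext ⟨f, a⟩ ⟨g, b⟩
  rw [extend_le, extend_le]
  simp only [topMap, h, h₁]
  refine or_congr Iff.rfl (and_congr (not_congr ?_) Iff.rfl)
  constructor <;> intro e <;> obtain rfl : f = g := congrArg Sigma.fst e <;> rfl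

variable {J : Type v} [LinearOrder J] [OrderTop J]

/-- The extension of a map from a disjoint union to the last elements added to its terms. -/
def topExtend (W : (Σ f, I f) → J) : (Σ f, WithTop (I f)) → J
  | ⟨f, some a⟩ => W ⟨f, a⟩
  | ⟨_, none⟩ => ⊤

theorem Seq.topExtend_mono (s : Seq U I J) : ∀ {x y : Σ f, WithTop (I f)}, s.extLE x y →
    topExtend s.W x ≤ topExtend s.W y
  | ⟨_, some _⟩, ⟨_, some _⟩, h => s.monotone_W _ _ h
  | ⟨_, some _⟩, ⟨_, none⟩, _ => le_top
  | ⟨_, none⟩, ⟨_, none⟩, _ => le_top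

theorem CellOrder.extLE_of_le (s : CellOrder U I) {f : U.Cells} :
    ∀ {a b : WithTop (I f)}, a ≤ b → s.extLE ⟨f, a⟩ ⟨f, b⟩
  | some _, some _, h => s.agrees _ _ (Sigma.LE.fiber f _ _ (WithTop.coe_le_coe.1 h))
  | some _, none, _ => trivial
  | none, some b, h => (WithTop.not_top_le_coe b h).elim
  | none, none, _ => le_refl (α := Σₗ c : Arr U.C, Arr (U.F c)) _

/-- The element of `seq(U)` induced on `Σ f, I' f` by one on `Σ f, I f`, for which the
elements with image `⊤` follow all the others and are sent to the last element of `J`. -/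
def Seq.extend (s : Seq U I J) (ρ : ∀ f, I' f →o WithTop (I f)) (hρ : TopCompatible ρ) :
    Seq U I' J where
  toCellOrder := s.toCellOrder.extend ρ hρ
  W x := topExtend s.W (topMap ρ x)
  monotone_W x y h := by
    apply s.topExtend_mono
    rcases (s.extend_le ρ hρ _ _).1 h with ⟨f, a, b, hab⟩ | ⟨-, h⟩
    · exact s.extLE_of_le ((ρ f).monotone hab)
    · exact h

theorem Seq.extend_pullback {I'' : U.Cells → Type w} [∀ f, LinearOrder (I'' f)]
    (s : Seq U I J) (ρ : ∀ f, I' f →o WithTop (I f)) (hρ : TopCompatible ρ)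
    (η : ∀ f, I'' f →o I' f) (ρ' : ∀ f, I'' f →o WithTop (I f)) (hρ' : TopCompatible ρ')
    (h : ∀ f a, ρ f (η f a) = ρ' f a) :
    (s.extend ρ hρ).pullback η = s.extend ρ' hρ' :=
  Seq.ext (congrArg CellOrder.le (s.toCellOrder.extend_pullback ρ hρ η ρ' hρ' h))
    (funext fun x => congrArg (fun z => topExtend s.W ⟨x.1, z⟩) (h x.1 x.2))

theorem Seq.pullback_extend {I₁ : U.Cells → Type w} [∀ f, LinearOrder (I₁ f)]
    (s : Seq U I J) (θ : ∀ f, I₁ f →o I f) (ρ : ∀ f, I' f →o WithTop (I₁ f))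
    (hρ : TopCompatible ρ) (ρ' : ∀ f, I' f →o WithTop (I f)) (hρ' : TopCompatible ρ')
    (h : ∀ f a, ρ' f a = (ρ f a).map (θ f)) :
    (s.pullback θ).extend ρ hρ = s.extend ρ' hρ' := by
  refine Seq.ext (congrArg CellOrder.le (s.toCellOrder.pullback_extend θ ρ hρ ρ' hρ' h)) ?_
  funext x
  change topExtend _ ⟨x.1, ρ x.1 x.2⟩ = topExtend _ ⟨x.1, ρ' x.1 x.2⟩
  rw [h]
  cases ρ x.1 x.2 <;> rfl

theorem Seq.extend_coe (s : Seq U I J) (ρ : ∀ f, I f →o WithTop (I f))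
    (hρ : TopCompatible ρ) (h : ∀ f a, ρ f a = a) : s.extend ρ hρ = s :=
  Seq.ext (congrArg CellOrder.le (s.toCellOrder.extend_coe ρ hρ h))
    (funext fun x => congrArg (fun z => topExtend s.W ⟨x.1, z⟩) (h x.1 x.2))

theorem Seq.extend_top {I₁ : U.Cells → Type w} [∀ f, LinearOrder (I₁ f)]
    (s : Seq U I J) (s₁ : Seq U I₁ J) (ρ : ∀ f, I' f →o WithTop (I f))
    (hρ : TopCompatible ρ) (ρ₁ : ∀ f, I' f →o WithTop (I₁ f)) (hρ₁ : TopCompatible ρ₁)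
    (h : ∀ f a, ρ f a = ⊤) (h₁ : ∀ f a, ρ₁ f a = ⊤) : s.extend ρ hρ = s₁.extend ρ₁ hρ₁ :=
  Seq.ext (congrArg CellOrder.le
    (s.toCellOrder.extend_top s₁.toCellOrder ρ hρ ρ₁ hρ₁ h h₁))
    (funext fun x => (congrArg (fun z => topExtend s.W ⟨x.1, z⟩) (h x.1 x.2)).trans
      (congrArg (fun z => topExtend s₁.W ⟨x.1, z⟩) (h₁ x.1 x.2)).symm)

end Extension

end TwoOrdinal

/-! ### Three operations on a simplicial variable -/

section ExtMode

/-- The three ways of changing a simplicial variable: leave it, add a last element, replace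
it by a point. -/
inductive ExtMode
  | keep
  | cone
  | collapse

namespace ExtMode

/-- The operation on ordinals. -/
def functor : ExtMode → SimplexCategory ⥤ SimplexCategory
  | keep => 𝟭 _
  | cone => coneFunctor
  | collapse => (Functor.const _).obj (SimplexCategory.mk 0)

/-- The map to an ordinal with a last element added. -/
def rho : (e : ExtMode) → (n : SimplexCategory) →
    Fin ((e.functor.obj n).len + 1) →o WithTop (Fin (n.len + 1))
  | keep, _ => ⟨WithTop.some, fun _ _ h => WithTop.coe_le_coe.2 h⟩
  | cone, n => ⟨Fin.lastCases (n := n.len + 1) (motive := fun _ => WithTop (Fin (n.len + 1))) ⊤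
      WithTop.some, by
      intro a b h
      change Fin (n.len + 1 + 1) at a b
      induction b using Fin.lastCases with
      | last => simp
      | cast b =>
        induction a using Fin.lastCases with
        | last => exact absurd h (Fin.castSucc_lt_last b).not_ge
        | cast a => simpa using Fin.castSucc_le_castSucc_iff.1 h⟩
  | collapse, _ => ⟨fun _ => ⊤, fun _ _ _ => le_rfl⟩

theorem rho_map (e : ExtMode) {m n : SimplexCategory} (θ : m ⟶ n) (a) :
    e.rho n ((e.functor.map θ).toOrderHom a) = (e.rho m a).map θ.toOrderHom := by
  cases e with
  | keep => rfl
  | cone =>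
    change Fin (m.len + 1 + 1) at a
    change Fin.lastCases (motive := fun _ => WithTop (Fin (n.len + 1))) _ _
      (coneHom θ.toOrderHom a) = WithTop.map _ (Fin.lastCases (motive := fun _ => _) _ _ a)
    induction a using Fin.lastCases <;> simp
  | collapse => rfl

theorem rho_eq_top {e : ExtMode} {n : SimplexCategory} {a} (h : e.rho n a = ⊤) : e ≠ keep := by
  rintro rfl
  exact WithTop.coe_ne_top (α := Fin (n.len + 1)) h

theorem rho_ne_top {e : ExtMode} {n : SimplexCategory} {a} (h : e.rho n a ≠ ⊤) :
    e ≠ collapse := by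
  rintro rfl
  exact h rfl

/-- The operation before adding a last element. -/
def start : ExtMode → ExtMode
  | keep => keep
  | cone => keep
  | collapse => collapse

/-- The operation with only the added last element. -/
def finish : ExtMode → ExtMode
  | keep => keep
  | cone => collapse
  | collapse => collapse

/-- The inclusion of the old elements. -/
def startMap : (e : ExtMode) → (n : SimplexCategory) →
    (e.start.functor.obj n ⟶ e.functor.obj n)
  | keep, _ => 𝟙 _
  | cone, n => coneIncl n
  | collapse, _ => 𝟙 _

/-- The inclusion of the new element. -/
def finishMap : (e : ExtMode) → (n : SimplexCategory) →
    (e.finish.functor.obj n ⟶ e.functor.obj n)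
  | keep, _ => 𝟙 _
  | cone, n => coneApex n
  | collapse, _ => 𝟙 _

theorem rho_startMap (e : ExtMode) (n : SimplexCategory) (a) :
    e.rho n ((e.startMap n).toOrderHom a) = e.start.rho n a := by
  cases e with
  | keep => rfl
  | cone => exact Fin.lastCases_castSucc (motive := fun _ => WithTop (Fin (n.len + 1))) _
  | collapse => rfl

theorem rho_finishMap (e : ExtMode) (n : SimplexCategory) (a) :
    e.rho n ((e.finishMap n).toOrderHom a) = e.finish.rho n a := by
  cases e with
  | keep => rfl
  | cone => exact Fin.lastCases_last (motive := fun _ => WithTop (Fin (n.len + 1)))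
  | collapse => rfl

variable (k : Type u) [CommRing k]

/-- The map of chains given by the inclusion of the old elements. -/
noncomputable def chainMap : (e : ExtMode) → (n : SimplexCategory) →
    ((simplexChains k).obj n ⟶ (simplexChains k).obj (e.functor.obj n))
  | keep, _ => 𝟙 _
  | cone, n => (simplexChains k).map (coneIncl n)
  | collapse, n => constChains n (𝟙 _)

/-- The map of chains given by the new element. -/
noncomputable def apexChainMap : (e : ExtMode) → (n : SimplexCategory) →
    ((simplexChains k).obj n ⟶ (simplexChains k).obj (e.functor.obj n))
  | keep, _ => 𝟙 _
  | cone, n => constChains n (coneApex n)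
  | collapse, n => constChains n (𝟙 _)

/-- The homotopy between the two maps of chains. -/
noncomputable def homotopy : (e : ExtMode) → (n : SimplexCategory) →
    Homotopy (e.chainMap k n) (e.apexChainMap k n)
  | keep, _ => Homotopy.refl _
  | cone, n => simplexConeHomotopy n
  | collapse, _ => Homotopy.refl _

theorem chainMap_start (e : ExtMode) (n : SimplexCategory) :
    e.start.chainMap k n ≫ (simplexChains k).map (e.startMap n) = e.chainMap k n := by
  cases e with
  | keep => exact (Category.id_comp _).trans (CategoryTheory.Functor.map_id _ _)
  | cone => exact Category.id_comp _
  | collapse => exact (constChains_map _ _ _).trans (congrArg _ (Category.id_comp _))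

theorem chainMap_finish (e : ExtMode) (n : SimplexCategory) :
    e.finish.chainMap k n ≫ (simplexChains k).map (e.finishMap n) = e.apexChainMap k n := by
  cases e with
  | keep => exact (Category.id_comp _).trans (CategoryTheory.Functor.map_id _ _)
  | cone => exact (constChains_map _ _ _).trans (congrArg _ (Category.id_comp _))
  | collapse => exact (constChains_map _ _ _).trans (congrArg _ (Category.id_comp _))

theorem chainMap_naturality (e : ExtMode) {m n : SimplexCategory} (θ : m ⟶ n) :
    (simplexChains k).map θ ≫ e.chainMap k n =
      e.chainMap k m ≫ (simplexChains k).map (e.functor.map θ) := by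
  cases e with
  | keep => exact (Category.comp_id _).trans (Category.id_comp _).symm
  | cone =>
    exact (Functor.map_comp (simplexChains k) θ (coneIncl n)).symm.trans
      ((congrArg (simplexChains k).map (coneIncl_naturality θ)).trans
        (Functor.map_comp (simplexChains k) (coneIncl m) (coneFunctor.map θ)))
  | collapse =>
    exact (map_constChains _ _).trans ((constChains_map _ _ _).trans
      (congrArg _ (Category.id_comp _))).symm

theorem apexChainMap_naturality (e : ExtMode) {m n : SimplexCategory} (θ : m ⟶ n) :
    (simplexChains k).map θ ≫ e.apexChainMap k n =
      e.apexChainMap k m ≫ (simplexChains k).map (e.functor.map θ) := by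
  cases e with
  | keep => exact (Category.comp_id _).trans (Category.id_comp _).symm
  | cone =>
    exact (map_constChains _ _).trans ((constChains_map _ _ _).trans
      (congrArg _ (coneApex_map θ))).symm
  | collapse =>
    exact (map_constChains _ _).trans ((constChains_map _ _ _).trans
      (congrArg _ (Category.id_comp _))).symm

theorem homotopy_naturality (e : ExtMode) {m n : SimplexCategory} (θ : m ⟶ n) (p q : ℕ) :
    ((simplexChains k).map θ).f p ≫ (e.homotopy k n).hom p q =
      (e.homotopy k m).hom p q ≫ ((simplexChains k).map (e.functor.map θ)).f q := by
  cases e with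
  | keep => exact Limits.comp_zero.trans Limits.zero_comp.symm
  | cone => exact simplexConeHomotopy_naturality θ p q
  | collapse => exact Limits.comp_zero.trans Limits.zero_comp.symm

end ExtMode

end ExtMode

/-! ### Collapsing the labels one by one -/

namespace TwoOrdinal

variable {U : TwoOrdinal.{u}}

/-- The condition under which a family of operations on ordinals acts on allowed orders. -/
def ModeCompatible (m : U.Cells → ExtMode) : Prop :=
  ∀ f g, m f ≠ .collapse → m g ≠ .keep → toLex f ≤ toLex g

theorem ModeCompatible.top {m : U.Cells → ExtMode} (hm : ModeCompatible m)
    (n : U.Cells → SimplexCategory) :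
    TopCompatible (U := U) (fun f => (m f).rho (n f)) :=
  fun f g _ _ ha hb => hm f g (ExtMode.rho_ne_top ha) (ExtMode.rho_eq_top hb)

theorem ModeCompatible.start {m : U.Cells → ExtMode} (hm : ModeCompatible m) :
    ModeCompatible fun f => (m f).start := by
  refine fun f g ha hb => hm f g (fun h => ?_) (fun h => ?_)
  · simp [h, ExtMode.start] at ha
  · simp [h, ExtMode.start] at hb

theorem ModeCompatible.finish {m : U.Cells → ExtMode} (hm : ModeCompatible m) :
    ModeCompatible fun f => (m f).finish := by
  refine fun f g ha hb => hm f g (fun h => ?_) (fun h => ?_)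
  · simp [h, ExtMode.finish] at ha
  · simp [h, ExtMode.finish] at hb

/-- The multi-index obtained by applying an operation to each variable. -/
abbrev modeObj (m : U.Cells → ExtMode)
    (n : U.Cells → SimplexCategory) : U.Cells → SimplexCategory :=
  fun f => (m f).functor.obj (n f)

variable {J : Type} [LinearOrder J] [OrderTop J]

/-- The action of a family of operations on the elements of `seq(U)`. -/
def modeElem {m : U.Cells → ExtMode} (hm : ModeCompatible m) {n : U.Cells → SimplexCategory}
    (x : (U.seqPoly J).obj (op n)) : (U.seqPoly J).obj (op (modeObj m n)) :=
  Seq.extend (U := U) x (fun f => (m f).rho (n f)) (hm.top n)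

theorem modeElem_map {m : U.Cells → ExtMode} (hm : ModeCompatible m)
    {n n' : U.Cells → SimplexCategory} (θ : n' ⟶ n) (x : (U.seqPoly J).obj (op n)) :
    (U.seqPoly J).map (Quiver.Hom.op (show modeObj m n' ⟶ modeObj m n from
      fun f => (m f).functor.map (θ f))) (modeElem hm x) =
      modeElem hm ((U.seqPoly J).map θ.op x) := by
  have hc : TopCompatible (U := U) (I' := fun f => Fin (((m f).functor.obj (n' f)).len + 1))
      (fun f => ((m f).rho (n f)).comp ((m f).functor.map (θ f)).toOrderHom) :=
    fun f g a b ha hb => hm.top n f g _ _ ha hb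
  refine (Seq.extend_pullback (U := U) x _ (hm.top n) _ _ hc (fun _ _ => rfl)).trans
    (Seq.pullback_extend (U := U) x _ _ (hm.top n') _ hc ?_).symm
  exact fun f a => (m f).rho_map (θ f) a

/-- Applied to `startMap` and `finishMap`, this exhibits the results of the two end operations as
restrictions of the element extended by cones. -/
theorem map_modeElem {m m' : U.Cells → ExtMode} (hm : ModeCompatible m) (hm' : ModeCompatible m')
    {n : U.Cells → SimplexCategory} (η : modeObj m n ⟶ modeObj m' n)
    (hη : ∀ f a, (m' f).rho (n f) ((η f).toOrderHom a) = (m f).rho (n f) a)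
    (x : (U.seqPoly J).obj (op n)) :
    (U.seqPoly J).map η.op (modeElem hm' x) = modeElem hm x :=
  Seq.extend_pullback (U := U) x _ (hm'.top n) _ _ (hm.top n) hη

variable (k : Type u) [CommRing k] (l : List U.Cells)

/-- The property that an endomorphism of `k[seq(U)] ⊗ C_*(Δ^•)^{⊠ l}` is induced by a family
of operations. -/
def IsModeMap {m : U.Cells → ExtMode} (hm : ModeCompatible m)
    (P : (chainRealization k (boxChains k l)).obj (U.seqPoly J) ⟶
      (chainRealization k (boxChains k l)).obj (U.seqPoly J)) : Prop :=
  ∀ n (x : (U.seqPoly J).obj (op n)), ιRealization (boxChains k l) x ≫ P =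
    boxHom (n' := modeObj m n) (fun f => (m f).chainMap k (n f)) l ≫
      ιRealization (boxChains k l) (modeElem hm x)

theorem exists_isModeMap {m : U.Cells → ExtMode} (hm : ModeCompatible m) :
    ∃ P, IsModeMap (J := J) k l hm P := by
  apply realization_exists_desc
  intro n' n θ x
  rw [← modeElem_map, ← map_ιRealization, boxChains_map, boxChains_map, ← Category.assoc,
    ← Category.assoc, boxHom_comp, boxHom_comp]
  refine congrArg (boxHom · l ≫ _) (funext fun f => ?_)
  exact ExtMode.chainMap_naturality k (m f) (θ f)

/-- Both maps can be rewritten with the same element `modeElem hm x`, restricted along `startMap` or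
`finishMap`. They then differ only by chain maps, joined by the tensor product of the cone
homotopies at labels in mode `cone` and of constant homotopies at the others. -/
theorem IsModeMap.homotopy {m : U.Cells → ExtMode} (hm : ModeCompatible m) {P Q}
    (hP : IsModeMap (J := J) k l hm.start P) (hQ : IsModeMap (J := J) k l hm.finish Q) :
    Nonempty (Homotopy P Q) := by
  have hP' (n) (x : (U.seqPoly J).obj (op n)) : ιRealization (boxChains k l) x ≫ P =
      boxHom (n' := modeObj m n) (fun f => (m f).chainMap k (n f)) l ≫
      ιRealization (boxChains k l) (modeElem hm x) := by
    rw [hP, ← map_modeElem hm.start hm (fun f => (m f).startMap (n f))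
      (fun f a => (m f).rho_startMap (n f) a), ← map_ιRealization, boxChains_map, ← Category.assoc,
      boxHom_comp]
    exact congrArg (boxHom · l ≫ _) (funext fun f => ExtMode.chainMap_start k (m f) (n f))
  have hQ' (n) (x : (U.seqPoly J).obj (op n)) : ιRealization (boxChains k l) x ≫ Q =
      boxHom (n' := modeObj m n) (fun f => (m f).apexChainMap k (n f)) l ≫
      ιRealization (boxChains k l) (modeElem hm x) := by
    rw [hQ, ← map_modeElem hm.finish hm (fun f => (m f).finishMap (n f))
      (fun f a => (m f).rho_finishMap (n f) a), ← map_ιRealization, boxChains_map, ← Category.assoc,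
      boxHom_comp]
    exact congrArg (boxHom · l ≫ _) (funext fun f => ExtMode.chainMap_finish k (m f) (n f))
  let H (n : U.Cells → SimplexCategory) := boxHomotopy (n' := modeObj m n)
    (fun f => (m f).homotopy k (n f)) l
  refine realization_homotopy _ (fun n x => (Homotopy.ofEq (hP' n x)).trans
    (((H n).compRight (ιRealization (boxChains k l) (modeElem hm x))).trans
      (Homotopy.ofEq (hQ' n x).symm))) ?_
  intro n' n θ x p q
  simp only [Homotopy.trans_hom, Homotopy.ofEq_hom, Homotopy.compRight_hom, Pi.zero_apply, zero_add,
    add_zero]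
  rw [← modeElem_map, ← map_ιRealization, HomologicalComplex.comp_f, ← Category.assoc,
    ← Category.assoc]
  refine congrArg (· ≫ _) ?_
  exact boxHomotopy_naturality (n' := modeObj m n') (m' := modeObj m n)
    (fun f => (m f).homotopy k (n' f)) (fun f => (m f).homotopy k (n f)) θ _
    (fun f => ExtMode.chainMap_naturality k (m f) (θ f))
    (fun f => ExtMode.apexChainMap_naturality k (m f) (θ f))
    (fun f => ExtMode.homotopy_naturality k (m f) (θ f)) l p q

open Classical in
/-- The operations which collapse the labels in a set of cells. -/
noncomputable def collapseMode (D : Finset (Σₗ c : Arr U.C, Arr (U.F c))) (f : U.Cells) : ExtMode :=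
  if toLex f ∈ D then .collapse else .keep

/-- New elements follow all the old ones, so the labels that receive them must come last; this is
why D is an upper set. -/
theorem collapseMode_compatible {D : Finset (Σₗ c : Arr U.C, Arr (U.F c))}
    (hD : IsUpperSet (D : Set (Σₗ c : Arr U.C, Arr (U.F c)))) :
    ModeCompatible (collapseMode D) := by
  intro f g hf hg
  have hf : toLex f ∉ D := fun h => by simp [collapseMode, h] at hf
  have hg : toLex g ∈ D := by by_contra h; simp [collapseMode, h] at hg
  by_contra h
  exact hf (hD (le_of_not_ge h) hg)

theorem IsModeMap.of_eq {m m' : U.Cells → ExtMode} (h : m = m') {hm : ModeCompatible m} {P}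
    (hP : IsModeMap (J := J) k l hm P) (hm' : ModeCompatible m') : IsModeMap k l hm' P := by
  subst h
  exact hP

theorem IsModeMap.eq_id {m : U.Cells → ExtMode} (h : ∀ f, m f = .keep) {hm : ModeCompatible m} {P}
    (hP : IsModeMap (J := J) k l hm P) : P = 𝟙 _ := by
  obtain rfl : m = fun _ => .keep := funext h
  refine realization_hom_ext _ fun n x => (hP n x).trans ?_
  have h₁ : boxHom (k := k) (n' := n) (fun f => 𝟙 _) l = 𝟙 _ := by
    rw [← CategoryTheory.Functor.map_id, boxChains_map]
    exact congrArg (boxHom · l) (funext fun f => (CategoryTheory.Functor.map_id _ _).symm)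
  have h₂ : modeElem hm x = x := Seq.extend_coe (U := U) x _ (hm.top n) fun _ _ => rfl
  refine Eq.trans ?_ (Category.comp_id _).symm
  refine Eq.trans ?_ (Category.id_comp _)
  exact congr (congrArg (· ≫ ·) h₁) (congrArg (ιRealization (boxChains k l)) h₂)

/-- Induction on the size of D: the larger labels of D are collapsed already, and the cone homotopy
at the least label of D collapses one more. -/
theorem homotopy_id_collapse (D : Finset (Σₗ c : Arr U.C, Arr (U.F c)))
    (hD : IsUpperSet (D : Set (Σₗ c : Arr U.C, Arr (U.F c)))) (P)
    (hP : IsModeMap (J := J) k l (collapseMode_compatible hD) P) :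
    Nonempty (Homotopy (𝟙 _) P) := by
  classical
  induction h : D.card generalizing D P with
  | zero =>
    obtain rfl := Finset.card_eq_zero.1 h
    exact ⟨Homotopy.ofEq (hP.eq_id k l fun f => by simp [collapseMode]).symm⟩
  | succ j ih =>
    have hne : D.Nonempty := Finset.card_pos.1 (by lia)
    have hmin := D.min'_le
    have hmem := D.min'_mem hne
    set f := D.min' hne
    have hE : IsUpperSet ((D.erase f : Finset _) : Set (Σₗ c : Arr U.C, Arr (U.F c))) := by
      intro a b hab ha
      simp only [Finset.coe_erase, Set.mem_sdiff, Finset.mem_coe, Set.mem_singleton_iff] at ha ⊢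
      refine ⟨hD hab ha.1, ?_⟩
      rintro rfl
      exact ha.2 (le_antisymm hab (hmin a ha.1))
    -- The least label f of D is coned and the rest of D is collapsed. The start of this family of
    -- operations collapses D without f, and its finish collapses D.
    let m (g : U.Cells) : ExtMode := if toLex g = f then .cone else collapseMode D g
    have hm : ModeCompatible m := by
      intro a b ha hb
      by_cases hb' : toLex b ∈ D
      · by_cases ha' : toLex a = f
        · exact ha' ▸ hmin _ hb'
        · by_contra hab
          refine ha ?_
          have : toLex a ∈ D := hD (le_of_not_ge hab) hb'
          simp [m, ha', collapseMode, this]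
      · have : toLex b ≠ f := fun e => hb' (e ▸ hmem)
        simp [m, collapseMode, hb', this] at hb
    have hs : (fun g => (m g).start) = collapseMode (D.erase f) := by
      funext g
      by_cases h₁ : toLex g = f <;> by_cases h₂ : toLex g ∈ D <;>
        simp [m, collapseMode, h₁, h₂, ExtMode.start]
    have hf : (fun g => (m g).finish) = collapseMode D := by
      funext g
      by_cases h₁ : toLex g = f <;> by_cases h₂ : toLex g ∈ D <;>
        simp [m, collapseMode, h₁, h₂, hmem, ExtMode.finish]
    obtain ⟨Q, hQ⟩ := exists_isModeMap (J := J) k l (collapseMode_compatible hE)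
    obtain ⟨h₁⟩ := ih (D.erase f) hE Q hQ (by rw [Finset.card_erase_of_mem hmem]; lia)
    obtain ⟨h₂⟩ := IsModeMap.homotopy k l hm (hQ.of_eq k l hs.symm hm.start)
      (hP.of_eq k l hf.symm hm.finish)
    exact ⟨h₁.trans h₂⟩

/-- The element of `seq(U)` on one-point ordinals, in lexicographic order, with constant value the
last element of `J`. -/
def topElem (J : Type) [LinearOrder J] [OrderTop J] :
    (U.seqPoly J).obj (op fun _ => SimplexCategory.mk 0) :=
  Seq.extend (U := U) (I := fun _ => PEmpty.{1})
    { le := fun x => x.2.elim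
      trans := fun x => x.2.elim
      antisymm := fun x => x.2.elim
      total := fun x => x.2.elim
      agrees := fun x => x.2.elim
      nested := fun _ _ i => i.elim
      separated := fun _ _ _ _ i => i.elim
      W := fun x => x.2.elim
      monotone_W := fun x => x.2.elim } (fun _ => ⟨fun _ => ⊤, fun _ _ _ => le_rfl⟩)
    (fun _ _ _ _ h => (h rfl).elim)

/-- The complex `k[seq(U)^J] ⊗ C_*(Δ^•)^{⊠ l}` is homotopy equivalent to `k`. -/
theorem exists_section_homotopy : ∃ σ : unitComplex k ⟶
    (chainRealization k (boxChains k l)).obj (U.seqPoly J),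
    σ ≫ chainRealizationAugmentation (boxChainsAugmentation k l) _ = 𝟙 _ ∧
    Nonempty (Homotopy (𝟙 _)
      (chainRealizationAugmentation (boxChainsAugmentation k l) (U.seqPoly J) ≫ σ)) := by
  refine ⟨boxVertex l ≫ ιRealization (boxChains k l) (topElem J), ?_, ?_⟩
  · exact (Category.assoc _ _ _).trans ((congrArg _ (ιRealization_augmentation _ _)).trans
      (boxVertex_augmentation l))
  · have hD : IsUpperSet ((Finset.univ : Finset (Σₗ c : Arr U.C, Arr (U.F c))) :
        Set (Σₗ c : Arr U.C, Arr (U.F c))) := fun _ _ _ _ => by simp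
    refine homotopy_id_collapse k l Finset.univ hD _ ?_
    have hm : ModeCompatible (U := U) fun _ => .collapse := fun _ _ h => (h rfl).elim
    refine IsModeMap.of_eq (m := fun _ => .collapse) k l (funext fun f => by simp [collapseMode])
      (hm := hm) (fun n x => ?_) _
    -- With all the labels collapsed, the extended element no longer depends on x.
    have h₁ : modeElem hm x = topElem J :=
      Seq.extend_top (U := U) x _ _ (hm.top n) _ _ (fun _ _ => rfl) (fun _ _ => rfl)
    refine Eq.trans ?_ (congr (congrArg (· ≫ ·) (boxHom_constChains n l).symm)
      (congrArg (ιRealization (boxChains k l)) h₁.symm))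
    refine (Category.assoc _ _ _).symm.trans ?_
    refine (congrArg (· ≫ _) (ιRealization_augmentation _ _)).trans ?_
    exact (Category.assoc _ _ _).symm

end TwoOrdinal

/-! ### Projectivity of the cosimplicial module of chains -/

section

open Limits MonoidalCategory CochainComplex.HomComplex

variable {k : Type u} [CommRing k]

section SimplexChainsProjective

open freeChains in
-- Yoneda: a natural map out of the free cosimplicial module on Δ([n], -) is given by its value on
-- the identity of [n]. One lift at J = [n] therefore suffices, and no naturality of the given lifts
-- is needed. Normalized chains inherit the property as a natural retract.
theorem simplexChains_exists_lift {n : ℕ} {M N : SimplexCategory ⥤ ModuleCat.{u} k}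
    (φ : ∀ J, ((simplexChains k).obj J).X n ⟶ N.obj J)
    (hφ : ∀ {J J'} (θ : J ⟶ J'), ((simplexChains k).map θ).f n ≫ φ J' = φ J ≫ N.map θ)
    (d : M ⟶ N)
    (h : ∀ J, ∃ y : ((simplexChains k).obj J).X n ⟶ M.obj J, y ≫ d.app J = φ J) :
    ∃ ψ : ∀ J, ((simplexChains k).obj J).X n ⟶ M.obj J,
      (∀ {J J'} (θ : J ⟶ J'), ((simplexChains k).map θ).f n ≫ ψ J' = ψ J ≫ M.map θ) ∧
      ∀ J, ψ J ≫ d.app J = φ J := by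
  obtain ⟨y, hy⟩ := h (SimplexCategory.mk n)
  let m : baseMod k ⟶ M.obj (SimplexCategory.mk n) :=
    gen (𝟙 _) ≫ (toNorm.app _).f n ≫ y
  let D (J : SimplexCategory) : ((freeChains k).obj J).X n ⟶ M.obj J := desc fun s => m ≫ M.map s
  have hD {J J' : SimplexCategory} (θ : J ⟶ J') :
      ((freeChains k).map θ).f n ≫ D J' = D J ≫ M.map θ := by
    apply freeChains.hom_ext
    intro s
    rw [gen_map_assoc, gen_desc, gen_desc_assoc, M.map_comp, Category.assoc m]
  have hto {J J' : SimplexCategory} (θ : J ⟶ J') : ((freeChains k).map θ).f n ≫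
      (toNorm.app J').f n = (toNorm.app J).f n ≫ ((simplexChains k).map θ).f n :=
    congrArg (fun f => HomologicalComplex.Hom.f f n) (toNorm (k := k).naturality θ)
  have hfrom {J J' : SimplexCategory} (θ : J ⟶ J') : ((simplexChains k).map θ).f n ≫
      (fromNorm.app J').f n = (fromNorm.app J).f n ≫ ((freeChains k).map θ).f n :=
    congrArg (fun f => HomologicalComplex.Hom.f f n) (fromNorm (k := k).naturality θ)
  refine ⟨fun J => (fromNorm.app J).f n ≫ D J, fun {J J'} θ => ?_, fun J => ?_⟩
  · rw [reassoc_of% (hfrom θ), hD, Category.assoc]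
  · have key : D J ≫ d.app J = (toNorm.app J).f n ≫ φ J := by
      apply freeChains.hom_ext
      intro s
      rw [gen_desc_assoc, Category.assoc m, d.naturality]
      simp only [m, Category.assoc]
      rw [reassoc_of% hy, ← hφ, ← reassoc_of% (hto s), gen_map_assoc, Category.id_comp]
    have e : (fromNorm.app J).f n ≫ (toNorm.app J).f n = 𝟙 _ :=
      congrArg (fun f => HomologicalComplex.Hom.f (NatTrans.app f J) n) (fromNorm_toNorm (k := k))
    rw [Category.assoc, key, reassoc_of% e]

open freeChains in
-- The projection of J to [0] makes φ factor through the normalized chains of a point. These are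
-- zero in positive degrees and generated by the vertex in degree 0.
theorem simplexChains_to_const_eq_zero {n : ℕ} {M : ModuleCat.{u} k}
    (φ : ∀ J, ((simplexChains k).obj J).X n ⟶ M)
    (hφ : ∀ {J J'} (θ : J ⟶ J'), ((simplexChains k).map θ).f n ≫ φ J' = φ J)
    (h : n = 0 → (vertexMap k).f n ≫ φ (SimplexCategory.mk 0) = 0) (J) : φ J = 0 := by
  have h₀ (c : SimplexCategory.mk n ⟶ SimplexCategory.mk 0) :
      gen c ≫ (toNorm.app _).f n ≫ φ (SimplexCategory.mk 0) = 0 := by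
    cases n with
    | zero =>
      obtain rfl : c = 𝟙 _ := Subsingleton.elim _ _
      have := congrArg (unitGen ≫ ·) (h rfl)
      rw [← vertex_toNorm, HomologicalComplex.comp_f, Category.assoc, unitGen_vertex_assoc] at this
      exact this.trans Limits.comp_zero
    | succ q =>
      rw [← Category.assoc, show c = SimplexCategory.σ 0 ≫ SimplexCategory.const _ _ 0 from
        Subsingleton.elim _ _, gen_toNorm_comp, Limits.zero_comp]
  let π : J ⟶ SimplexCategory.mk 0 := SimplexCategory.const _ _ 0
  have key : (toNorm.app J).f n ≫ φ J = 0 := by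
    apply freeChains.hom_ext
    intro s
    have e' : ((freeChains k).map π).f n ≫ (toNorm.app _).f n =
      (toNorm.app J).f n ≫ ((simplexChains k).map π).f n :=
        congrArg (fun f => HomologicalComplex.Hom.f f n) (toNorm (k := k).naturality π)
    rw [← hφ π, ← reassoc_of% e', gen_map_assoc, Limits.comp_zero]
    exact h₀ _
  have e : (fromNorm.app J).f n ≫ (toNorm.app J).f n = 𝟙 _ :=
    congrArg (fun f => HomologicalComplex.Hom.f (NatTrans.app f J) n) (fromNorm_toNorm (k := k))
  rw [← Category.id_comp (φ J), ← e, Category.assoc, key, Limits.comp_zero]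

variable (k) in
/-- The cosimplicial cochain complex of normalized chains of simplices. -/
noncomputable abbrev simplexCochains : SimplexCategory ⥤ CochainComplex (ModuleCat.{u} k) ℤ :=
  simplexChains k ⋙ toCochain k

theorem toCochain_X_isZero (K : ChainComplex (ModuleCat.{u} k) ℕ) {p : ℤ} (hp : 0 < p) :
    IsZero (((toCochain k).obj K).X p) :=
  HomologicalComplex.isZero_extend_X _ _ _ fun i => by
    change -(i : ℤ) ≠ p
    lia

/-- The identification of the parts of a complex with those of its extension. -/
noncomputable def toCochainXIso {p : ℤ} {n : ℕ} (h : ComplexShape.embeddingDownNat.f n = p)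
    (K : ChainComplex (ModuleCat.{u} k) ℕ) : ((toCochain k).obj K).X p ≅ K.X n :=
  HomologicalComplex.extendXIso K _ h

theorem toCochain_map_f_hom {p : ℤ} {n : ℕ} (h : ComplexShape.embeddingDownNat.f n = p)
    {K L : ChainComplex (ModuleCat.{u} k) ℕ} (f : K ⟶ L) :
    ((toCochain k).map f).f p ≫ (toCochainXIso h L).hom = (toCochainXIso h K).hom ≫ f.f n := by
  rw [← Iso.eq_comp_inv, Category.assoc]
  exact HomologicalComplex.extendMap_f f _ h

theorem toCochain_inv_map_f {p : ℤ} {n : ℕ} (h : ComplexShape.embeddingDownNat.f n = p)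
    {K L : ChainComplex (ModuleCat.{u} k) ℕ} (f : K ⟶ L) :
    (toCochainXIso h K).inv ≫ ((toCochain k).map f).f p = f.f n ≫ (toCochainXIso h L).inv := by
  rw [Iso.inv_comp_eq]
  exact HomologicalComplex.extendMap_f f _ h

theorem toCochain_inv_map_f_assoc {p : ℤ} {n : ℕ} (h : ComplexShape.embeddingDownNat.f n = p)
    {K L : ChainComplex (ModuleCat.{u} k) ℕ} (f : K ⟶ L) {Z : ModuleCat.{u} k}
    (g : ((toCochain k).obj L).X p ⟶ Z) :
    (toCochainXIso h K).inv ≫ ((toCochain k).map f).f p ≫ g =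
      f.f n ≫ (toCochainXIso h L).inv ≫ g := by
  rw [← Category.assoc, toCochain_inv_map_f, Category.assoc]

theorem embeddingDownNat_f_toNat {p : ℤ} (hp : p ≤ 0) :
    ComplexShape.embeddingDownNat.f (-p).toNat = p := by
  change -((-p).toNat : ℤ) = p
  lia

theorem simplexCochains_exists_lift {p : ℤ} {M N : SimplexCategory ⥤ ModuleCat.{u} k}
    (φ : ∀ J, ((simplexCochains k).obj J).X p ⟶ N.obj J)
    (hφ : ∀ {J J'} (θ : J ⟶ J'), ((simplexCochains k).map θ).f p ≫ φ J' = φ J ≫ N.map θ)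
    (d : M ⟶ N)
    (h : ∀ J, ∃ y : ((simplexCochains k).obj J).X p ⟶ M.obj J, y ≫ d.app J = φ J) :
    ∃ ψ : ∀ J, ((simplexCochains k).obj J).X p ⟶ M.obj J,
      (∀ {J J'} (θ : J ⟶ J'), ((simplexCochains k).map θ).f p ≫ ψ J' = ψ J ≫ M.map θ) ∧
      ∀ J, ψ J ≫ d.app J = φ J := by
  rcases lt_or_ge 0 p with hp | hp
  · exact ⟨fun _ => 0, fun _ => by rw [comp_zero, zero_comp],
      fun J => (toCochain_X_isZero _ hp).eq_of_src _ _⟩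
  · have hn := embeddingDownNat_f_toNat hp
    generalize (-p).toNat = n at hn
    let e (J) : ((simplexCochains k).obj J).X p ≅ ((simplexChains k).obj J).X n :=
      toCochainXIso hn ((simplexChains k).obj J)
    have he {J J'} (θ : J ⟶ J') : (e J).inv ≫ ((simplexCochains k).map θ).f p =
        ((simplexChains k).map θ).f n ≫ (e J').inv := toCochain_inv_map_f hn _
    have he' {J J'} (θ : J ⟶ J') : ((simplexCochains k).map θ).f p ≫ (e J').hom =
        (e J).hom ≫ ((simplexChains k).map θ).f n := toCochain_map_f_hom hn _
    obtain ⟨ψ, hψ, hψ'⟩ := simplexChains_exists_lift (fun J => (e J).inv ≫ φ J)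
      (fun {J J'} θ => by rw [← Category.assoc, ← he θ, Category.assoc, hφ,
        Category.assoc]) d fun J => by
        obtain ⟨y, hy⟩ := h J
        exact ⟨(e J).inv ≫ y, by rw [Category.assoc, hy]⟩
    refine ⟨fun J => (e J).hom ≫ ψ J, fun {J J'} θ => ?_, fun J => ?_⟩
    · dsimp only
      rw [← Category.assoc, he' θ, Category.assoc, hψ, Category.assoc]
    · rw [Category.assoc, hψ', Iso.hom_inv_id_assoc]

theorem simplexCochains_to_const_eq_zero {p : ℤ} {M : ModuleCat.{u} k}
    (φ : ∀ J, ((simplexCochains k).obj J).X p ⟶ M)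
    (hφ : ∀ {J J'} (θ : J ⟶ J'), ((simplexCochains k).map θ).f p ≫ φ J' = φ J)
    (h : p = 0 → ((toCochain k).map (vertexMap k)).f p ≫ φ (SimplexCategory.mk 0) = 0) (J) :
    φ J = 0 := by
  rcases lt_or_ge 0 p with hp | hp
  · exact (toCochain_X_isZero _ hp).eq_of_src _ _
  · have hn := embeddingDownNat_f_toNat hp
    generalize (-p).toNat = n at hn
    let e (J) : ((simplexCochains k).obj J).X p ≅ ((simplexChains k).obj J).X n :=
      toCochainXIso hn ((simplexChains k).obj J)
    have he {J J'} (θ : J ⟶ J') : (e J).inv ≫ ((simplexCochains k).map θ).f p =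
        ((simplexChains k).map θ).f n ≫ (e J').inv := toCochain_inv_map_f hn _
    rw [← cancel_epi (e J).inv, Limits.comp_zero]
    refine simplexChains_to_const_eq_zero (fun J => (e J).inv ≫ φ J)
      (fun {J J'} θ => by rw [← Category.assoc, ← he θ, Category.assoc, hφ]) ?_ J
    rintro rfl
    refine (toCochain_inv_map_f_assoc hn (vertexMap k) (φ (SimplexCategory.mk 0))).symm.trans ?_
    exact (congrArg (_ ≫ ·) (h (by rw [← hn]; rfl))).trans Limits.comp_zero

end SimplexChainsProjective

namespace natCochains

variable {A K : SimplexCategory ⥤ CochainComplex (ModuleCat.{u} k) ℤ} {n : ℤ}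

/-- The natural cochain with a single component. -/
noncomputable def single {p q : ℤ} (ψ : ∀ J, (A.obj J).X p ⟶ (K.obj J).X q)
    (hψ : ∀ {J J'} (σ : J ⟶ J'), (A.map σ).f p ≫ ψ J' = ψ J ≫ (K.map σ).f q) (n : ℤ) :
    natCochains A K n :=
  ⟨fun J => Cochain.single (ψ J) n, by
    intro J J' σ p' q' h
    by_cases hp : p' = p
    · subst hp
      by_cases hq : q' = q
      · subst hq
        rw [Cochain.single_v, Cochain.single_v, hψ]
      · rw [Cochain.single_v_eq_zero' _ _ _ _ _ hq, Cochain.single_v_eq_zero' _ _ _ _ _ hq,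
          zero_comp, comp_zero]
    · rw [Cochain.single_v_eq_zero _ _ _ _ _ hp, Cochain.single_v_eq_zero _ _ _ _ _ hp,
        zero_comp, comp_zero]⟩

end natCochains

end

/-! ### Cohomology of hom_Δ by successive approximation -/

section

open Limits MonoidalCategory CochainComplex.HomComplex

variable {k : Type u} [CommRing k]

section Refinements

/-- A choice of preimages need not be linear, but it extends linearly to the free module on the
elements of A, which covers A. -/
theorem ModuleCat.exists_refinement {A X Y : ModuleCat.{u} k} (x : A ⟶ Y) (d : X ⟶ Y)
    (h : ∀ a : A, ∃ b : X, d.hom b = x.hom a) :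
    ∃ (A' : ModuleCat.{u} k) (π : A' ⟶ A) (_ : Epi π) (y : A' ⟶ X), π ≫ x = y ≫ d := by
  choose b hb using h
  refine ⟨ModuleCat.of k (A →₀ k), ModuleCat.ofHom (Finsupp.linearCombination k id), ?_,
    ModuleCat.ofHom (Finsupp.linearCombination k b), ?_⟩
  · rw [ModuleCat.epi_iff_surjective]
    intro a
    exact ⟨Finsupp.single a 1, by simp⟩
  · ext a
    simp [hb]

/-- The hypothesis h gives exactness away from degree 0 and injectivity on cohomology in degree 0;
the section in h' gives surjectivity there. -/
theorem quasiIso_to_single {O : CochainComplex (ModuleCat.{u} k) ℤ} {M : ModuleCat.{u} k}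
    (f : O ⟶ (HomologicalComplex.single _ _ 0).obj M)
    (h : ∀ (n : ℤ) (z : O.X n), (O.d n (n + 1)).hom z = 0 → (n = 0 → (f.f n).hom z = 0) →
      ∃ w, (O.d (n - 1) n).hom w = z)
    (h' : ∃ s : M ⟶ O.X 0, s ≫ O.d 0 1 = 0 ∧
      s ≫ f.f 0 = (HomologicalComplex.singleObjXSelf _ 0 M).inv) : QuasiIso f := by
  rw [quasiIso_iff]
  intro n
  have hp : (ComplexShape.up ℤ).prev n = n - 1 := by simp
  have hn : (ComplexShape.up ℤ).next n = n + 1 := by simp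
  by_cases h₀ : n = 0
  · subst h₀
    rw [quasiIsoAt_iff_isIso_homologyMap]
    have : Mono (HomologicalComplex.homologyMap f 0) := by
      rw [HomologicalComplex.mono_homologyMap_iff_up_to_refinements f _ 0 _ hp hn]
      intro A x hx y hxy
      refine ModuleCat.exists_refinement x _ fun a => h 0 _ ?_ fun _ => ?_
      · exact congrArg (fun g => g.hom a) hx
      · rw [show HomologicalComplex.d _ _ _ = 0 from
          HomologicalComplex.single_obj_d _ _ _ _ _, comp_zero] at hxy
        exact congrArg (fun g => g.hom a) hxy
    have : Epi (HomologicalComplex.homologyMap f 0) := by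
      rw [HomologicalComplex.epi_homologyMap_iff_up_to_refinements f _ 0 _ hp hn]
      intro A y _
      obtain ⟨s, hs, hs'⟩ := h'
      refine ⟨A, 𝟙 _, inferInstance,
        y ≫ (HomologicalComplex.singleObjXSelf (ComplexShape.up ℤ) 0 M).hom ≫ s, ?_, 0, ?_⟩
      · rw [Category.assoc, Category.assoc]
        refine (congrArg (fun g => y ≫ _ ≫ g) hs).trans ?_
        rw [comp_zero, comp_zero]
      · rw [Category.assoc, Category.assoc, hs', Iso.hom_inv_id, Category.comp_id,
          Category.id_comp, zero_comp, add_zero]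
    exact isIso_of_mono_of_epi _
  · rw [quasiIsoAt_iff_exactAt' _ _ (HomologicalComplex.exactAt_single_obj _ _ _ _ h₀),
      HomologicalComplex.exactAt_iff_exact_up_to_refinements _ _ _ _ hp hn]
    intro A x hx
    exact ModuleCat.exists_refinement x _ fun a => h n _ (congrArg (fun g => g.hom a) hx)
      fun e => (h₀ e).elim

end Refinements

section HomDelta

variable {K : SimplexCategory ⥤ CochainComplex (ModuleCat.{u} k) ℤ}
  {E : CochainComplex (ModuleCat.{u} k) ℤ} (ε : K ⟶ (Functor.const _).obj E)

/-- The property of an augmented cosimplicial complex to be objectwise homotopy equivalent to its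
augmentation, in degree `0`. -/
structure ObjectwiseContractible : Prop where
  exists_section : ∀ J, ∃ σ : E ⟶ K.obj J, σ ≫ ε.app J = 𝟙 E ∧
    Nonempty (Homotopy (𝟙 _) (ε.app J ≫ σ))
  isZero : ∀ J q, 0 < q → IsZero ((K.obj J).X q)
  isZero' : ∀ q ≠ 0, IsZero (E.X q)

namespace ObjectwiseContractible

variable {ε} (hε : ObjectwiseContractible ε)
include hε

/-- The homotopy H writes the identity as dH + Hd plus a term through ε. On a cycle killed by ε only
Hd remains, so x ≫ H is a primitive. -/
theorem exists_factor (J : SimplexCategory) {Z : ModuleCat.{u} k} {q : ℤ}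
    (x : Z ⟶ (K.obj J).X q) (hx : x ≫ (K.obj J).d q (q + 1) = 0) (hx' : x ≫ (ε.app J).f q = 0) :
    ∃ y : Z ⟶ (K.obj J).X (q - 1), y ≫ (K.obj J).d (q - 1) q = x := by
  obtain ⟨σ, -, ⟨H⟩⟩ := hε.exists_section J
  have h := H.comm q
  rw [dNext_eq (i' := q + 1) _ (by simp), prevD_eq (j' := q - 1) _ (by simp)] at h
  refine ⟨x ≫ H.hom q (q - 1), ?_⟩
  have h' := congrArg (x ≫ ·) h
  simp only [HomologicalComplex.id_f, HomologicalComplex.comp_f, Preadditive.comp_add] at h'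
  rw [reassoc_of% hx, reassoc_of% hx', zero_comp, zero_add, zero_comp, add_zero] at h'
  rw [Category.assoc, ← h']
  exact Category.comp_id x

/-- Let r = z - δw, which vanishes in source degrees above p = -N. Since δr = 0, its component at p
takes values in cycles of K. Provided that ε kills this component, it lifts through the differential
at each J, hence naturally by projectivity, and the lift corrects w in source degree p. -/
theorem exists_extension {n m : ℤ} (hnm : n + 1 = m) (z : natCochains (simplexCochains k) K m)
    (hz : natCochainsD _ _ m (m + 1) z = 0) (w : natCochains (simplexCochains k) K n) (N : ℕ)
    (hw : ∀ J p q h, -(N : ℤ) < p → ((natCochainsD _ _ n m w).1 J).v p q h = (z.1 J).v p q h)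
    (h₀ : ∀ h : 0 + m = 0, N = 0 → ((toCochain k).map (vertexMap k)).f 0 ≫
      ((z - natCochainsD _ _ n m w).1 (SimplexCategory.mk 0)).v 0 0 h ≫ (ε.app _).f 0 = 0) :
    ∃ w' : natCochains (simplexCochains k) K n,
      (∀ J p q h, -(N : ℤ) < p → (w'.1 J).v p q h = (w.1 J).v p q h) ∧
      ∀ J p q h, -((N + 1 : ℕ) : ℤ) < p →
        ((natCochainsD _ _ n m w').1 J).v p q h = (z.1 J).v p q h := by
  set r := z - natCochainsD _ _ n m w with hr
  have hr' : natCochainsD _ _ m (m + 1) r = 0 := by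
    rw [hr, map_sub, hz, zero_sub, neg_eq_zero]
    exact Subtype.ext (funext fun J => δ_δ n m (m + 1) (w.1 J))
  have hr₀ (J p q h) (hp : -(N : ℤ) < p) : (r.1 J).v p q h = 0 := by
    change (z.1 J - (natCochainsD _ _ n m w).1 J).v p q h = 0
    rw [Cochain.sub_v, hw _ _ _ _ hp, sub_self]
  obtain ⟨p, hp⟩ : ∃ p : ℤ, p = -N := ⟨_, rfl⟩
  obtain ⟨q, hq⟩ : ∃ q : ℤ, p + m = q := ⟨_, rfl⟩
  have hd (J) : (r.1 J).v p q hq ≫ (K.obj J).d q (q + 1) = 0 := by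
    have h₁ : (δ m (m + 1) (r.1 J)).v p (q + 1) (by lia) = 0 := by
      have : δ m (m + 1) (r.1 J) = 0 := congrArg (fun s => s.1 J) hr'
      rw [this, Cochain.zero_v]
    rw [δ_v m (m + 1) rfl _ p (q + 1) _ q (p + 1) (by lia) rfl,
      hr₀ J (p + 1) _ _ (by lia), comp_zero, smul_zero, add_zero] at h₁
    exact h₁
  -- The complex E is concentrated in degree 0. There the composite is a natural map to a constant
  -- module: it vanishes automatically if p < 0, and for p = 0 it is zero by the vertex condition
  -- `h₀`.
  have he (J) : (r.1 J).v p q hq ≫ (ε.app J).f q = 0 := by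
    by_cases hq₀ : q = 0
    · subst hq₀
      refine simplexCochains_to_const_eq_zero (M := E.X 0) (fun J => (r.1 J).v p 0 hq ≫
        (ε.app J).f 0)
        (fun {J J'} θ => ?_) (fun hp₀ => ?_) J
      · have e₁ := r.2 J J' θ p 0 hq
        have e₂ : (K.map θ).f 0 ≫ (ε.app J').f 0 = (ε.app J).f 0 :=
          congrArg (fun f => HomologicalComplex.Hom.f f 0) ((ε.naturality θ).trans
            (Category.comp_id _))
        rw [← Category.assoc, ← e₁, Category.assoc, e₂]
      · subst hp₀
        exact h₀ hq (by lia)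
    · exact (hε.isZero' q hq₀).eq_of_tgt _ _
  let d : K ⋙ HomologicalComplex.eval _ _ (q - 1) ⟶ K ⋙ HomologicalComplex.eval _ _ q :=
    { app := fun J => (K.obj J).d (q - 1) q
      naturality := fun J J' θ => (K.map θ).comm (q - 1) q }
  obtain ⟨ψ, hψ, hψ'⟩ : ∃ ψ : ∀ J, ((simplexCochains k).obj J).X p ⟶ (K.obj J).X (q - 1),
      (∀ {J J'} (θ : J ⟶ J'), ((simplexCochains k).map θ).f p ≫ ψ J' =
        ψ J ≫ (K.map θ).f (q - 1)) ∧
      ∀ J, ψ J ≫ (K.obj J).d (q - 1) q = (r.1 J).v p q hq := simplexCochains_exists_lift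
    (N := K ⋙ HomologicalComplex.eval _ _ q) (fun J => (r.1 J).v p q hq)
    (fun {J J'} θ => (r.2 J J' θ p q hq).symm) d
    (fun J => hε.exists_factor J _ (hd J) (he J))
  -- A cochain concentrated in source degree p has a differential concentrated in source degrees p
  -- and p - 1. The equations already obtained above p are not disturbed.
  let s : natCochains (simplexCochains k) K n := natCochains.single ψ hψ n
  refine ⟨w + s, fun J p' q' h hp' => ?_, fun J p' q' h hp' => ?_⟩
  · change (w.1 J + Cochain.single (ψ J) n).v p' q' h = _
    rw [Cochain.add_v, Cochain.single_v_eq_zero _ _ _ _ _ (by lia), add_zero]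
  · have e : ((natCochainsD _ _ n m s).1 J).v p' q' h = (r.1 J).v p' q' h := by
      change (δ n m (Cochain.single (ψ J) n)).v p' q' h = _
      rw [δ_v n m hnm _ p' q' _ (q' - 1) (p' + 1) rfl rfl,
        Cochain.single_v_eq_zero _ _ (p' + 1) _ _ (by lia), comp_zero, smul_zero, add_zero]
      by_cases hpp : p' = p
      · subst hpp
        obtain rfl : q' = q := by lia
        rw [Cochain.single_v]
        exact hψ' J
      · rw [Cochain.single_v_eq_zero _ _ _ _ _ hpp, zero_comp, hr₀ _ _ _ _ (by lia)]
    rw [map_add]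
    change ((natCochainsD _ _ n m w).1 J + (natCochainsD _ _ n m s).1 J).v p' q' h = _
    rw [Cochain.add_v, e]
    change _ + (z.1 J - (natCochainsD _ _ n m w).1 J).v p' q' h = _
    rw [Cochain.sub_v, add_sub_cancel]

/-- From N = 1 on, the vertex condition of `exists_extension` is vacuous, so the corrections can be
iterated forever. Each component is eventually constant, and the limit is taken componentwise. -/
theorem exists_primitive_of_one_le {n m : ℤ} (hnm : n + 1 = m)
    (z : natCochains (simplexCochains k) K m)
    (hz : natCochainsD _ _ m (m + 1) z = 0) (w₀ : natCochains (simplexCochains k) K n) (N : ℕ)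
    (hN : 1 ≤ N)
    (hw₀ : ∀ J p q h, -(N : ℤ) < p →
      ((natCochainsD _ _ n m w₀).1 J).v p q h = (z.1 J).v p q h) :
    ∃ w : natCochains (simplexCochains k) K n,
      (∀ J p q h, -(N : ℤ) < p → (w.1 J).v p q h = (w₀.1 J).v p q h) ∧
      natCochainsD _ _ n m w = z := by
  let P (i : ℕ) (w : natCochains (simplexCochains k) K n) : Prop := ∀ J p q h,
    -((N + i : ℕ) : ℤ) < p → ((natCochainsD _ _ n m w).1 J).v p q h = (z.1 J).v p q h
  have step (i : ℕ) (w : {w // P i w}) : ∃ w' : {w // P (i + 1) w}, ∀ J p q h,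
      -((N + i : ℕ) : ℤ) < p → (w'.1.1 J).v p q h = (w.1.1 J).v p q h := by
    obtain ⟨w', h₁, h₂⟩ := hε.exists_extension hnm z hz w.1 (N + i) w.2 (fun _ h => by lia)
    exact ⟨⟨w', h₂⟩, h₁⟩
  choose next hnext using step
  let seq (i : ℕ) : {w // P i w} := Nat.rec ⟨w₀, hw₀⟩ next i
  have hseq (i j : ℕ) (J p q h) (hp : -((N + i : ℕ) : ℤ) < p) :
      ((seq (i + j)).1.1 J).v p q h = ((seq i).1.1 J).v p q h := by
    induction j with
    | zero => rfl
    | succ j ih => exact (hnext (i + j) (seq (i + j)) J p q h (by push_cast at hp ⊢; lia)).trans ih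
  have hseq' (i j : ℕ) (hij : i ≤ j) (J p q h) (hp : -((N + i : ℕ) : ℤ) < p) :
      ((seq j).1.1 J).v p q h = ((seq i).1.1 J).v p q h := by
    obtain ⟨l, rfl⟩ := Nat.exists_eq_add_of_le hij
    exact hseq i l J p q h hp
  -- By stage 1 - p the component at p is final, and so is the equation there. The differential also
  -- involves the component at p + 1, which is final as well.
  let w : natCochains (simplexCochains k) K n :=
    ⟨fun J => Cochain.mk fun p q h => ((seq (1 - p).toNat).1.1 J).v p q h,
      fun J J' σ p q h => (seq (1 - p).toNat).1.2 J J' σ p q h⟩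
  have hw (J p q h) : (w.1 J).v p q h = ((seq (1 - p).toNat).1.1 J).v p q h := rfl
  refine ⟨w, fun J p q h hp => ?_, Subtype.ext (funext fun J => ?_)⟩
  · exact hseq' 0 _ (Nat.zero_le _) J p q h hp
  · refine Cochain.ext _ _ fun p q h => ?_
    refine Eq.trans ?_ ((seq (1 - p).toNat).2 J p q h (by push_cast; lia))
    change (δ n m (w.1 J)).v p q h = (δ n m ((seq (1 - p).toNat).1.1 J)).v p q h
    rw [δ_v n m hnm _ p q _ (q - 1) (p + 1) rfl rfl, δ_v n m hnm _ p q _ (q - 1) (p + 1) rfl rfl,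
      hw, hw, ← hseq' (1 - (p + 1)).toNat (1 - p).toNat (by lia) J (p + 1) q (by lia)
        (by push_cast; lia)]

theorem exists_primitive {n m : ℤ} (hnm : n + 1 = m) (z : natCochains (simplexCochains k) K m)
    (hz : natCochainsD _ _ m (m + 1) z = 0)
    (h₀ : ∀ h : 0 + m = 0, ((toCochain k).map (vertexMap k)).f 0 ≫
      (z.1 (SimplexCategory.mk 0)).v 0 0 h ≫ (ε.app _).f 0 = 0) :
    ∃ w, natCochainsD _ _ n m w = z := by
  obtain ⟨w, -, hw⟩ := hε.exists_extension hnm z hz 0 0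
    (fun J p q h hp => (toCochain_X_isZero _ (by simpa using hp)).eq_of_src _ _)
    (fun h _ => by rw [map_zero, sub_zero]; exact h₀ h)
  obtain ⟨w', -, hw'⟩ := hε.exists_primitive_of_one_le hnm z hz w 1 le_rfl hw
  exact ⟨w', hw'⟩

/-- A natural lift of η in source degree 0 has no differential there, since K vanishes in positive
degrees. Applied to the zero cocycle, `exists_primitive_of_one_le` extends it to a cocycle without
changing it in degree 0. -/
theorem exists_cocycle (η : simplexCochains k ⟶ (Functor.const _).obj E) :
    ∃ z : natCochains (simplexCochains k) K 0, natCochainsD _ _ 0 1 z = 0 ∧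
      ∀ J, (z.1 J).v 0 0 rfl ≫ (ε.app J).f 0 = (η.app J).f 0 := by
  let d : K ⋙ HomologicalComplex.eval _ _ 0 ⟶ (Functor.const _).obj (E.X 0) :=
    { app := fun J => (ε.app J).f 0
      naturality := fun J J' θ => congrArg (fun f => HomologicalComplex.Hom.f f 0)
        (ε.naturality θ) }
  obtain ⟨ψ, hψ, hψ'⟩ : ∃ ψ : ∀ J, ((simplexCochains k).obj J).X 0 ⟶ (K.obj J).X 0,
      (∀ {J J'} (θ : J ⟶ J'), ((simplexCochains k).map θ).f 0 ≫ ψ J' = ψ J ≫ (K.map θ).f 0) ∧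
      ∀ J, ψ J ≫ (ε.app J).f 0 = (η.app J).f 0 := simplexCochains_exists_lift
    (N := (Functor.const _).obj (E.X 0)) (fun J => (η.app J).f 0)
    (fun {J J'} θ => congrArg (fun f => HomologicalComplex.Hom.f f 0) (η.naturality θ)) d
      (fun J => by
      obtain ⟨σ, hσ, -⟩ := hε.exists_section J
      refine ⟨(η.app J).f 0 ≫ σ.f 0, (Category.assoc _ _ _).trans ?_⟩
      exact (congrArg (_ ≫ ·) (congrArg (fun f => HomologicalComplex.Hom.f f 0) hσ)).trans
        (Category.comp_id _))
  obtain ⟨z, hz, hz'⟩ := hε.exists_primitive_of_one_le (n := 0) (m := 1) rfl 0 (map_zero _)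
    (natCochains.single ψ hψ 0) 1 le_rfl (fun J p q h hp => by
      obtain hp | rfl : 0 < p ∨ p = 0 := by lia
      · exact (toCochain_X_isZero _ hp).eq_of_src _ _
      · exact (hε.isZero J q (by lia)).eq_of_tgt _ _)
  refine ⟨z, hz', fun J => ?_⟩
  rw [hz J 0 0 rfl (by simp)]
  exact (congrArg (· ≫ _) (Cochain.single_v _ _ _)).trans (hψ' J)

end ObjectwiseContractible

end HomDelta

end

/-! ### The augmentation of O(U) is a quasi-isomorphism -/

section

open Limits MonoidalCategory CochainComplex.HomComplex

variable (k : Type u) [CommRing k]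

theorem ιRealization_map {I : Type u} [Category.{u} I]
    (G : I ⥤ ChainComplex (ModuleCat.{u} k) ℕ) {X Y : Iᵒᵖ ⥤ Type u} (f : X ⟶ Y) {n : I}
    (x : X.obj (op n)) :
    ιRealization G x ≫ (chainRealization k G).map f = ιRealization G (f.app _ x) := by
  refine (Category.assoc _ _ _).trans ?_
  refine (Sigma.ι _ x ≫= coend.ι_map ((copowerBifunctor k G).map f) n).trans ?_
  refine (Category.assoc _ _ _).symm.trans (congrArg (· ≫ coend.ι _ n) ?_)
  dsimp [copowerBifunctor, sigmaConst]
  simp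

namespace TwoOrdinal

variable (U : TwoOrdinal.{u})

/-- The augmentations of the complexes `k[seq(U)^J] ⊗ C_*(Δ^•)^{⊠ cells}`. -/
noncomputable def seqAugmentation : U.seqChains k ⋙ toCochain k ⟶
    (Functor.const _).obj ((toCochain k).obj (unitComplex k)) where
  app J := (toCochain k).map (chainRealizationAugmentation (boxChainsAugmentation k U.cellList) _)
  naturality J J' σ := by
    refine Eq.trans ?_ (Category.comp_id _).symm
    refine ((toCochain k).map_comp _ _).symm.trans (congrArg (toCochain k).map ?_)
    refine realization_hom_ext _ fun n x => ?_
    refine (Category.assoc _ _ _).symm.trans ?_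
    refine (congrArg (· ≫ chainRealizationAugmentation _ _) (ιRealization_map k _ _ _)).trans ?_
    exact (ιRealization_augmentation _ _).trans (ιRealization_augmentation _ _).symm

theorem objectwiseContractible : ObjectwiseContractible (U.seqAugmentation k) where
  exists_section J := by
    obtain ⟨σ, hσ, ⟨H⟩⟩ := exists_section_homotopy (U := U) (J := Fin (J.len + 1)) k U.cellList
    refine ⟨(toCochain k).map σ, ?_, ⟨?_⟩⟩
    · exact ((toCochain k).map_comp _ _).symm.trans ((congrArg _ hσ).trans
        ((toCochain k).map_id _))
    · exact (Homotopy.ofEq ((toCochain k).map_id _).symm).trans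
        ((H.extend ComplexShape.embeddingDownNat).trans
          (Homotopy.ofEq ((toCochain k).map_comp _ _)))
  isZero J q hq := toCochain_X_isZero _ hq
  isZero' q hq := (HomologicalComplex.isZero_single_obj_X (ComplexShape.up ℤ) 0
    (baseMod k) q hq).of_iso
    ((HomologicalComplex.eval _ _ q).mapIso (toCochainUnitIso k))

/-- The augmentations of the chains of simplices. -/
noncomputable def simplexCochainsAugmentation : simplexCochains k ⟶
    (Functor.const _).obj ((toCochain k).obj (unitComplex k)) where
  app J := (toCochain k).map ((simplexChainsAugmentation k).app J)
  naturality _ _ σ := ((toCochain k).map_comp _ _).symm.trans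
    ((congrArg (toCochain k).map (((simplexChainsAugmentation k).naturality σ).trans
      (Category.comp_id _))).trans (Category.comp_id _).symm)

theorem vertexMap_simplexCochainsAugmentation :
    ((toCochain k).map (vertexMap k)).f 0 ≫
      ((simplexCochainsAugmentation k).app (SimplexCategory.mk 0)).f 0 = 𝟙 _ := by
  refine congrArg (fun f => HomologicalComplex.Hom.f f 0)
    (((toCochain k).map_comp _ _).symm.trans
      ((congrArg (toCochain k).map (freeChains.vertexMap_aug (k := k))).trans
        ((toCochain k).map_id _)))

/-- The isomorphism of `k` with the part of degree `0` of the unit complex. -/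
noncomputable def unitXIso : ((toCochain k).obj (unitComplex k)).X 0 ≅ baseMod k :=
  (HomologicalComplex.eval _ _ 0).mapIso (toCochainUnitIso k) ≪≫
    HomologicalComplex.singleObjXSelf (ComplexShape.up ℤ) 0 (baseMod k)

/-- The map on `k` induced by a natural cochain of degree `0`. -/
noncomputable def cochainScalar (z : natCochains (simplexCochains k)
    (U.seqChains k ⋙ toCochain k) 0) :
    ((toCochain k).obj (unitComplex k)).X 0 ⟶ ((toCochain k).obj (unitComplex k)).X 0 :=
  ((toCochain k).map (vertexMap k)).f 0 ≫ (z.1 (SimplexCategory.mk 0)).v 0 0 rfl ≫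
    ((U.seqAugmentation k).app (SimplexCategory.mk 0)).f 0

theorem augmentation_f_zero
    (z : natCochains (simplexCochains k) (U.seqChains k ⋙ toCochain k) 0) :
    ((U.augmentation k).f 0 ≫ (HomologicalComplex.singleObjXSelf _ 0 (baseMod k)).hom).hom z =
      ((unitXIso k).inv ≫ U.cochainScalar k z ≫ (unitXIso k).hom).hom (1 : k) := by
  dsimp only [augmentation, homDeltaAugmentation]
  erw [HomologicalComplex.mkHomToSingle_f, Category.assoc, Iso.inv_hom_id, Category.comp_id]
  dsimp [cochainScalar, unitXIso, seqAugmentation]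
  simp
  rfl

/-- In degree 0, vanishing of the augmentation of z is exactly the vertex condition of
`exists_primitive`. Lifting the augmentation of C_*(Δ^•) gives a cocycle of augmentation 1, which
splits the map. -/
theorem quasiIso_augmentation : QuasiIso (U.augmentation k) := by
  have hε := U.objectwiseContractible k
  refine quasiIso_to_single _ (fun n z hz hz' => ?_) ?_
  · refine hε.exists_primitive (n := n - 1) (m := n) (by lia) z hz fun h => ?_
    obtain rfl : n = 0 := by lia
    have h₁ : (unitXIso k).inv ≫ U.cochainScalar k z ≫ (unitXIso k).hom = 0 := by
      refine ModuleCat.hom_ext (LinearMap.ext_ring ?_)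
      refine (U.augmentation_f_zero k z).symm.trans ?_
      exact (congrArg (HomologicalComplex.singleObjXSelf (ComplexShape.up ℤ) 0
        (baseMod k)).hom.hom (hz' rfl)).trans (map_zero _)
    have h₂ : U.cochainScalar k z = 0 := by
      rw [← cancel_epi (unitXIso k).inv, ← cancel_mono (unitXIso k).hom, Category.assoc, h₁]
      simp
    exact h₂
  · obtain ⟨z, hz, hz'⟩ := hε.exists_cocycle (simplexCochainsAugmentation k)
    have h₂ : U.cochainScalar k z = 𝟙 _ := by
      rw [cochainScalar, hz']
      exact vertexMap_simplexCochainsAugmentation k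
    refine ⟨ModuleCat.ofHom (LinearMap.toSpanSingleton k _ z), ?_, ?_⟩
    · refine ModuleCat.hom_ext (LinearMap.ext_ring ?_)
      change natCochainsD _ _ 0 1 ((1 : k) • z) = 0
      rw [one_smul, hz]
    · rw [← cancel_mono (HomologicalComplex.singleObjXSelf (ComplexShape.up ℤ) 0 (baseMod k)).hom,
        Iso.inv_hom_id]
      refine ModuleCat.hom_ext (LinearMap.ext_ring ?_)
      refine (congrArg (fun y => ((U.augmentation k).f 0 ≫ (HomologicalComplex.singleObjXSelf _ 0
        (baseMod k)).hom).hom y) (one_smul k z)).trans ?_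
      refine (U.augmentation_f_zero k z).trans ?_
      rw [h₂, Category.id_comp, Iso.inv_hom_id]

end TwoOrdinal

end

/-! ### Coordinates on S(U, J): positions and amounts -/

theorem stdSimplex_sum_map {X Y : Type*} [Fintype X] [Fintype Y] (P : Y → Prop) [DecidablePred P]
    (θ : X → Y) (t : stdSimplex ℝ X) :
    (∑ y, if P y then stdSimplex.map θ t y else 0) = ∑ x, if P (θ x) then t x else 0 := by
  classical
  rw [← Finset.sum_fiberwise (M := ℝ) Finset.univ θ
    (fun x => if P (θ x) then t x else 0 : X → ℝ)]
  refine Finset.sum_congr rfl fun y _ => ?_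
  rw [stdSimplex.map_coe, FunOnFinite.linearMap_apply_apply]
  split_ifs with h
  · refine Finset.sum_congr rfl fun x hx => (if_pos ?_).symm
    rw [(Finset.mem_filter.1 hx).2]
    exact h
  · refine (Finset.sum_eq_zero fun x hx => if_neg ?_).symm
    rw [(Finset.mem_filter.1 hx).2]
    exact h

namespace TwoOrdinal

variable {U : TwoOrdinal.{u}}

section Comparison

variable {I I' : U.Cells → Type w} [∀ f, LinearOrder (I f)] [∀ f, LinearOrder (I' f)]

/-- Condition 2 forbids an element of a higher level between two elements of g. All of `I g` lies on
the same side of i, so the vertex 0 in `position` is an arbitrary choice. -/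
theorem CellOrder.le_iff_of_lt (s : CellOrder U I) {f g : U.Cells} (h : g.1 < f.1) (i : I f)
    (j j' : I g) : s.le ⟨f, i⟩ ⟨g, j⟩ ↔ s.le ⟨f, i⟩ ⟨g, j'⟩ := by
  have key (j j' : I g) (hj : s.le ⟨f, i⟩ ⟨g, j⟩) : s.le ⟨f, i⟩ ⟨g, j'⟩ := by
    refine (s.total _ _).resolve_right fun hj' => ?_
    exact h.not_gt (s.nested g f j' j i (fun e => h.ne (congrArg Sigma.fst e).symm) hj' hj)
  exact ⟨key j j', key j' j⟩

theorem CellOrder.pullback_le_iff (s : CellOrder U I) (θ : ∀ f, I' f →o I f) {f g : U.Cells}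
    (h : f ≠ g) (i : I' f) (j : I' g) :
    (s.pullback θ).le ⟨f, i⟩ ⟨g, j⟩ ↔ s.le ⟨f, θ f i⟩ ⟨g, θ g j⟩ :=
  ⟨s.le_of_pullback_le θ, fun hle => Or.inr ⟨fun e => h (congrArg Sigma.fst e), hle⟩⟩

end Comparison

section Coordinates

variable {n m : U.Cells → SimplexCategory}

/-- The vertices of a product of simplices. -/
abbrev Vertices (n : U.Cells → SimplexCategory) : Type u := Σ f, Fin ((n f).len + 1)

theorem sum_map_weights (P : Vertices n → Prop) [DecidablePred P]
    (θ : ∀ f, Fin ((m f).len + 1) →o Fin ((n f).len + 1))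
    (t : ∀ f, stdSimplex ℝ (Fin ((m f).len + 1))) :
    (∑ z, if P z then stdSimplex.map (θ z.1) (t z.1) z.2 else 0) =
      ∑ z : Vertices m, if P (sumMap θ z) then t z.1 z.2 else 0 := by
  refine (Fintype.sum_sigma _).trans (Eq.trans ?_ (Fintype.sum_sigma _).symm)
  exact Finset.sum_congr rfl fun f _ => stdSimplex_sum_map (fun i => P ⟨f, i⟩) (θ f) (t f)

open Classical in
/-- The total length of the subsegments, with label at a higher level than `g`, which precede those
with label `g`. -/
noncomputable def CellOrder.position (s : CellOrder U fun f => Fin ((n f).len + 1))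
    (t : ∀ f, stdSimplex ℝ (Fin ((n f).len + 1))) (g : U.Cells) : ℝ :=
  ∑ z : Vertices n, if g.1 < z.1.1 ∧ s.le z ⟨g, 0⟩ then t z.1 z.2 else 0

theorem CellOrder.position_pullback (s : CellOrder U fun f => Fin ((n f).len + 1))
    (θ : ∀ f, Fin ((m f).len + 1) →o Fin ((n f).len + 1))
    (t : ∀ f, stdSimplex ℝ (Fin ((m f).len + 1))) (g : U.Cells) :
    (s.pullback θ).position t g = s.position (fun f => stdSimplex.map (θ f) (t f)) g := by
  classical
  rw [position, position, sum_map_weights (fun z => g.1 < z.1.1 ∧ s.le z ⟨g, 0⟩)]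
  refine Finset.sum_congr rfl fun z _ => if_congr (and_congr_right fun h => ?_) rfl rfl
  obtain ⟨f, i⟩ := z
  rw [s.pullback_le_iff θ (fun e => h.ne (congrArg Sigma.fst e).symm)]
  exact s.le_iff_of_lt h _ _ _

/-- The possible amounts of the elements of `J`. -/
def amountSet (U : TwoOrdinal.{u}) (J : Type v) [Fintype J] : Set (J → ℝ) :=
  {q | (∀ j, 0 ≤ q j) ∧ ∑ j, q j = Fintype.card U.Cells}

theorem convex_amountSet (J : Type v) [Fintype J] : Convex ℝ (U.amountSet J) := by
  rintro p ⟨hp, hp'⟩ q ⟨hq, hq'⟩ a b ha hb hab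
  refine ⟨fun j => add_nonneg (mul_nonneg ha (hp j)) (mul_nonneg hb (hq j)), ?_⟩
  simp only [Pi.add_apply, Pi.smul_apply, smul_eq_mul]
  rw [Finset.sum_add_distrib, ← Finset.mul_sum, ← Finset.mul_sum, hp', hq', ← add_mul, hab, one_mul]

variable {J : Type v} [LinearOrder J]

/-- The total length of the subsegments with a given image in `J`. -/
noncomputable def Seq.amount (s : Seq U (fun f => Fin ((n f).len + 1)) J)
    (t : ∀ f, stdSimplex ℝ (Fin ((n f).len + 1))) (j : J) : ℝ :=
  ∑ z : Vertices n, if s.W z = j then t z.1 z.2 else 0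

theorem Seq.amount_pullback (s : Seq U (fun f => Fin ((n f).len + 1)) J)
    (θ : ∀ f, Fin ((m f).len + 1) →o Fin ((n f).len + 1))
    (t : ∀ f, stdSimplex ℝ (Fin ((m f).len + 1))) (j : J) :
    (s.pullback θ).amount t j = s.amount (fun f => stdSimplex.map (θ f) (t f)) j :=
  (sum_map_weights (fun z => s.W z = j) θ t).symm

/-- The coordinates of a representative of a point of `S(U, J)`. -/
noncomputable def polyCoords (y : PolyCells (U.seqPoly J)) : (U.Cells → ℝ) × (J → ℝ) :=
  ((Seq.toCellOrder (U := U) y.1.2).position y.2, Seq.amount (U := U) y.1.2 y.2)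

/-- The coordinates of a point of `S(U, J)`. -/
noncomputable def coords (y : U.S J) : (U.Cells → ℝ) × (J → ℝ) :=
  Quot.lift polyCoords (by
    rintro _ _ ⟨θ, x, t⟩
    exact Prod.ext (funext fun g => CellOrder.position_pullback _ _ _ _)
      (funext fun j => Seq.amount_pullback (U := U) x _ _ _)) y

theorem continuous_sum_weights (P : Vertices n → Prop) [DecidablePred P] :
    Continuous fun t : ∀ f, stdSimplex ℝ (Fin ((n f).len + 1)) =>
      ∑ z : Vertices n, if P z then t z.1 z.2 else 0 := by
  refine continuous_finsetSum _ fun z _ => ?_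
  split_ifs
  · exact (continuous_apply z.2).comp (continuous_subtype_val.comp (continuous_apply z.1))
  · exact continuous_const

open Classical in
theorem continuous_coords : Continuous (coords (U := U) (J := J)) := by
  refine continuous_quot_lift (f := polyCoords) _ (continuous_sigma fun p => ?_)
  exact Continuous.prodMk (continuous_pi fun g => continuous_sum_weights
      (fun z => g.1 < z.1.1 ∧ (Seq.toCellOrder (U := U) p.2).le z ⟨g, 0⟩))
    (continuous_pi fun j => continuous_sum_weights
      (fun z => Seq.W (U := U) p.2 z = j))

/-- The number of 2-cells of higher level than `c`. -/
noncomputable def higher (U : TwoOrdinal.{u}) (c : Arr U.C) : ℕ :=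
  Fintype.card {f : U.Cells // c < f.1}

/-- The possible positions of the 2-cells. -/
def positionSet (U : TwoOrdinal.{u}) : Set (U.Cells → ℝ) :=
  {p | (∀ g, 0 ≤ p g ∧ p g ≤ U.higher g.1) ∧
    ∀ (c : Arr U.C) (f g : Arr (U.F c)), f ≤ g → p ⟨c, f⟩ ≤ p ⟨c, g⟩}

variable [Fintype J]

/-- Each label of higher level contributes at most its total length 1. Monotonicity on a level comes
from condition 3: what precedes f also precedes g. -/
theorem CellOrder.position_mem (s : CellOrder U fun f => Fin ((n f).len + 1))
    (t : ∀ f, stdSimplex ℝ (Fin ((n f).len + 1))) : s.position t ∈ U.positionSet := by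
  classical
  refine ⟨fun g => ⟨Finset.sum_nonneg fun z _ => ?_, ?_⟩, fun c f g hfg => ?_⟩
  · split_ifs
    · exact (t z.1).2.1 _
    · exact le_rfl
  · have h₁ : s.position t g ≤ ∑ z : Vertices n, if g.1 < z.1.1 then t z.1 z.2 else 0 := by
      refine Finset.sum_le_sum fun z _ => ?_
      have := (t z.1).2.1 z.2
      split_ifs with h h'
      · exact le_rfl
      · exact absurd h.1 h'
      · exact this
      · exact le_rfl
    refine h₁.trans (le_of_eq ?_)
    have h₂ (f : U.Cells) : (∑ i, if g.1 < f.1 then (t f i : ℝ) else 0) =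
        if g.1 < f.1 then 1 else 0 := by
      split_ifs
      · exact (t f).2.2
      · simp
    rw [Fintype.sum_sigma, Finset.sum_congr rfl fun f _ => h₂ f, Finset.sum_boole, higher,
      Fintype.card_subtype]
  · refine Finset.sum_le_sum fun z _ => ?_
    have := (t z.1).2.1 z.2
    split_ifs with h h'
    · exact le_rfl
    · refine (h' ⟨h.1, s.trans _ _ _ h.2 ?_⟩).elim
      rcases hfg.eq_or_lt with rfl | hfg
      · exact s.refl _
      · exact s.separated c f g hfg _ _
    · exact this
    · exact le_rfl

theorem Seq.amount_mem (s : Seq U (fun f => Fin ((n f).len + 1)) J)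
    (t : ∀ f, stdSimplex ℝ (Fin ((n f).len + 1))) : s.amount t ∈ U.amountSet J := by
  refine ⟨fun j => Finset.sum_nonneg fun z _ => ?_, ?_⟩
  · split_ifs
    · exact (t z.1).2.1 _
    · exact le_rfl
  · simp only [amount]
    rw [Finset.sum_comm]
    simp only [Finset.sum_ite_eq, Finset.mem_univ, if_true]
    rw [Fintype.sum_sigma, Finset.sum_congr rfl fun f _ => stdSimplex.sum_eq_one (t f)]
    simp

theorem coords_mem (y : U.S J) : coords y ∈ U.positionSet ×ˢ U.amountSet J := by
  induction y using Quot.ind with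
  | mk y => exact ⟨CellOrder.position_mem _ _, Seq.amount_mem (U := U) y.1.2 y.2⟩

theorem convex_positionSet : Convex ℝ U.positionSet := by
  rintro p ⟨hp, hp'⟩ q ⟨hq, hq'⟩ a b ha hb hab
  refine ⟨fun g => ⟨?_, ?_⟩, fun c f g hfg => ?_⟩
  · exact add_nonneg (mul_nonneg ha (hp g).1) (mul_nonneg hb (hq g).1)
  · calc a * p g + b * q g ≤ a * U.higher g.1 + b * U.higher g.1 :=
        add_le_add (mul_le_mul_of_nonneg_left (hp g).2 ha)
          (mul_le_mul_of_nonneg_left (hq g).2 hb)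
      _ = U.higher g.1 := by rw [← add_mul, hab, one_mul]
  · exact add_le_add (mul_le_mul_of_nonneg_left (hp' c f g hfg) ha)
      (mul_le_mul_of_nonneg_left (hq' c f g hfg) hb)

end Coordinates

end TwoOrdinal

/-! ### Cumulative sums and common subdivisions -/

section Cumulative

variable {J : Type*} [LinearOrder J] [Fintype J]

theorem eq_of_cumulative_eq {x y : J → ℝ}
    (h : ∀ j, (∑ i, if i ≤ j then x i else 0) = ∑ i, if i ≤ j then y i else 0) : x = y := by
  funext j
  induction j using WellFoundedLT.induction with
  | ind j ih =>
    have e (z : J → ℝ) : (∑ i, if i ≤ j then z i else 0) =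
        (∑ i, if i < j then z i else 0) + z j := by
      rw [← Fintype.sum_ite_eq j z, ← Finset.sum_add_distrib]
      refine Finset.sum_congr rfl fun i _ => ?_
      rcases lt_trichotomy i j with hij | rfl | hij
      · simp [hij, hij.le, hij.ne']
      · simp
      · simp [hij.not_gt, hij.not_ge, hij.ne]
    have h' := h j
    rw [e, e, Finset.sum_congr rfl fun i _ => ite_congr rfl (fun hi => ih i hi) fun _ => rfl] at h'
    exact add_left_cancel h'

theorem cumulative_mono {q : J → ℝ} (hq : ∀ j, 0 ≤ q j) {j j' : J} (h : j ≤ j') :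
    (∑ i, if i ≤ j then q i else 0) ≤ ∑ i, if i ≤ j' then q i else 0 := by
  refine Finset.sum_le_sum fun i _ => ?_
  have := hq i
  split_ifs with h₁ h₂
  · exact le_rfl
  · exact absurd (h₁.trans h) h₂
  · exact this
  · exact le_rfl

/-- The cumulative sums cut [0, ∑ q) into half-open intervals, and j is the index of the one
containing u: the least index whose cumulative sum exceeds u. -/
theorem exists_cumulative_section {q : J → ℝ} (hq : ∀ j, 0 ≤ q j) {u : ℝ} (hu₀ : 0 ≤ u)
    (hu : u < ∑ j, q j) : ∃ j, ∀ j', j ≤ j' ↔ u < ∑ i, if i ≤ j' then q i else 0 := by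
  classical
  have hne : Nonempty J := by
    by_contra h
    rw [not_nonempty_iff] at h
    rw [Fintype.sum_empty] at hu
    exact hu.not_ge hu₀
  let s : Finset J := {j | u < ∑ i, if i ≤ j then q i else 0}
  have hs : s.Nonempty := by
    refine ⟨Finset.univ.max' Finset.univ_nonempty, Finset.mem_filter.2 ⟨Finset.mem_univ _, ?_⟩⟩
    rw [Finset.sum_congr rfl fun i _ => if_pos (Finset.univ.le_max' i (Finset.mem_univ i))]
    exact hu
  refine ⟨s.min' hs, fun j' => ⟨fun h => ?_, fun h => s.min'_le _ (by simpa [s] using h)⟩⟩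
  exact lt_of_lt_of_le (Finset.mem_filter.1 (s.min'_mem hs)).2 (cumulative_mono hq h)

end Cumulative

section Subdivision

theorem sum_partition_lt {m : ℕ} (c : ℕ → ℝ) (hc : StrictMonoOn c (Set.Iic (m + 1))) {j : ℕ}
    (hj : j ≤ m + 1) :
    (∑ i : Fin (m + 1), if c i < c j then c (i + 1) - c i else 0) = c j - c 0 := by
  rw [Fin.sum_univ_eq_sum_range (fun i => if c i < c j then c (i + 1) - c i else 0),
    ← Finset.sum_range_sub, ← Finset.sum_filter]
  refine Finset.sum_congr ?_ fun _ _ => rfl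
  ext i
  simp only [Finset.mem_filter, Finset.mem_range]
  constructor
  · rintro ⟨hi, h⟩
    exact (hc.lt_iff_lt (show i ≤ m + 1 by lia) hj).1 h
  · intro h
    exact ⟨by lia, hc (show i ≤ m + 1 by lia) hj h⟩

/-- The subdivision of the interval `[0, 1)` given by a finite set of points. -/
theorem exists_subdivision (B : Finset ℝ) (h₀ : 0 ∈ B) (hB : ∀ x ∈ B, 0 ≤ x ∧ x < 1) :
    ∃ (m : ℕ) (b : Fin (m + 1) → ℝ) (s : stdSimplex ℝ (Fin (m + 1))), m + 1 = B.card ∧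
      StrictMono b ∧ b 0 = 0 ∧ (∀ i, b i ∈ B) ∧ (∀ i, 0 < s i) ∧
      ∀ T, T ∈ B ∨ T = 1 → (∑ i, if b i < T then s i else 0) = T := by
  obtain ⟨m, hm⟩ : ∃ m, B.card = m + 1 := ⟨B.card - 1, by
    have := Finset.card_pos.2 ⟨_, h₀⟩
    lia⟩
  let b := B.orderEmbOfFin hm
  -- The points of B are continued by the end point 1; the weights will be the gaps between
  -- consecutive points, so sums of weights telescope.
  let c (i : ℕ) : ℝ := if h : i < m + 1 then b ⟨i, h⟩ else 1
  have hbB (i) : b i ∈ B := B.orderEmbOfFin_mem hm i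
  have hcb (i : Fin (m + 1)) : c i = b i := dif_pos i.2
  have hc1 : c (m + 1) = 1 := dif_neg (lt_irrefl _)
  have hc : StrictMonoOn c (Set.Iic (m + 1)) := by
    intro i hi j hj hij
    have hi' : i < m + 1 := lt_of_lt_of_le hij hj
    by_cases hj' : j < m + 1
    · simp only [c, dif_pos hi', dif_pos hj']
      exact b.strictMono hij
    · simp only [c, dif_pos hi', dif_neg hj']
      exact (hB _ (hbB _)).2
  have hc0 : c 0 = 0 := by
    obtain ⟨i, hi⟩ : ∃ i, b i = 0 := by
      have : (0 : ℝ) ∈ Set.range b := by rw [B.range_orderEmbOfFin hm]; exact h₀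
      exact this
    refine le_antisymm ?_ ((hB _ (hcb 0 ▸ hbB 0)).1)
    rw [← hi, ← hcb]
    exact hc.monotoneOn (show 0 ≤ m + 1 by lia) (show i.1 ≤ m + 1 by lia) (Nat.zero_le _)
  let s (i : Fin (m + 1)) : ℝ := c (i + 1) - c i
  have hs (i) : 0 < s i := sub_pos.2 (hc (show i.1 ≤ m + 1 by lia) (show i.1 + 1 ≤ m + 1 by lia)
    (Nat.lt_succ_self _))
  have key (T) (hT : T ∈ B ∨ T = 1) : (∑ i, if b i < T then s i else 0) = T := by
    obtain ⟨j, hj, rfl⟩ : ∃ j ≤ m + 1, c j = T := by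
      rcases hT with hT | rfl
      · have : T ∈ Set.range b := by rw [B.range_orderEmbOfFin hm]; exact hT
        obtain ⟨i, rfl⟩ := this
        exact ⟨i, i.2.le, hcb i⟩
      · exact ⟨m + 1, le_rfl, hc1⟩
    simp_rw [← hcb]
    exact (sum_partition_lt c hc hj).trans (by rw [hc0, sub_zero])
  refine ⟨m, b, ⟨s, fun i => (hs i).le, ?_⟩, hm.symm, b.strictMono, (hcb 0).symm.trans hc0, hbB, hs,
    key⟩
  have := key 1 (Or.inr rfl)
  rwa [Finset.sum_congr rfl fun i _ => if_pos (hB _ (hbB i)).2] at this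

theorem stdSimplex_cumulative_le_one {a : ℕ} (t : stdSimplex ℝ (Fin (a + 1))) (j) :
    (∑ i, if i ≤ j then t i else 0) ≤ 1 := by
  refine le_trans (Finset.sum_le_sum fun i _ => ?_) (stdSimplex.sum_eq_one t).le
  split_ifs
  · exact le_rfl
  · exact t.2.1 i

/-- The piece starting at `b i` is sent to the interval of t that contains it. By h, no cumulative
sum of t cuts a piece, so the total weights agree. -/
theorem exists_map_eq_of_subdivision {a m : ℕ} (t : stdSimplex ℝ (Fin (a + 1)))
    (b : Fin (m + 1) → ℝ)
    (hb : Monotone b) (hb' : ∀ i, 0 ≤ b i ∧ b i < 1) (s : stdSimplex ℝ (Fin (m + 1)))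
    (h : ∀ j, (∑ i, if b i < ∑ i, if i ≤ j then t i else 0 then s i else 0) =
      ∑ i, if i ≤ j then t i else 0) :
    ∃ θ : Fin (m + 1) →o Fin (a + 1), stdSimplex.map θ s = t := by
  have hex (i) := exists_cumulative_section (q := t) t.2.1 (hb' i).1
    (lt_of_lt_of_eq (hb' i).2 (stdSimplex.sum_eq_one t).symm)
  choose θ hθ using hex
  refine ⟨⟨θ, fun i j hij => (hθ i _).2 (lt_of_le_of_lt (hb hij) ((hθ j _).1 le_rfl))⟩, ?_⟩
  refine stdSimplex.ext (eq_of_cumulative_eq fun j => ?_)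
  refine (stdSimplex_sum_map (fun i => i ≤ j) _ s).trans (Eq.trans ?_ (h j))
  exact Finset.sum_congr rfl fun i _ => if_congr (hθ i j) rfl rfl

/-- Two points of simplices are images of an interior point of a simplex. -/
theorem exists_common_subdivision {a a' : ℕ} (t : stdSimplex ℝ (Fin (a + 1)))
    (t' : stdSimplex ℝ (Fin (a' + 1))) :
    ∃ (m : ℕ) (s : stdSimplex ℝ (Fin (m + 1))) (θ : Fin (m + 1) →o Fin (a + 1))
      (θ' : Fin (m + 1) →o Fin (a' + 1)), (∀ i, 0 < s i) ∧ stdSimplex.map θ s = t ∧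
      stdSimplex.map θ' s = t' := by
  classical
  let T (j) := ∑ i, if i ≤ j then t i else 0
  let T' (j) := ∑ i, if i ≤ j then t' i else 0
  have hnn {a : ℕ} (t : stdSimplex ℝ (Fin (a + 1))) (j) : 0 ≤ ∑ i, if i ≤ j then t i else 0 :=
    Finset.sum_nonneg fun i _ => by
      split_ifs
      · exact t.2.1 i
      · exact le_rfl
  -- The cuts are those of both t and t'. The value 1 is left out, as it is the end of the last
  -- piece and would start an empty one.
  let B : Finset ℝ := {x ∈ {0} ∪ Finset.univ.image T ∪ Finset.univ.image T' | x < 1}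
  have hT (j) : T j ∈ B ∨ T j = 1 := by
    rcases (stdSimplex_cumulative_le_one t j).lt_or_eq with h | h
    · exact Or.inl (Finset.mem_filter.2 ⟨by simp, h⟩)
    · exact Or.inr h
  have hT' (j) : T' j ∈ B ∨ T' j = 1 := by
    rcases (stdSimplex_cumulative_le_one t' j).lt_or_eq with h | h
    · exact Or.inl (Finset.mem_filter.2 ⟨by simp, h⟩)
    · exact Or.inr h
  have hB (x) (hx : x ∈ B) : 0 ≤ x ∧ x < 1 := by
    obtain ⟨hx, h⟩ := Finset.mem_filter.1 hx
    refine ⟨?_, h⟩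
    simp only [Finset.mem_union, Finset.mem_singleton, Finset.mem_image, Finset.mem_univ,
      true_and] at hx
    obtain (rfl | ⟨j, rfl⟩) | ⟨j, rfl⟩ := hx
    exacts [le_rfl, hnn t j, hnn t' j]
  obtain ⟨m, b, s, -, hb, -, hbB, hs, h⟩ := exists_subdivision B
    (Finset.mem_filter.2 ⟨by simp, zero_lt_one⟩) hB
  obtain ⟨θ, hθ⟩ := exists_map_eq_of_subdivision t b hb.monotone (fun i => hB _ (hbB i)) s
    (fun j => h _ (hT j))
  obtain ⟨θ', hθ'⟩ := exists_map_eq_of_subdivision t' b hb.monotone (fun i => hB _ (hbB i)) s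
    (fun j => h _ (hT' j))
  exact ⟨m, s, θ, θ', hs, hθ, hθ'⟩

end Subdivision

/-- For positive weights, a subset with the same total weight is the whole set. This recovers orders
and maps from their coordinates. -/
theorem iff_of_sum_ite_eq {X : Type*} [Fintype X] {P P' : X → Prop} [DecidablePred P]
    [DecidablePred P'] {w : X → ℝ} (hw : ∀ z, 0 < w z) (h : ∀ z, P z → P' z)
    (hs : (∑ z, if P z then w z else 0) = ∑ z, if P' z then w z else 0) (z : X) (hz : P' z) :
    P z := by
  by_contra hz'
  refine hs.not_lt (Finset.sum_lt_sum (fun y _ => ?_) ⟨z, Finset.mem_univ _, ?_⟩)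
  · have := (hw y).le
    split_ifs with h₁ h₂
    · exact le_rfl
    · exact absurd (h y h₁) h₂
    · exact this
    · exact le_rfl
  · rw [if_neg hz', if_pos hz]
    exact hw z

/-! ### Injectivity of the coordinates -/

namespace TwoOrdinal

variable {U : TwoOrdinal.{u}} {n : U.Cells → SimplexCategory}

/-- Inside a level, conditions 1 and 3 leave no choice for the order. -/
theorem CellOrder.le_of_fst_eq {I : U.Cells → Type w} [∀ f, LinearOrder (I f)]
    (s : CellOrder U I) (s' : CellOrder U I) {z w : Σ f, I f} (h : z.1.1 = w.1.1)
    (hzw : s.le z w) : s'.le z w := by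
  obtain ⟨⟨c, f⟩, i⟩ := z
  obtain ⟨⟨c', g⟩, j⟩ := w
  obtain rfl : c = c' := h
  rcases lt_trichotomy f g with hfg | rfl | hfg
  · exact s'.separated c f g hfg i j
  · rcases le_total i j with hij | hij
    · exact s'.agrees _ _ (Sigma.LE.fiber _ _ _ hij)
    · have := s.antisymm _ _ hzw (s.agrees _ _ (Sigma.LE.fiber _ _ _ hij))
      rw [this]
      exact s'.refl _
  · have := s.antisymm _ _ hzw (s.separated c g f hfg j i)
    have h₂ : (⟨c, f⟩ : U.Cells) = ⟨c, g⟩ := congrArg Sigma.fst this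
    simp only [Sigma.mk.injEq, heq_eq_eq, true_and] at h₂
    exact (hfg.ne h₂.symm).elim

/-- Suppose that z precedes g for s but not for s'. Then the higher elements preceding g for s' all
precede z, for s' and so by `ih` for s, and hence precede g for s. The two sets have the same
weight, so they are equal, although z is only in the second. -/
theorem CellOrder.le_of_position_eq {s s' : CellOrder U fun f => Fin ((n f).len + 1)}
    {t : ∀ f, stdSimplex ℝ (Fin ((n f).len + 1))} (ht : ∀ f i, 0 < t f i)
    (h : s.position t = s'.position t) {c : Arr U.C}
    (ih : ∀ z w : Vertices n, c < z.1.1 → c < w.1.1 → (s.le z w ↔ s'.le z w))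
    {z : Vertices n} {g : U.Cells} (hz : c < z.1.1) (hg : g.1 = c) (hzg : s.le z ⟨g, 0⟩) :
    s'.le z ⟨g, 0⟩ := by
  classical
  subst hg
  by_contra hc
  have hsub (w : Vertices n) (hw : g.1 < w.1.1 ∧ s'.le w ⟨g, 0⟩) :
      g.1 < w.1.1 ∧ s.le w ⟨g, 0⟩ := by
    refine ⟨hw.1, s.trans _ _ _ ((ih _ _ hw.1 hz).2 ?_) hzg⟩
    exact (s'.total w z).resolve_right fun hzw => hc (s'.trans _ _ _ hzw hw.2)
  exact hc (iff_of_sum_ite_eq (w := fun z : Vertices n => t z.1 z.2) (fun z => ht _ _) hsub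
    (congrFun h g).symm z ⟨hz, hzg⟩).2

/-- Descending induction on the level c: the orders agree above c by induction, inside c by
`le_of_fst_eq`, and between the two by `le_of_position_eq`. -/
theorem CellOrder.eq_of_position_eq {s s' : CellOrder U fun f => Fin ((n f).len + 1)}
    {t : ∀ f, stdSimplex ℝ (Fin ((n f).len + 1))} (ht : ∀ f i, 0 < t f i)
    (h : s.position t = s'.position t) : s = s' := by
  have key (c : Arr U.C) : ∀ z w : Vertices n, c ≤ z.1.1 → c ≤ w.1.1 →
      (s.le z w ↔ s'.le z w) := by
    induction c using WellFoundedGT.induction with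
    | ind c ih =>
      have ih' (z w : Vertices n) (hz : c < z.1.1) (hw : c < w.1.1) : s.le z w ↔ s'.le z w :=
        ih (min z.1.1 w.1.1) (lt_min hz hw) z w (min_le_left _ _) (min_le_right _ _)
      have hzw (z w : Vertices n) (hz : c < z.1.1) (hw : w.1.1 = c) : s.le z w ↔ s'.le z w := by
        obtain ⟨f, i⟩ := z
        obtain ⟨g, j⟩ := w
        have hfg : g.1 < f.1 := lt_of_eq_of_lt hw hz
        rw [s.le_iff_of_lt hfg i j 0, s'.le_iff_of_lt hfg i j 0]
        exact ⟨le_of_position_eq ht h ih' hz hw,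
          le_of_position_eq ht h.symm (fun z w hz hw => (ih' z w hz hw).symm) hz hw⟩
      intro z w hz hw
      rcases hz.eq_or_lt with hz | hz <;> rcases hw.eq_or_lt with hw | hw
      · exact ⟨s.le_of_fst_eq s' (hz.symm.trans hw), s'.le_of_fst_eq s (hz.symm.trans hw)⟩
      · have e := hzw w z hw hz.symm
        have hne : z ≠ w := by
          rintro rfl
          exact hw.ne hz
        constructor
        · intro hle
          refine (s'.total z w).resolve_right fun hle' => hne ?_
          exact s.antisymm _ _ hle (e.2 hle')
        · intro hle
          refine (s.total z w).resolve_right fun hle' => hne ?_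
          exact s'.antisymm _ _ hle (e.1 hle')
      · exact hzw z w hz hw.symm
      · exact ih' z w hz hw
  ext z w
  exact key (min z.1.1 w.1.1) z w (min_le_left _ _) (min_le_right _ _)

variable {J : Type v} [LinearOrder J] [Fintype J]

theorem Seq.sum_amount_le (x : Seq U (fun f => Fin ((n f).len + 1)) J)
    (t : ∀ f, stdSimplex ℝ (Fin ((n f).len + 1))) (j : J) :
    (∑ j', if j' ≤ j then x.amount t j' else 0) =
      ∑ z : Vertices n, if x.W z ≤ j then t z.1 z.2 else 0 := by
  have h (j' : J) : (if j' ≤ j then x.amount t j' else 0) =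
      ∑ z : Vertices n, if x.W z = j' then (if j' ≤ j then t z.1 z.2 else 0) else 0 := by
    split_ifs with h
    · rfl
    · simp
  rw [Finset.sum_congr rfl fun j' _ => h j', Finset.sum_comm]
  exact Finset.sum_congr rfl fun z _ => by rw [Finset.sum_ite_eq, if_pos (Finset.mem_univ _)]

/-- If x'.W z exceeded x.W z, the elements with x'.W at most x.W z would form an initial segment
without z, contained in those with x.W at most x.W z. Equal cumulative amounts make the two sets
equal, yet z is in the second. -/
theorem Seq.W_le_of_amount_eq {x x' : Seq U (fun f => Fin ((n f).len + 1)) J}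
    {t : ∀ f, stdSimplex ℝ (Fin ((n f).len + 1))} (ht : ∀ f i, 0 < t f i)
    (h : x.toCellOrder = x'.toCellOrder) (h' : x.amount t = x'.amount t) (z : Vertices n) :
    x'.W z ≤ x.W z := by
  by_contra hc
  have hsub (w : Vertices n) (hw : x'.W w ≤ x.W z) : x.W w ≤ x.W z := by
    refine x.monotone_W _ _ ?_
    rw [h]
    exact (x'.total w z).resolve_right fun hzw => hc ((x'.monotone_W _ _ hzw).trans hw)
  refine hc (iff_of_sum_ite_eq (w := fun z : Vertices n => t z.1 z.2) (fun z => ht _ _) hsub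
    ?_ z le_rfl)
  rw [← x.sum_amount_le, ← x'.sum_amount_le, h']

theorem Seq.eq_of_coords_eq {x x' : Seq U (fun f => Fin ((n f).len + 1)) J}
    {t : ∀ f, stdSimplex ℝ (Fin ((n f).len + 1))} (ht : ∀ f i, 0 < t f i)
    (h : x.position t = x'.position t) (h' : x.amount t = x'.amount t) : x = x' := by
  have e : x.toCellOrder = x'.toCellOrder := CellOrder.eq_of_position_eq ht h
  exact Seq.ext (congrArg CellOrder.le e) (funext fun z => le_antisymm
    (W_le_of_amount_eq ht e.symm h'.symm z) (W_le_of_amount_eq ht e h' z))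

/-- The gluing relation replaces both representatives by ones with the same multi-index and the same
positive weights; these are determined by their coordinates. -/
theorem coords_injective : Function.Injective (coords (U := U) (J := J)) := by
  intro y y' h
  induction y using Quot.ind with
  | mk y =>
  induction y' using Quot.ind with
  | mk y' =>
  obtain ⟨⟨n, x⟩, t⟩ := y
  obtain ⟨⟨n', x'⟩, t'⟩ := y'
  choose m s θ θ' hs hθ hθ' using fun f => exists_common_subdivision (t f) (t' f)
  obtain rfl : (fun f => stdSimplex.map (θ f) (s f)) = t := funext hθ
  obtain rfl : (fun f => stdSimplex.map (θ' f) (s f)) = t' := funext hθ'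
  let m' (f : U.Cells) := SimplexCategory.mk (m f)
  let η (f) : m' f ⟶ n f := SimplexCategory.Hom.mk (θ f)
  let η' (f) : m' f ⟶ n' f := SimplexCategory.Hom.mk (θ' f)
  have e := Quot.sound (PolyGlue.glue (X := U.seqPoly J) (m := m') η x s)
  have e' := Quot.sound (PolyGlue.glue (X := U.seqPoly J) (m := m') η' x' s)
  refine e.symm.trans (Eq.trans ?_ e')
  have h' := (congrArg coords e).trans (h.trans (congrArg coords e').symm)
  have hx : (U.seqPoly J).map (Quiver.Hom.op η) x = (U.seqPoly J).map (Quiver.Hom.op η') x' :=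
    Seq.eq_of_coords_eq (U := U) (n := m') (t := s) hs (congrArg Prod.fst h')
      (congrArg Prod.snd h')
  rw [hx]

end TwoOrdinal

/-! ### Placing unit segments at prescribed positions -/

section Placement

variable {Φ C : Type*} [LinearOrder Φ] [LinearOrder C]

/-- A disjoint placement in a segment of the unit segments labelled by the elements of `s`, which
may be cut in pieces: `E f u` is the place of the point `u` of the segment with label `f`, and
`a f T` is the length of the part of this segment which is placed before `T`. -/
structure IsPlacement (π : Φ → C) (p : Φ → ℝ) (s : Finset Φ) (E a : Φ → ℝ → ℝ) : Prop where
  strictMono : ∀ f ∈ s, StrictMono (E f)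
  ne : ∀ f ∈ s, ∀ g ∈ s, f ≠ g → ∀ u ∈ Set.Ico (0 : ℝ) 1, ∀ v ∈ Set.Ico (0 : ℝ) 1, E f u ≠ E g v
  mem : ∀ f ∈ s, ∀ u ∈ Set.Ico (0 : ℝ) 1, E f u ∈ Set.Ico (0 : ℝ) s.card
  length_mem : ∀ f ∈ s, ∀ T ∈ Set.Icc (0 : ℝ) s.card, a f T ∈ Set.Icc (0 : ℝ) 1
  lt_iff : ∀ f ∈ s, ∀ T ∈ Set.Icc (0 : ℝ) s.card, ∀ u ∈ Set.Ico (0 : ℝ) 1,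
    E f u < T ↔ u < a f T
  sum_length : ∀ T ∈ Set.Icc (0 : ℝ) s.card, ∑ f ∈ s, a f T = T
  nested : ∀ f ∈ s, ∀ g ∈ s, g ≠ f → ∀ u ∈ Set.Ico (0 : ℝ) 1, ∀ u' ∈ Set.Ico (0 : ℝ) 1,
    ∀ v ∈ Set.Ico (0 : ℝ) 1, E f u < E g v → E g v < E f u' → π g < π f
  separated : ∀ f ∈ s, ∀ g ∈ s, f < g → π f = π g → ∀ u ∈ Set.Ico (0 : ℝ) 1,
    ∀ v ∈ Set.Ico (0 : ℝ) 1, E f u < E g v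
  position : ∀ g ∈ s, ∑ f ∈ s with π g < π f, a f (E g 0) = p g

/-- The position of g counts only the labels of higher level among all that is placed before g
begins. -/
theorem IsPlacement.le_apply {π : Φ → C} {p : Φ → ℝ} {s : Finset Φ} {E a : Φ → ℝ → ℝ}
    (h : IsPlacement π p s E a) {g : Φ} (hg : g ∈ s) {u : ℝ} (hu : u ∈ Set.Ico (0 : ℝ) 1) :
    p g ≤ E g u := by
  have h₀ := h.mem g hg 0 (by simp)
  have h₁ : E g 0 ∈ Set.Icc (0 : ℝ) s.card := ⟨h₀.1, h₀.2.le⟩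
  calc p g = ∑ f ∈ s with π g < π f, a f (E g 0) := (h.position g hg).symm
    _ ≤ ∑ f ∈ s, a f (E g 0) := Finset.sum_le_sum_of_subset_of_nonneg (Finset.filter_subset _ _)
      fun f hf _ => (h.length_mem f hf _ h₁).1
    _ = E g 0 := h.sum_length _ h₁
    _ ≤ E g u := (h.strictMono g hg).monotone hu.1

/-- The map which makes room for a segment of length `1` at `p`. -/
noncomputable def makeRoom (p y : ℝ) : ℝ := if p ≤ y then y + 1 else y

/-- The length of the part of `[0, T)` outside a segment of length `1` starting at `p`. -/
noncomputable def lengthOutside (p T : ℝ) : ℝ := max (min T p) (T - 1)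

theorem strictMono_makeRoom (p : ℝ) : StrictMono (makeRoom p) := by
  intro y z h
  simp only [makeRoom]
  split_ifs <;> linarith

theorem makeRoom_lt_iff (p y T : ℝ) : makeRoom p y < T ↔ y < lengthOutside p T := by
  simp only [makeRoom, lengthOutside, lt_max_iff, lt_min_iff]
  split_ifs with h
  · constructor
    · intro h'
      right
      linarith
    · rintro (h' | h')
      · linarith
      · linarith
  · push Not at h
    constructor
    · intro h'
      exact Or.inl ⟨h', h⟩
    · rintro (h' | h')
      · exact h'.1
      · linarith

theorem lengthOutside_makeRoom (p y : ℝ) : lengthOutside p (makeRoom p y) = y := by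
  simp only [makeRoom, lengthOutside]
  split_ifs with h
  · rw [min_eq_right (by linarith), max_eq_right (by linarith), add_sub_cancel_right]
  · push Not at h
    rw [min_eq_left h.le, max_eq_left (by linarith)]

theorem lengthOutside_self (p : ℝ) : lengthOutside p p = p := by
  simp [lengthOutside]

theorem lengthOutside_mem {p N T : ℝ} (hp : p ∈ Set.Icc 0 N) (hT : T ∈ Set.Icc 0 (N + 1)) :
    lengthOutside p T ∈ Set.Icc 0 N :=
  ⟨le_max_of_le_left (le_min hT.1 hp.1),
    max_le ((min_le_right _ _).trans hp.2) (by linarith [hT.2])⟩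

theorem sub_lengthOutside_mem (p T : ℝ) : T - lengthOutside p T ∈ Set.Icc (0 : ℝ) 1 := by
  have h₁ : lengthOutside p T ≤ T := max_le (min_le_left _ _) (by linarith)
  have h₂ : T - 1 ≤ lengthOutside p T := le_max_right _ _
  constructor <;> linarith

theorem add_lt_iff_lt_sub_lengthOutside (p T : ℝ) {u : ℝ} (hu : u ∈ Set.Ico (0 : ℝ) 1) :
    p + u < T ↔ u < T - lengthOutside p T := by
  rw [lt_sub_comm, lengthOutside, max_lt_iff, min_lt_iff]
  have := hu.1
  have := hu.2
  constructor
  · intro h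
    exact ⟨Or.inr (by linarith), by linarith⟩
  · rintro ⟨h | h, _⟩ <;> linarith

theorem makeRoom_notMem (p y : ℝ) {u : ℝ} (hu : u ∈ Set.Ico (0 : ℝ) 1) : p + u ≠ makeRoom p y := by
  have := hu.1
  have := hu.2
  simp only [makeRoom]
  split_ifs with h
  · linarith
  · push Not at h
    linarith

/-- The new label x is the smallest, so its level is the lowest: its segment may cut the others and
is not cut by them. It goes in one piece to [p x, p x + 1), and whatever lies at or after p x is
shifted by 1. -/
theorem IsPlacement.insert_of_lt {π : Φ → C} (hπ : Monotone π) {p : Φ → ℝ} {s : Finset Φ}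
    {E a : Φ → ℝ → ℝ} (h : IsPlacement π p s E a) {x : Φ} (hx : ∀ f ∈ s, x < f)
    (hp : p x ∈ Set.Icc (0 : ℝ) s.card) (hp' : ∀ f ∈ s, π x = π f → p x ≤ p f) :
    IsPlacement π p (insert x s)
      (Function.update (fun g u => makeRoom (p x) (E g u)) x fun u => p x + u)
      (Function.update (fun g T => a g (lengthOutside (p x) T)) x
        fun T => T - lengthOutside (p x) T) := by
  have hxs : x ∉ s := fun hxs => lt_irrefl x (hx x hxs)
  have hne {f} (hf : f ∈ s) : f ≠ x := (hx f hf).ne'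
  have hcard : ((insert x s).card : ℝ) = s.card + 1 := by
    rw [Finset.card_insert_of_notMem hxs]
    push_cast
    rfl
  have h0 : (0 : ℝ) ∈ Set.Ico (0 : ℝ) 1 := by simp
  have hroom {y : ℝ} : y ≤ makeRoom (p x) y ∧ makeRoom (p x) y ≤ y + 1 := by
    simp only [makeRoom]
    split_ifs <;> constructor <;> linarith
  -- Labels on the level of x lie entirely at or after p x, so they are shifted past the new segment
  -- and never cut by it.
  have hlevel {f} (hf : f ∈ s) (hfx : π f ≤ π x) {u : ℝ} (hu : u ∈ Set.Ico (0 : ℝ) 1) :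
      p x ≤ E f u :=
    (hp' f hf (le_antisymm (hπ (hx f hf).le) hfx)).trans (h.le_apply hf hu)
  have hsum (T : ℝ) (S : Finset Φ) (hS : S ⊆ s) :
      ∑ f ∈ S, Function.update (fun g T => a g (lengthOutside (p x) T)) x
        (fun T => T - lengthOutside (p x) T) f T = ∑ f ∈ S, a f (lengthOutside (p x) T) :=
    Finset.sum_congr rfl fun f hf => by rw [Function.update_of_ne (hne (hS hf))]
  constructor
  · intro f hf
    rcases Finset.mem_insert.1 hf with rfl | hf
    · rw [Function.update_self]
      exact fun u v huv => by simpa using huv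
    · rw [Function.update_of_ne (hne hf)]
      exact fun u v huv => strictMono_makeRoom _ (h.strictMono f hf huv)
  · intro f hf g hg hfg u hu v hv
    rw [Finset.mem_insert] at hf hg
    rcases hf with rfl | hf <;> rcases hg with rfl | hg
    · exact (hfg rfl).elim
    · rw [Function.update_self, Function.update_of_ne (hne hg)]
      exact makeRoom_notMem _ _ hu
    · rw [Function.update_self, Function.update_of_ne (hne hf)]
      exact (makeRoom_notMem _ _ hv).symm
    · rw [Function.update_of_ne (hne hf), Function.update_of_ne (hne hg)]
      exact (strictMono_makeRoom _).injective.ne (h.ne f hf g hg hfg u hu v hv)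
  · intro f hf u hu
    rw [hcard]
    rcases Finset.mem_insert.1 hf with rfl | hf
    · rw [Function.update_self]
      exact ⟨add_nonneg hp.1 hu.1, add_lt_add_of_le_of_lt hp.2 hu.2⟩
    · rw [Function.update_of_ne (hne hf)]
      have := h.mem f hf u hu
      exact ⟨this.1.trans hroom.1, lt_of_le_of_lt hroom.2 (by linarith [this.2])⟩
  · intro f hf T hT
    rw [hcard] at hT
    rcases Finset.mem_insert.1 hf with rfl | hf
    · rw [Function.update_self]
      exact sub_lengthOutside_mem _ _
    · rw [Function.update_of_ne (hne hf)]
      exact h.length_mem f hf _ (lengthOutside_mem hp hT)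
  · intro f hf T hT u hu
    rw [hcard] at hT
    rcases Finset.mem_insert.1 hf with rfl | hf
    · rw [Function.update_self, Function.update_self]
      exact add_lt_iff_lt_sub_lengthOutside _ _ hu
    · rw [Function.update_of_ne (hne hf), Function.update_of_ne (hne hf), makeRoom_lt_iff]
      exact h.lt_iff f hf _ (lengthOutside_mem hp hT) u hu
  · intro T hT
    rw [hcard] at hT
    rw [Finset.sum_insert hxs, hsum T s subset_rfl, h.sum_length _ (lengthOutside_mem hp hT),
      Function.update_self, sub_add_cancel]
  · intro f hf g hg hgf u hu u' hu' v hv h₁ h₂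
    rw [Finset.mem_insert] at hf hg
    rcases hf with rfl | hf <;> rcases hg with rfl | hg
    · exact (hgf rfl).elim
    · rw [Function.update_self, Function.update_of_ne (hne hg)] at h₁ h₂
      have := hu.1
      have := hu'.2
      simp only [makeRoom] at h₁ h₂
      split_ifs at h₁ h₂ <;> linarith
    · rw [Function.update_self, Function.update_of_ne (hne hf)] at h₁ h₂
      by_contra hc
      have := hlevel hf (not_lt.1 hc) hu
      have := hv.2
      rw [makeRoom, if_pos (hlevel hf (not_lt.1 hc) hu)] at h₁
      linarith
    · rw [Function.update_of_ne (hne hf), Function.update_of_ne (hne hg)] at h₁ h₂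
      exact h.nested f hf g hg hgf u hu u' hu' v hv ((strictMono_makeRoom _).lt_iff_lt.1 h₁)
        ((strictMono_makeRoom _).lt_iff_lt.1 h₂)
  · intro f hf g hg hfg hπfg u hu v hv
    rw [Finset.mem_insert] at hf hg
    rcases hf with rfl | hf <;> rcases hg with rfl | hg
    · exact (lt_irrefl _ hfg).elim
    · have := hlevel hg hπfg.ge hv
      have := hu.2
      rw [Function.update_self, Function.update_of_ne (hne hg), makeRoom,
        if_pos (hlevel hg hπfg.ge hv)]
      linarith
    · exact (hfg.not_gt (hx f hf)).elim
    · rw [Function.update_of_ne (hne hf), Function.update_of_ne (hne hg)]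
      exact strictMono_makeRoom _ (h.separated f hf g hg hfg hπfg u hu v hv)
  · intro g hg
    rcases Finset.mem_insert.1 hg with rfl | hg
    · rw [Finset.filter_insert, if_neg (lt_irrefl _), hsum _ _ (Finset.filter_subset _ _),
        Function.update_self, add_zero, lengthOutside_self]
      -- The position of the new label counts only strictly higher levels, but the labels on its own
      -- level contribute nothing before its position, so the sum is that over all of s.
      refine Eq.trans ?_ (h.sum_length _ hp)
      refine Finset.sum_subset (Finset.filter_subset _ _) fun f hf hf' => ?_
      have hfg : ¬ π g < π f := fun hlt => hf' (Finset.mem_filter.2 ⟨hf, hlt⟩)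
      refine le_antisymm (not_lt.1 fun hlt => ?_) (h.length_mem f hf _ hp).1
      exact ((h.lt_iff f hf _ hp 0 h0).2 hlt).not_ge (hlevel hf (not_lt.1 hfg) h0)
    · rw [Finset.filter_insert, if_neg (hπ (hx g hg).le).not_gt, hsum _ _
      (Finset.filter_subset _ _),
        Function.update_of_ne (hne hg), lengthOutside_makeRoom]
      exact h.position g hg

/-- Labels are inserted from the largest down. The bound on p only involves higher levels, so it is
unaffected by the removal of the smallest label. -/
theorem exists_isPlacement {π : Φ → C} (hπ : Monotone π) {p : Φ → ℝ} (s : Finset Φ)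
    (hp : ∀ g ∈ s, 0 ≤ p g ∧ p g ≤ (s.filter fun f => π g < π f).card)
    (hp' : ∀ f ∈ s, ∀ g ∈ s, f ≤ g → π f = π g → p f ≤ p g) :
    ∃ E a, IsPlacement π p s E a := by
  induction s using Finset.induction_on_min with
  | empty =>
    refine ⟨0, 0, ⟨?_, ?_, ?_, ?_, ?_, ?_, ?_, ?_, ?_⟩⟩
    all_goals simp
  | insert x s hx ih =>
    have hi {f} (hf : f ∈ s) : f ∈ insert x s := Finset.mem_insert_of_mem hf
    obtain ⟨E, a, h⟩ := ih (fun g hg => by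
      have := hp g (hi hg)
      rwa [Finset.filter_insert, if_neg (hπ (hx g hg).le).not_gt] at this)
      (fun f hf g hg => hp' f (hi hf) g (hi hg))
    have hx' := hp x (Finset.mem_insert_self _ _)
    rw [Finset.filter_insert, if_neg (lt_irrefl _)] at hx'
    exact ⟨_, _, h.insert_of_lt hπ hx ⟨hx'.1, hx'.2.trans
      (by exact_mod_cast Finset.card_le_card (Finset.filter_subset _ _))⟩
      fun f hf => hp' x (Finset.mem_insert_self _ _) f (hi hf) (hx f hf).le⟩

end Placement

/-! ### Surjectivity of the coordinates, with a bounded number of pieces -/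

namespace TwoOrdinal

variable {U : TwoOrdinal.{u}} {J : Type v} [LinearOrder J]

theorem monotone_fst_ofLex : Monotone fun f : Σₗ c : Arr U.C, Arr (U.F c) => (ofLex f).1 :=
  fun f g h => by
    rcases Sigma.Lex.le_def.1 h with h | ⟨h, -⟩
    · exact h.le
    · exact h.le

/-- The element of `seq(U)` given by a placement of the segments labelled by the 2-cells. -/
theorem exists_seq_of_isPlacement {p : (Σₗ c : Arr U.C, Arr (U.F c)) → ℝ}
    {E a : (Σₗ c : Arr U.C, Arr (U.F c)) → ℝ → ℝ}
    (h : IsPlacement (fun f => (ofLex f).1) p Finset.univ E a) {m : ℕ} (b : Fin (m + 1) → ℝ)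
    (hb : StrictMono b) (hb' : ∀ i, b i ∈ Set.Ico (0 : ℝ) 1) (σ : ℝ → J)
    (hσ : MonotoneOn σ (Set.Ico 0 (Fintype.card (Σₗ c : Arr U.C, Arr (U.F c))))) :
    ∃ x : Seq U (fun _ => Fin (m + 1)) J, (∀ z w : Σ _ : U.Cells, Fin (m + 1),
      x.le z w ↔ E (toLex z.1) (b z.2) ≤ E (toLex w.1) (b w.2)) ∧
      ∀ z, x.W z = σ (E (toLex z.1) (b z.2)) := by
  have hu (f : Σₗ c : Arr U.C, Arr (U.F c)) : f ∈ Finset.univ := Finset.mem_univ f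
  refine ⟨{
    le := fun z w => E (toLex z.1) (b z.2) ≤ E (toLex w.1) (b w.2)
    trans := fun _ _ _ => le_trans
    antisymm := ?_
    total := fun _ _ => le_total _ _
    agrees := ?_
    nested := ?_
    separated := ?_
    W := fun z => σ (E (toLex z.1) (b z.2))
    monotone_W := ?_ }, fun _ _ => Iff.rfl, fun _ => rfl⟩
  · rintro ⟨f, i⟩ ⟨g, j⟩ h₁ h₂
    have e := le_antisymm h₁ h₂
    by_cases hfg : f = g
    · subst hfg
      exact congrArg (Sigma.mk f) (hb.injective ((h.strictMono _ (hu _)).injective e))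
    · exact (h.ne _ (hu (toLex f)) _ (hu (toLex g)) hfg _ (hb' i) _ (hb' j) e).elim
  · rintro _ _ ⟨f, i, j, hij⟩
    exact (h.strictMono _ (hu _)).monotone (hb.monotone hij)
  · intro f g i₁ i₂ i hgf h₁ h₂
    exact h.nested (toLex f) (hu _) (toLex g) (hu _) hgf _ (hb' i₁) _ (hb' i₂) _ (hb' i)
      (lt_of_le_of_ne h₁ (h.ne _ (hu _) _ (hu _) (Ne.symm hgf) _ (hb' _) _ (hb' _)))
      (lt_of_le_of_ne h₂ (h.ne _ (hu _) _ (hu _) hgf _ (hb' _) _ (hb' _)))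
  · intro c f g hfg i j
    exact (h.separated (toLex ⟨c, f⟩) (hu _) (toLex ⟨c, g⟩) (hu _)
      (Sigma.Lex.lt_def.2 (Or.inr ⟨rfl, hfg⟩)) rfl _ (hb' i) _ (hb' j)).le
  · intro z w hzw
    exact hσ (h.mem _ (hu _) _ (hb' _)) (h.mem _ (hu _) _ (hb' _)) hzw

/-- Each unit segment has to be cut only where another label begins or where the image in J changes.
The bound counts these cuts and is uniform in y, as compactness requires; all labels share one
subdivision, so a single m serves. -/
theorem exists_small_representative (U : TwoOrdinal.{u}) (J : Type v) [LinearOrder J] [Fintype J]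
    [Nonempty J] :
    ∃ M : ℕ, ∀ y ∈ U.positionSet ×ˢ U.amountSet J, ∃ m ≤ M,
      ∃ (x : Seq U (fun _ => Fin (m + 1)) J) (t : U.Cells → stdSimplex ℝ (Fin (m + 1))),
        polyCoords (U := U) ⟨⟨fun _ => SimplexCategory.mk m, x⟩, t⟩ = y := by
  classical
  let L := Σₗ c : Arr U.C, Arr (U.F c)
  refine ⟨1 + Fintype.card (L × L) + Fintype.card (L × J), ?_⟩
  rintro ⟨p, q⟩ ⟨⟨hp, hp'⟩, hq, hq'⟩
  let N := Fintype.card L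
  have hN : ∑ j, q j = (N : ℝ) := hq'
  obtain ⟨E, a, h⟩ := exists_isPlacement (π := fun f : L => (ofLex f).1) monotone_fst_ofLex
    (p := fun f => p (ofLex f)) Finset.univ (fun g _ => ⟨(hp (ofLex g)).1, (hp (ofLex g)).2.trans
      (le_of_eq (by
        rw [higher, Fintype.card_subtype]
        rfl))⟩) (by
      rintro ⟨c, f⟩ - ⟨c', g⟩ - hfg (rfl : c = c')
      refine hp' c f g ?_
      rcases Sigma.Lex.le_def.1 hfg with h | ⟨_, h⟩
      · exact (lt_irrefl _ h).elim
      · exact h)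
  have hu (f : L) : f ∈ Finset.univ := Finset.mem_univ f
  let Q (j : J) : ℝ := ∑ i, if i ≤ j then q i else 0
  have hQ (j) : Q j ∈ Set.Icc (0 : ℝ) N := by
    constructor
    · refine Finset.sum_nonneg fun i _ => ?_
      split_ifs
      · exact hq i
      · exact le_rfl
    · rw [← hN]
      refine Finset.sum_le_sum fun i _ => ?_
      split_ifs
      · exact le_rfl
      · exact hq i
  have h0 : (0 : ℝ) ∈ Set.Ico (0 : ℝ) 1 := by simp
  have hE (g : L) : E g 0 ∈ Set.Icc (0 : ℝ) N := Set.Ico_subset_Icc_self (h.mem g (hu g) 0 h0)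
  -- In the segment of f, the cut `a f (E g 0)` is made where g begins and `a f (Q j)` where the
  -- total length passes the cumulative amount `Q j`.
  let B₀ : Finset ℝ := {0} ∪ Finset.univ.image (fun z : L × L => a z.1 (E z.2 0)) ∪
    Finset.univ.image (fun z : L × J => a z.1 (Q z.2))
  let B : Finset ℝ := {x ∈ B₀ | x < 1}
  have hBcard : B.card ≤ 1 + Fintype.card (L × L) + Fintype.card (L × J) := by
    refine (Finset.card_filter_le _ _).trans ((Finset.card_union_le _ _).trans
      (add_le_add ((Finset.card_union_le _ _).trans (add_le_add ?_ ?_)) ?_))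
    · rw [Finset.card_singleton]
    · exact Finset.card_image_le
    · exact Finset.card_image_le
  have hmem {T : ℝ} (hT : T ∈ B₀) (hT' : T ≤ 1) : T ∈ B ∨ T = 1 := by
    rcases hT'.lt_or_eq with h | h
    · exact Or.inl (Finset.mem_filter.2 ⟨hT, h⟩)
    · exact Or.inr h
  have hB (x) (hx : x ∈ B) : 0 ≤ x ∧ x < 1 := by
    obtain ⟨hx, hlt⟩ := Finset.mem_filter.1 hx
    refine ⟨?_, hlt⟩
    simp only [B₀, Finset.mem_union, Finset.mem_singleton, Finset.mem_image, Finset.mem_univ,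
      true_and] at hx
    obtain (rfl | ⟨z, rfl⟩) | ⟨z, rfl⟩ := hx
    exacts [le_rfl, (h.length_mem _ (hu _) _ (hE _)).1, (h.length_mem _ (hu _) _ (hQ _)).1]
  obtain ⟨m, b, s, hm, hb, hb0, hbB, hs, hsum⟩ := exists_subdivision B
    (Finset.mem_filter.2 ⟨by simp [B₀], zero_lt_one⟩) hB
  have hb' (i) : b i ∈ Set.Ico (0 : ℝ) 1 := hB _ (hbB i)
  -- The point at place T goes to the least j with T < `Q j`; outside [0, N) the value is
  -- irrelevant.
  have hex (T : ℝ) : ∃ j : J, T ∈ Set.Ico (0 : ℝ) N → ∀ j', j ≤ j' ↔ T < Q j' := by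
    by_cases hT : T ∈ Set.Ico (0 : ℝ) N
    · obtain ⟨j, hj⟩ := exists_cumulative_section hq hT.1 (lt_of_lt_of_eq hT.2 hN.symm)
      exact ⟨j, fun _ => hj⟩
    · exact ⟨Classical.arbitrary J, fun hT' => (hT hT').elim⟩
  choose σ hσ using hex
  obtain ⟨x, hx, hxW⟩ := exists_seq_of_isPlacement h b hb hb' σ
    (fun T hT T' hT' hle => (hσ T hT _).2 (lt_of_le_of_lt hle ((hσ T' hT' _).1 le_rfl)))
  refine ⟨m, by lia, x, fun _ => s, Prod.ext (funext fun g => ?_)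
    (eq_of_cumulative_eq fun j => ?_)⟩
  · refine (Fintype.sum_sigma _).trans ?_
    -- The pieces of f that precede g are those starting before the cut `a f (E g 0)`. Since this
    -- cut is in B or equal to 1, their total length is exactly its value.
    have key (f : U.Cells) : (∑ i, if g.1 < f.1 ∧ x.le ⟨f, i⟩ ⟨g, 0⟩ then s i else 0) =
        if g.1 < f.1 then a (toLex f) (E (toLex g) 0) else 0 := by
      by_cases hlt : g.1 < f.1
      · rw [if_pos hlt]
        refine Eq.trans (Finset.sum_congr rfl fun i _ => if_congr ?_ rfl rfl)
          (hsum _ (hmem (by simp [B₀]) (h.length_mem _ (hu (toLex f)) _ (hE (toLex g))).2))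
        have hne : toLex f ≠ toLex g := fun e => hlt.ne (congrArg (fun f => (ofLex f).1) e).symm
        rw [and_iff_right hlt, hx, ← h.lt_iff _ (hu _) _ (hE _) _ (hb' i)]
        dsimp only
        rw [hb0]
        exact ⟨fun hle => lt_of_le_of_ne hle (h.ne _ (hu _) _ (hu _) hne _ (hb' i) _ h0), le_of_lt⟩
      · simp [hlt]
    refine (Finset.sum_congr rfl fun f _ => key f).trans ?_
    refine Eq.trans ?_ (h.position (toLex g) (hu _))
    exact (Finset.sum_filter _ _).symm
  · refine (x.sum_amount_le (n := fun _ => SimplexCategory.mk m) (fun _ => s) j).trans ?_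
    refine (Fintype.sum_sigma _).trans ?_
    have key (f : U.Cells) : (∑ i, if x.W ⟨f, i⟩ ≤ j then s i else 0) = a (toLex f) (Q j) := by
      have hQB : a (toLex f) (Q j) ∈ B₀ :=
        Finset.mem_union_right _ (Finset.mem_image.2 ⟨(toLex f, j), Finset.mem_univ _, rfl⟩)
      refine Eq.trans (Finset.sum_congr rfl fun i _ => if_congr ?_ rfl rfl)
        (hsum _ (hmem hQB (h.length_mem _ (hu (toLex f)) _ (hQ j)).2))
      have e : σ (E (toLex f) (b i)) ≤ j ↔ b i < a (toLex f) (Q j) := by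
        rw [hσ _ (h.mem _ (hu _) _ (hb' i)), ← h.lt_iff _ (hu _) _ (hQ j) _ (hb' i)]
      rw [hxW]
      exact e
    refine (Finset.sum_congr rfl fun f _ => key f).trans ?_
    exact (h.sum_length _ (hQ j)).trans rfl

end TwoOrdinal

/-! ### Compactness and the homeomorphisms of part (a) -/

namespace TwoOrdinal

instance (U : TwoOrdinal.{u}) (I : U.Cells → Type w) [∀ f, LinearOrder (I f)] [∀ f, Finite (I f)]
    (J : Type v) [LinearOrder J] [Finite J] : Finite (Seq U I J) :=
  Finite.of_injective (fun x : Seq U I J => (x.le, x.W)) fun _ _ h =>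
    Seq.ext (congrArg Prod.fst h) (congrArg Prod.snd h)

section

variable (U : TwoOrdinal.{u}) (J : Type v) [LinearOrder J] [Fintype J] [Nonempty J]

theorem exists_coords_eq {y : (U.Cells → ℝ) × (J → ℝ)} (hy : y ∈ U.positionSet ×ˢ U.amountSet J) :
    ∃ x : U.S J, coords x = y := by
  obtain ⟨M, hM⟩ := exists_small_representative U J
  obtain ⟨m, -, x, t, h⟩ := hM y hy
  exact ⟨Quot.mk _ ⟨⟨fun _ => SimplexCategory.mk m, x⟩, t⟩, h⟩

/-- By `coords_injective`, a representative with the right coordinates represents the point itself.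
A finite disjoint union of products of simplices, with m ≤ M, therefore covers S(U, J). -/
instance compactSpace_S : CompactSpace (U.S J) := by
  obtain ⟨M, hM⟩ := exists_small_representative U J
  let Y := Σ z : (Σ m : Fin (M + 1), Seq U (fun _ => Fin (m.1 + 1)) J),
    (U.Cells → stdSimplex ℝ (Fin (z.1.1 + 1)))
  let F : Y → U.S J := fun z =>
    Quot.mk _ ⟨⟨fun _ => SimplexCategory.mk z.1.1, z.1.2⟩, z.2⟩
  have hF : Continuous F := continuous_sigma fun z =>
    continuous_quot_mk.comp (continuous_sigmaMk (ι := Σ n : U.Cells → SimplexCategory,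
      (U.seqPoly J).obj (op n)) (σ := fun p => ∀ f, stdSimplex ℝ (Fin ((p.1 f).len + 1)))
      (i := ⟨fun _ => SimplexCategory.mk z.1.1, z.2⟩))
  have hs : Function.Surjective F := fun y => by
    obtain ⟨m, hm, x, t, h⟩ := hM _ (coords_mem y)
    exact ⟨⟨⟨⟨m, Nat.lt_succ_of_le hm⟩, x⟩, t⟩, coords_injective h⟩
  exact hs.compactSpace hF

/-- The space `S(U, J)` is the set of possible coordinates. -/
noncomputable def coordsHomeo : U.S J ≃ₜ ↥(U.positionSet ×ˢ U.amountSet J) :=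
  Continuous.homeoOfEquivCompactToT2
    (f := Equiv.ofBijective (fun y => ⟨coords y, coords_mem y⟩)
      ⟨fun _ _ h => coords_injective (congrArg Subtype.val h), fun y =>
        (exists_coords_eq U J y.2).imp fun _ h => Subtype.ext h⟩)
    (continuous_coords.subtype_mk _)

theorem contractibleSpace_S : ContractibleSpace (U.S J) := by
  classical
  have hne : (U.positionSet ×ˢ U.amountSet J).Nonempty := by
    refine ⟨(0, Pi.single (Classical.arbitrary J) (Fintype.card U.Cells : ℝ)),
      ⟨fun g => ⟨le_rfl, Nat.cast_nonneg _⟩, fun _ _ _ _ => le_rfl⟩, fun j => ?_, ?_⟩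
    · by_cases h : j = Classical.arbitrary J
      · subst h
        exact (Nat.cast_nonneg _).trans_eq (Pi.single_eq_same (M := fun _ => ℝ) _ _).symm
      · simp [Pi.single_eq_of_ne h]
    · simp
  have := (U.convex_positionSet.prod (convex_amountSet J)).contractibleSpace hne
  exact (coordsHomeo U J).contractibleSpace

end

section

variable (U : TwoOrdinal.{u})

/-- An element of `seq(U)` with outer colour a point is an allowed order. -/
def CellOrder.toSeq {U : TwoOrdinal.{u}} {I : U.Cells → Type w} [∀ f, LinearOrder (I f)]
    (s : CellOrder U I) : Seq U I PUnit.{1} where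
  toCellOrder := s
  W _ := PUnit.unit
  monotone_W _ _ _ := le_rfl

/-- The map of disjoint unions of cells inducing `S₀HomeoS`. -/
def polyCellsHomeo : PolyCells U.cellOrderPoly ≃ₜ PolyCells (U.seqPoly PUnit.{1}) where
  toFun z := ⟨⟨z.1.1, CellOrder.toSeq (U := U) z.1.2⟩, z.2⟩
  invFun z := ⟨⟨z.1.1, Seq.toCellOrder (U := U) z.1.2⟩, z.2⟩
  left_inv _ := rfl
  right_inv _ := rfl
  continuous_toFun := continuous_sigma fun z => continuous_sigmaMk
      (ι := Σ n : U.Cells → SimplexCategory, (U.seqPoly PUnit.{1}).obj (op n))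
      (σ := fun p => ∀ f, stdSimplex ℝ (Fin ((p.1 f).len + 1)))
      (i := ⟨z.1, CellOrder.toSeq (U := U) z.2⟩)
  continuous_invFun := continuous_sigma fun z => continuous_sigmaMk
      (ι := Σ n : U.Cells → SimplexCategory, U.cellOrderPoly.obj (op n))
      (σ := fun p => ∀ f, stdSimplex ℝ (Fin ((p.1 f).len + 1)))
      (i := ⟨z.1, Seq.toCellOrder (U := U) z.2⟩)

/-- The space `S(U)` is `S(U, J)` for a point `J`. -/
def S₀HomeoS : U.S₀ ≃ₜ U.S PUnit.{1} where
  toFun := Quot.map U.polyCellsHomeo (by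
    rintro _ _ ⟨θ, x, t⟩
    exact PolyGlue.glue (X := U.seqPoly PUnit.{1}) θ (CellOrder.toSeq (U := U) x) t)
  invFun := Quot.map U.polyCellsHomeo.symm (by
    rintro _ _ ⟨θ, x, t⟩
    exact PolyGlue.glue (X := U.cellOrderPoly) θ (Seq.toCellOrder (U := U) x) t)
  left_inv := by
    rintro ⟨z⟩
    rfl
  right_inv := by
    rintro ⟨z⟩
    rfl
  continuous_toFun := continuous_quot_lift _ (continuous_quot_mk.comp U.polyCellsHomeo.continuous)
  continuous_invFun :=
    continuous_quot_lift _ (continuous_quot_mk.comp U.polyCellsHomeo.symm.continuous)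

/-- A set of amounts is a simplex of size the number of 2-cells. -/
noncomputable def amountHomeo [Nonempty U.Cells] (J : Type v) [Fintype J] :
    ↥(U.amountSet J) ≃ₜ stdSimplex ℝ J where
  toFun q := ⟨fun j => q.1 j / Fintype.card U.Cells, fun j => div_nonneg (q.2.1 j)
    (Nat.cast_nonneg _),
    by
      rw [← Finset.sum_div, q.2.2, div_self (Nat.cast_ne_zero.2 Fintype.card_ne_zero)]⟩
  invFun t := ⟨fun j => t.1 j * Fintype.card U.Cells, fun j => mul_nonneg (t.2.1 j)
    (Nat.cast_nonneg _),
    by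
      rw [← Finset.sum_mul, t.2.2, one_mul]⟩
  left_inv q := Subtype.ext (funext fun j =>
    div_mul_cancel₀ _ (Nat.cast_ne_zero.2 Fintype.card_ne_zero))
  right_inv t := Subtype.ext (funext fun j =>
    mul_div_cancel_right₀ _ (Nat.cast_ne_zero.2 Fintype.card_ne_zero))
  continuous_toFun := Continuous.subtype_mk (continuous_pi fun j =>
    ((continuous_apply j).comp continuous_subtype_val).div_const _) _
  continuous_invFun := Continuous.subtype_mk (continuous_pi fun j =>
    ((continuous_apply j).comp continuous_subtype_val).mul_const _) _

noncomputable instance : Unique ↥(U.amountSet PUnit.{1}) where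
  default := ⟨fun _ => Fintype.card U.Cells, fun _ => Nat.cast_nonneg _, by simp⟩
  uniq q := Subtype.ext (funext fun j => by
    have h := q.2.2
    rw [Fintype.sum_unique] at h
    exact h)

/-- The space `S(U)` is the set of possible positions. -/
noncomputable def S₀HomeoPositionSet : U.S₀ ≃ₜ ↥U.positionSet :=
  U.S₀HomeoS.trans ((coordsHomeo U PUnit.{1}).trans
    ((Homeomorph.Set.prod _ _).trans (Homeomorph.prodUnique _ _)))

/-- If there are 2-cells, then `S(U, J)` is a product of `S(U)` and a simplex. -/
noncomputable def SHomeoProd [Nonempty U.Cells] (J : Type v) [LinearOrder J] [Fintype J]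
    [Nonempty J] : U.S J ≃ₜ U.S₀ × stdSimplex ℝ J :=
  (coordsHomeo U J).trans ((Homeomorph.Set.prod _ _).trans
    (U.S₀HomeoPositionSet.symm.prodCongr (U.amountHomeo J)))

end

end TwoOrdinal

/-! ### Monotone families as simplices, and part (b) -/

section MonotoneTuples

/-- The monotone families of points of the segment `[0, d]`. -/
def monotoneTuples (A : Type u) [Preorder A] (d : ℝ) : Set (A → ℝ) :=
  {p | (∀ a, 0 ≤ p a ∧ p a ≤ d) ∧ Monotone p}

theorem sum_fin_sub_eq {k : ℕ} (g : ℕ → ℝ) (j : Fin k) :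
    (∑ i : Fin k, if i ≤ j then g (i + 1) - g i else 0) = g (j + 1) - g 0 := by
  refine (Fin.sum_univ_eq_sum_range (fun i => if i ≤ j.1 then g (i + 1) - g i else 0) k).trans ?_
  rw [← Finset.sum_filter, ← Finset.sum_range_sub]
  congr 1
  ext i
  simp only [Finset.mem_filter, Finset.mem_range]
  lia

variable {k : ℕ} {d : ℝ}

/-- The scaled partial sums of a point of a simplex. -/
def partialSums (d : ℝ) (t : stdSimplex ℝ (Fin (k + 1))) (j : Fin k) : ℝ :=
  d * ∑ i, if i ≤ j.castSucc then t i else 0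

theorem partialSums_mem (hd : 0 < d) (t : stdSimplex ℝ (Fin (k + 1))) :
    partialSums d t ∈ monotoneTuples (Fin k) d := by
  refine ⟨fun j => ⟨mul_nonneg hd.le (Finset.sum_nonneg fun i _ => ?_), ?_⟩, fun i j h => ?_⟩
  · split_ifs
    · exact t.2.1 i
    · exact le_rfl
  · exact mul_le_of_le_one_right hd.le (stdSimplex_cumulative_le_one t _)
  · exact mul_le_mul_of_nonneg_left (cumulative_mono t.2.1 (Fin.castSucc_le_castSucc_iff.2 h)) hd.le

theorem partialSums_injective (hd : 0 < d) :
    Function.Injective (partialSums d : stdSimplex ℝ (Fin (k + 1)) → Fin k → ℝ) := by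
  intro t t' h
  refine Subtype.ext (eq_of_cumulative_eq fun j => ?_)
  induction j using Fin.lastCases with
  -- The full sum is 1 for every point of the simplex, which is why `partialSums` omits it.
  | last =>
    simp only [Fin.le_last, if_true]
    exact t.2.2.trans t'.2.2.symm
  | cast j => exact mul_left_cancel₀ hd.ne' (congrFun h j)

theorem exists_partialSums_eq (hd : 0 < d) {p : Fin k → ℝ} (hp : p ∈ monotoneTuples (Fin k) d) :
    ∃ t, partialSums d t = p := by
  -- The family p is framed by 0 and d; the barycentric coordinates are its k + 1 successive
  -- differences divided by d.
  let g : ℕ → ℝ := fun n => match n with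
    | 0 => 0
    | n + 1 => if h : n < k then p ⟨n, h⟩ else d
  have hg (n : ℕ) : g n ≤ g (n + 1) := by
    cases n with
    | zero =>
      dsimp only [g]
      split_ifs
      · exact (hp.1 _).1
      · exact hd.le
    | succ n =>
      dsimp only [g]
      split_ifs with h h'
      · exact hp.2 (Fin.mk_le_mk.2 n.le_succ)
      · exact (hp.1 _).2
      · lia
      · exact le_rfl
  have hk : g (k + 1) = d := dif_neg (lt_irrefl k)
  refine ⟨⟨fun i => (g (i + 1) - g i) / d, fun i => div_nonneg (sub_nonneg.2 (hg i)) hd.le, ?_⟩,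
    funext fun j => ?_⟩
  · rw [← Finset.sum_div, Fin.sum_univ_eq_sum_range (fun i => g (i + 1) - g i),
      Finset.sum_range_sub, hk, show g 0 = 0 from rfl, sub_zero, div_self hd.ne']
  · have h (i : Fin (k + 1)) : (if i ≤ j.castSucc then (g (i + 1) - g i) / d else 0) =
        (if i ≤ j.castSucc then g (i + 1) - g i else 0) / d := by
      split_ifs
      · rfl
      · rw [zero_div]
    refine (congrArg (d * ·) (Finset.sum_congr rfl fun i _ => h i)).trans ?_
    rw [← Finset.sum_div, sum_fin_sub_eq, mul_div_cancel₀ _ hd.ne']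
    exact (sub_zero _).trans (dif_pos j.2)

theorem continuous_partialSums :
    Continuous (partialSums d : stdSimplex ℝ (Fin (k + 1)) → Fin k → ℝ) := by
  refine continuous_pi fun j => continuous_const.mul (continuous_finsetSum _ fun i _ => ?_)
  split_ifs
  · exact (continuous_apply i).comp continuous_subtype_val
  · exact continuous_const

/-- The monotone families in a segment of positive length form a simplex. -/
noncomputable def simplexHomeoMonotoneTuples (k : ℕ) (hd : 0 < d) :
    stdSimplex ℝ (Fin (k + 1)) ≃ₜ ↥(monotoneTuples (Fin k) d) :=
  Continuous.homeoOfEquivCompactToT2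
    (f := Equiv.ofBijective (fun t => ⟨partialSums d t, partialSums_mem hd t⟩)
      ⟨fun _ _ h => partialSums_injective hd (congrArg Subtype.val h), fun p =>
        (exists_partialSums_eq hd p.2).imp fun _ h => Subtype.ext h⟩)
    (continuous_partialSums.subtype_mk _)

/-- The space of monotone families depends only on the order type of the set of indices. -/
def monotoneTuplesCongr {A B : Type*} [Preorder A] [Preorder B] (e : A ≃o B) (d : ℝ) :
    ↥(monotoneTuples A d) ≃ₜ ↥(monotoneTuples B d) where
  toFun p := ⟨fun b => p.1 (e.symm b), fun b => p.2.1 _, p.2.2.comp e.symm.monotone⟩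
  invFun p := ⟨fun a => p.1 (e a), fun a => p.2.1 _, p.2.2.comp e.monotone⟩
  left_inv p := Subtype.ext (funext fun a => congrArg p.1 (e.symm_apply_apply a))
  right_inv p := Subtype.ext (funext fun b => congrArg p.1 (e.apply_symm_apply b))
  continuous_toFun := by
    refine Continuous.subtype_mk (continuous_pi fun b => ?_) _
    exact (continuous_apply (e.symm b)).comp continuous_subtype_val
  continuous_invFun := by
    refine Continuous.subtype_mk (continuous_pi fun a => ?_) _
    exact (continuous_apply (e a)).comp continuous_subtype_val

/-- A segment of length 0 has to be treated apart: it occurs at levels with no 2-cell above them,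
and the factor is a point whatever the number of indices. -/
theorem exists_monotoneTuples_homeo (A : Type*) [LinearOrder A] [Fintype A] (n : ℕ) :
    ∃ k : ℕ, Nonempty (↥(monotoneTuples A n) ≃ₜ stdSimplex ℝ (Fin (k + 1))) := by
  rcases n.eq_zero_or_pos with rfl | hn
  · refine ⟨0, ⟨?_⟩⟩
    have : Unique ↥(monotoneTuples A ((0 : ℕ) : ℝ)) :=
      { default := ⟨fun _ => 0, fun _ => ⟨le_rfl, Nat.cast_nonneg _⟩, monotone_const⟩
        uniq := fun p => Subtype.ext (funext fun a =>
          le_antisymm ((p.2.1 a).2.trans_eq Nat.cast_zero) (p.2.1 a).1) }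
    exact Homeomorph.homeomorphOfUnique _ (stdSimplex ℝ (Fin 1))
  · exact ⟨Fintype.card A, ⟨(monotoneTuplesCongr (Fintype.orderIsoFinOfCardEq A rfl).symm _).trans
      (simplexHomeoMonotoneTuples _ (Nat.cast_pos.2 hn)).symm⟩⟩

end MonotoneTuples

namespace TwoOrdinal

variable (U : TwoOrdinal.{u})

/-- The positions of 2-cells with different images under `π` are independent. -/
noncomputable def positionSetHomeo :
    ↥U.positionSet ≃ₜ ∀ c : Arr U.C, ↥(monotoneTuples (Arr (U.F c)) (U.higher c)) where
  toFun p c := ⟨fun f => p.1 ⟨c, f⟩, fun f => p.2.1 ⟨c, f⟩, fun f g h => p.2.2 c f g h⟩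
  invFun p := ⟨fun f => (p f.1).1 f.2, fun f => (p f.1).2.1 f.2, fun c _ _ h => (p c).2.2 h⟩
  left_inv _ := rfl
  right_inv _ := rfl
  continuous_toFun := by
    refine continuous_pi fun c => Continuous.subtype_mk (continuous_pi fun f => ?_) _
    exact (continuous_apply (⟨c, f⟩ : U.Cells)).comp continuous_subtype_val
  continuous_invFun := Continuous.subtype_mk (continuous_pi fun f =>
    (continuous_apply f.2).comp (continuous_subtype_val.comp (continuous_apply f.1))) _

theorem exists_S₀_homeo_pi_simplex : ∃ (r : ℕ) (d : Fin r → ℕ),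
    Nonempty (U.S₀ ≃ₜ ∀ i, stdSimplex ℝ (Fin (d i + 1))) := by
  choose d hd using fun c : Arr U.C => exists_monotoneTuples_homeo (Arr (U.F c)) (U.higher c)
  let e := (Fintype.equivFin (Arr U.C)).symm
  exact ⟨_, fun i => d (e i), ⟨U.S₀HomeoPositionSet.trans (U.positionSetHomeo.trans
    ((Homeomorph.piCongrRight fun c => (hd c).some).trans
      (Homeomorph.piCongrLeft (Y := fun c => stdSimplex ℝ (Fin (d c + 1))) e).symm))⟩⟩

end TwoOrdinal

theorem mainTheorem4 (U : TwoOrdinal.{u}) :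
    (∀ (J : Type v) [LinearOrder J] [Fintype J] [Nonempty J],
      ContractibleSpace (U.S J) ∧
        (Nonempty U.Cells → Nonempty (U.S J ≃ₜ U.S₀ × stdSimplex ℝ J))) ∧
    (∃ (r : ℕ) (d : Fin r → ℕ), Nonempty (U.S₀ ≃ₜ ∀ i, stdSimplex ℝ (Fin (d i + 1)))) ∧
    (∀ (k : Type u) [CommRing k], QuasiIso (U.augmentation k)) := by
  refine ⟨?_, ?_, fun k _ => U.quasiIso_augmentation k⟩
  · exact fun J _ _ _ => ⟨TwoOrdinal.contractibleSpace_S U J, fun _ => ⟨U.SHomeoProd J⟩⟩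
  · exact U.exists_S₀_homeo_pi_simplex
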